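/- Fix $d\in\mathbb N$, $T\in(0,\infty)$ and a continuous $\zeta:\mathbb R^d\to\mathbb R_+$ such that $\zeta(x)\le C(1+\|x\|^p)$ for all $x$, for some $0\le p<2$ and $C\in(0,\infty)$. **Spaces.** Let $\mathcal M(\mathbb R^d)$ be the space of sub-probability measures on $\mathbb R^d$ with the topology of weak convergence, metrized by the bounded-Lipschitz metric $d_{BL}$, and let $\mathcal D=\mathbb D([0,T]:\mathcal M(\mathbb R^d))$ be the space of right-continuous paths with left limits, with the Skorokhod topology. Let $\mathcal C=C([0,T]:\mathbb R^d)$ with the uniform topology. Let $\mathcal R^W$ be the space of finite Borel measures $r$ on $\mathbb R^d\times[0,T]$ with $r(\mathbb R^d\times[0,t])=t$ for all $t\in[0,T]$ and $\int\|y\|\,r(dy\,dt)<\infty$, with the topology of weak convergence plus convergence of first moments. Let $\Xi=\mathcal C\times\mathcal C\times\mathcal R^W\times\mathbb R_+$ with coordinate maps $(\tilde b,b,\rho,\tilde\sigma)$, its Borel $\sigma$-field, and the filtration $\mathcal G_t=\sigma\{\tilde b_s,\,b_s,\,\rho(A\times[0,s]),\,\tilde\sigma: s\le t,\ A\in\mathcal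 B(\mathbb R^d)\}$. Let $\theta$ be the exponential distribution with rate $1$, and for $\Theta\in\mathcal P(\Xi)$ (the probability measures on $\Xi$) let $\Theta_{(4)}$ be the law of $\tilde\sigma$ under $\Theta$. **The function $I$.** Let $\mathcal P_\infty$ be the set of $\Theta\in\mathcal P(\Xi)$ such that $\Theta_{(4)}\ll\theta$ and, under $\Theta$: (1) $b$ is a $d$-dimensional standard $\mathcal G_t$-Brownian motion; (2) $\int_{\mathbb R^d\times[0,T]}\|y\|^2\,\rho(dy\,dt)<\infty$ a.s.; (3) a.s., $\tilde b_t=b_t+\int_{\mathbb R^d\times[0,t]}y\,\rho(dy\,ds)$ for all $t\in[0,T]$. With $R(\cdot\|\theta)$ the relative entropy, put $$\mathcal J(\Theta)=\mathbf E^\Theta\Big[\tfrac12\int_{\mathbb R^d\times[0,T]}\|y\|^2\,\rho(dy\,dt)\Big]+R(\Theta_{(4)}\|\theta).$$ Let $\mathcal P^1_\infty$ be the set of $\Theta\in\mathcal P_\infty$ with $\mathcal J(\Theta)<\infty$ for which there is a measurable $\varpi_\Theta:[0,T]\to\mathcal M(\mathbb R^d)$ (necessarily unique) with $$\langle f,\varpi_\Theta(t)\rangle=\mathbf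 E^\Theta\Big[f(\tilde b_t)\,\mathbf 1_{\{\tilde\sigma>\int_0^t\langle\zeta,\varpi_\Theta(s)\rangle ds\}}\Big]\quad\text{for all } f\in C_b(\mathbb R^d),\ t\in[0,T].$$ Define $I:\mathcal D\to[0,\infty]$ by $$I(\pi)=\inf\{\mathcal J(\Theta):\Theta\in\mathcal P^1_\infty,\ \varpi_\Theta=\pi\},\qquad \inf\emptyset=\infty.$$ **Proposition.** For every $M<\infty$ the set $\{\pi\in\mathcal D: I(\pi)\le M\}$ is compact. In particular, $I$ is lower semicontinuous, so $I$ is a good rate function. -/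

import Mathlib

open MeasureTheory ProbabilityTheory Filter Topology Set
open scoped ENNReal NNReal BoundedContinuousFunction

noncomputable section

namespace KilledBM

/-! ### Sub-probability measures with the bounded-Lipschitz metric -/

/-- The space `M(S)` of sub-probability measures on `S`. -/
structure SubProb (S : Type*) [MeasurableSpace S] where
  toMeasure : Measure S
  mass_le_one : toMeasure univ ≤ 1

instance {S : Type*} [MeasurableSpace S] (μ : SubProb S) : IsFiniteMeasure μ.toMeasure :=
  ⟨μ.mass_le_one.trans_lt ENNReal.one_lt_top⟩

/-- The unit ball `‖f‖_BL ≤ 1` of the bounded-Lipschitz norm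
`‖f‖_BL = max (sup |f|) (Lip f)`. -/
def BLBall (S : Type*) [PseudoEMetricSpace S] : Set (S → ℝ) :=
  {f | (∀ x, |f x| ≤ 1) ∧ LipschitzWith 1 f}

/-- The bounded-Lipschitz distance `d_BL(μ, ν) = sup_{‖f‖_BL ≤ 1} |⟨μ - ν, f⟩|`
(it is at most `2`, hence finite). -/
def dBL {S : Type*} [PseudoEMetricSpace S] [MeasurableSpace S] (μ ν : SubProb S) : ℝ≥0∞ :=
  ⨆ f ∈ BLBall S, edist (∫ x, f x ∂μ.toMeasure) (∫ x, f x ∂ν.toMeasure)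

theorem eq_of_dBL_eq_zero {S : Type*} [PseudoEMetricSpace S] [MeasurableSpace S] [BorelSpace S]
    {μ ν : SubProb S} (h : dBL μ ν = 0) : μ = ν := by
  have hBL : ∀ f ∈ BLBall S, ∫ x, f x ∂μ.toMeasure = ∫ x, f x ∂ν.toMeasure := by
    intro f hf
    have h1 : edist (∫ x, f x ∂μ.toMeasure) (∫ x, f x ∂ν.toMeasure) ≤ dBL μ ν :=
      le_iSup₂_of_le f hf le_rfl
    rw [h] at h1
    exact edist_eq_zero.1 (le_antisymm h1 bot_le)
  have hclosed : ∀ F : Set S, IsClosed F → μ.toMeasure F = ν.toMeasure F := by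
    intro F hF
    have hpos : ∀ n : ℕ, (0 : ℝ) < 1 / ((n : ℝ) + 1) := fun n => by positivity
    have hlim : Tendsto (fun n : ℕ => 1 / ((n : ℝ) + 1)) atTop (𝓝 0) :=
      tendsto_one_div_add_atTop_nhds_zero_nat
    have e1 := tendsto_integral_thickenedIndicator_of_isClosed μ.toMeasure hF hpos hlim
    have e2 := tendsto_integral_thickenedIndicator_of_isClosed ν.toMeasure hF hpos hlim
    have key : ∀ n : ℕ, ∫ x, (thickenedIndicator (hpos n) F x : ℝ) ∂μ.toMeasure
        = ∫ x, (thickenedIndicator (hpos n) F x : ℝ) ∂ν.toMeasure := by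
      intro n
      have hmem : (fun x => (1 / ((n : ℝ) + 1)) * (thickenedIndicator (hpos n) F x : ℝ))
          ∈ BLBall S := by
        constructor
        · intro x
          have h0 : (0 : ℝ) ≤ (thickenedIndicator (hpos n) F x : ℝ) := NNReal.coe_nonneg _
          have h1 : (thickenedIndicator (hpos n) F x : ℝ) ≤ 1 := by
            exact_mod_cast thickenedIndicator_le_one (hpos n) F x
          have h2 : 1 / ((n : ℝ) + 1) ≤ 1 := by
            rw [div_le_one (by positivity)]
            linarith [(Nat.cast_nonneg n : (0 : ℝ) ≤ n)]
          rw [abs_of_nonneg (mul_nonneg (hpos n).le h0)]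
          exact mul_le_one₀ h2 h0 h1
        · have hL := lipschitzWith_thickenedIndicator (hpos n) F
          have hL2 : LipschitzWith ((1 / ((n : ℝ) + 1)).toNNReal)
              (fun r : ℝ≥0 => (1 / ((n : ℝ) + 1)) * (r : ℝ)) := by
            refine LipschitzWith.of_dist_le_mul fun a b => ?_
            rw [Real.dist_eq, ← mul_sub, abs_mul, abs_of_pos (hpos n),
              Real.coe_toNNReal _ (hpos n).le]
            rfl
          have h3 := hL2.comp hL
          rwa [mul_inv_cancel₀ (by simpa using hpos n)] at h3
      have := hBL _ hmem
      rw [integral_const_mul, integral_const_mul] at this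
      exact mul_left_cancel₀ (hpos n).ne' this
    have e3 := tendsto_nhds_unique (e1.congr key) e2
    exact (measureReal_eq_measureReal_iff).1 e3
  have : μ.toMeasure = ν.toMeasure := by
    refine ext_of_generate_finite _ ?_ isPiSystem_isClosed (fun F hF => hclosed F hF)
      (hclosed univ isClosed_univ)
    rw [BorelSpace.measurable_eq (α := S), borel_eq_generateFrom_isClosed]
  cases μ; cases ν; simpa using this

/-- `M(S)` as a metric space; the metric `d_BL` metrizes weak convergence when `S` is Polish. -/
instance {S : Type*} [PseudoEMetricSpace S] [MeasurableSpace S] [BorelSpace S] :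
    EMetricSpace (SubProb S) where
  edist := dBL
  edist_self μ := by simp [dBL]
  edist_comm μ ν := by simp [dBL, edist_comm]
  edist_triangle μ ν κ := iSup₂_le fun f hf =>
    (edist_triangle _ (∫ x, f x ∂ν.toMeasure) _).trans
      (add_le_add (le_iSup₂_of_le f hf le_rfl) (le_iSup₂_of_le f hf le_rfl))
  eq_of_edist_eq_zero h := eq_of_dBL_eq_zero h

instance {S : Type*} [PseudoEMetricSpace S] [MeasurableSpace S] [BorelSpace S] :
    MeasurableSpace (SubProb S) := borel _

instance {S : Type*} [PseudoEMetricSpace S] [MeasurableSpace S] [BorelSpace S] :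
    BorelSpace (SubProb S) := ⟨rfl⟩

/-! ### The Skorokhod space -/

/-- The time interval `[0,T]`. -/
abbrev Time (T : ℝ) : Type := Set.Icc (0 : ℝ) T

/-- The space `D([0,T] : S)` of right-continuous functions with left limits. -/
structure Skorokhod (T : ℝ) (S : Type*) [TopologicalSpace S] where
  toFun : Time T → S
  right_cts : ∀ t, ContinuousWithinAt toFun (Ici t) t
  left_lim : ∀ t, ∃ l, Tendsto toFun (𝓝[<] t) (𝓝 l)

instance (T : ℝ) (S : Type*) [TopologicalSpace S] :
    CoeFun (Skorokhod T S) (fun _ => Time T → S) := ⟨Skorokhod.toFun⟩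

/-- The Skorokhod (`J₁`) distance
`d(x,y) = inf_λ max (sup_t |λ(t) - t|) (sup_t d(x(t), y(λ(t))))`, the infimum being over all
increasing bijections `λ` of `[0,T]` onto itself. -/
def dSkorokhod {T : ℝ} {S : Type*} [EMetricSpace S] (x y : Skorokhod T S) : ℝ≥0∞ :=
  ⨅ l : Time T ≃o Time T, max (⨆ t, edist (l t) t) (⨆ t, edist (x t) (y (l t)))

theorem dSkorokhod_comm_le {T : ℝ} {S : Type*} [EMetricSpace S] (x y : Skorokhod T S) :
    dSkorokhod x y ≤ dSkorokhod y x := by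
  refine le_iInf fun l => iInf_le_of_le l.symm (max_le_max ?_ ?_)
  · refine iSup_le fun t => le_iSup_of_le (l.symm t) ?_
    rw [l.apply_symm_apply, edist_comm]
  · refine iSup_le fun t => le_iSup_of_le (l.symm t) ?_
    rw [l.apply_symm_apply, edist_comm]

theorem dSkorokhod_triangle {T : ℝ} {S : Type*} [EMetricSpace S] (x y z : Skorokhod T S) :
    dSkorokhod x z ≤ dSkorokhod x y + dSkorokhod y z := by
  refine le_of_forall_gt fun c hc => ?_
  obtain ⟨a, ha, b, hb, hab⟩ := ENNReal.exists_add_lt_of_add_lt hc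
  obtain ⟨l, hl⟩ := iInf_lt_iff.1 ha
  obtain ⟨m, hm⟩ := iInf_lt_iff.1 hb
  obtain ⟨hl1, hl2⟩ := max_lt_iff.1 hl
  obtain ⟨hm1, hm2⟩ := max_lt_iff.1 hm
  refine (iInf_le_of_le (l.trans m) (max_le (iSup_le fun t => ?_) (iSup_le fun t => ?_))).trans_lt hab
  · have h1 := (le_iSup (fun t => edist (l t) t) t).trans hl1.le
    have h2 := (le_iSup (fun t => edist (m t) t) (l t)).trans hm1.le
    exact (edist_triangle _ (l t) _).trans ((add_comm a b).symm ▸ add_le_add h2 h1)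
  · have h1 := (le_iSup (fun t => edist (x t) (y (l t))) t).trans hl2.le
    have h2 := (le_iSup (fun t => edist (y t) (z (m t))) (l t)).trans hm2.le
    exact (edist_triangle _ (y (l t)) _).trans (add_le_add h1 h2)

theorem eq_of_dSkorokhod_eq_zero {T : ℝ} {S : Type*} [EMetricSpace S] {x y : Skorokhod T S}
    (h : dSkorokhod x y = 0) : x = y := by
  have hex : ∀ ε : ℝ≥0∞, 0 < ε → ∃ l : Time T ≃o Time T,
      (∀ t, edist (l t) t < ε) ∧ ∀ t, edist (x t) (y (l t)) < ε := by
    intro ε hε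
    have h' : dSkorokhod x y < ε := h ▸ hε
    obtain ⟨l, hl⟩ := iInf_lt_iff.1 h'
    obtain ⟨h1, h2⟩ := max_lt_iff.1 hl
    exact ⟨l, fun t => (le_iSup (fun t => edist (l t) t) t).trans_lt h1,
      fun t => (le_iSup (fun t => edist (x t) (y (l t))) t).trans_lt h2⟩
  have hpt : ∀ t, x t = y t := by
    intro t
    by_cases ht : IsTop t
    · refine edist_eq_zero.1 (le_antisymm (le_of_forall_gt fun ε hε => ?_) bot_le)
      obtain ⟨l, -, hl⟩ := hex ε hε
      have : l t = t := le_antisymm (ht _) (by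
        have := l.monotone (ht (l.symm t))
        rwa [l.apply_symm_apply] at this)
      simpa [this] using hl t
    · refine edist_eq_zero.1 (le_antisymm (ENNReal.le_of_forall_pos_le_add fun ε hε _ => ?_) bot_le)
      have hε3 : (0 : ℝ≥0∞) < ε / 3 := ENNReal.div_pos (by exact_mod_cast hε.ne') (by norm_num)
      have hx := (x.right_cts t) (Metric.eball_mem_nhds (x t) hε3)
      have hy := (y.right_cts t) (Metric.eball_mem_nhds (y t) hε3)
      obtain ⟨r, hr, hsub⟩ := Metric.mem_nhdsWithin_iff.1 (inter_mem hx hy)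
      obtain ⟨v, htv⟩ : ∃ v, t < v := by by_contra! hcon; exact ht hcon
      have htv' : (t : ℝ) < v := htv
      set w : ℝ := min (v : ℝ) (t + r / 2) with hw
      have htw : (t : ℝ) < w := lt_min htv' (by linarith)
      have hwv : w ≤ v := min_le_left _ _
      have hwr : w ≤ t + r / 2 := min_le_right _ _
      let s : Time T := ⟨w, t.2.1.trans htw.le, hwv.trans v.2.2⟩
      have hη : 0 < min (w - t) (r / 2) := lt_min (by linarith) (by linarith)
      obtain ⟨l, hl1, hl2⟩ := hex (min (ε / 3) (ENNReal.ofReal (min (w - t) (r / 2))))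
        (lt_min hε3 (ENNReal.ofReal_pos.2 hη))
      have h1 : |(l s : ℝ) - w| < min (w - t) (r / 2) := by
        have h := (hl1 s).trans_le (min_le_right _ _)
        rw [edist_dist, ENNReal.ofReal_lt_ofReal_iff hη] at h
        exact h
      have h1a := h1.trans_le (min_le_left _ _)
      have h1b := h1.trans_le (min_le_right _ _)
      rw [abs_lt] at h1a h1b
      have hs : s ∈ Metric.ball t r ∩ Ici t := by
        refine ⟨?_, show (t : ℝ) ≤ w from htw.le⟩
        change |w - (t : ℝ)| < r
        rw [abs_lt]; constructor <;> linarith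
      have hls : l s ∈ Metric.ball t r ∩ Ici t := by
        refine ⟨?_, show (t : ℝ) ≤ l s by linarith⟩
        change |(l s : ℝ) - (t : ℝ)| < r
        rw [abs_lt]; constructor <;> linarith
      have hxs : edist (x s) (x t) ≤ ε / 3 := le_of_lt (hsub hs).1
      have hyl : edist (y (l s)) (y t) ≤ ε / 3 := le_of_lt (hsub hls).2
      have hxy : edist (x s) (y (l s)) ≤ ε / 3 := ((hl2 s).trans_le (min_le_left _ _)).le
      calc edist (x t) (y t)
          ≤ edist (x t) (x s) + edist (x s) (y (l s)) + edist (y (l s)) (y t) :=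
            edist_triangle4 _ _ _ _
        _ ≤ ε / 3 + ε / 3 + ε / 3 := by
            rw [edist_comm (x t)]
            gcongr
        _ = 0 + ε := by rw [ENNReal.add_thirds, zero_add]
  cases x; cases y
  simp only [Skorokhod.mk.injEq]
  exact funext hpt

/-- The Skorokhod space with the Skorokhod topology. -/
instance {T : ℝ} {S : Type*} [EMetricSpace S] : EMetricSpace (Skorokhod T S) where
  edist := dSkorokhod
  edist_self x := le_antisymm (iInf_le_of_le (OrderIso.refl _) (by simp)) bot_le
  edist_comm x y := le_antisymm (dSkorokhod_comm_le x y) (dSkorokhod_comm_le y x)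
  edist_triangle := dSkorokhod_triangle
  eq_of_edist_eq_zero := eq_of_dSkorokhod_eq_zero

/-! ### The canonical space -/

/-- `ℝ^d` with the Euclidean norm. -/
abbrev E (d : ℕ) : Type := EuclideanSpace ℝ (Fin d)

/-- `C([0,T] : ℝ^d)` with the uniform topology. -/
abbrev PathSpace (d : ℕ) (T : ℝ) : Type := C(Time T, E d)

instance (d : ℕ) (T : ℝ) : MeasurableSpace (PathSpace d T) := borel _

instance (d : ℕ) (T : ℝ) : BorelSpace (PathSpace d T) := ⟨rfl⟩

/-- The space `R^W` of finite Borel measures `r` on `ℝ^d × [0,T]` with `r(ℝ^d × [0,t]) = t` for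
all `t ∈ [0,T]` and finite first moment in `y`. -/
structure RelaxedControl (d : ℕ) (T : ℝ) where
  toFiniteMeasure : FiniteMeasure (E d × Time T)
  time_marginal : ∀ t : Time T,
    (toFiniteMeasure : Measure (E d × Time T)) (univ ×ˢ Iic t) = ENNReal.ofReal t
  first_moment : ∫⁻ p, ‖p.1‖ₑ ∂(toFiniteMeasure : Measure (E d × Time T)) < ∞

/-- The underlying measure of a relaxed control. -/
def RelaxedControl.toMeasure {d : ℕ} {T : ℝ} (r : RelaxedControl d T) :
    Measure (E d × Time T) := r.toFiniteMeasure

/-- The topology of `R^W`: weak convergence plus convergence of first moments. -/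
instance (d : ℕ) (T : ℝ) : TopologicalSpace (RelaxedControl d T) :=
  TopologicalSpace.induced
    (fun r => (r.toFiniteMeasure, ∫ p, ‖p.1‖ ∂r.toMeasure)) inferInstance

instance (d : ℕ) (T : ℝ) : MeasurableSpace (RelaxedControl d T) := borel _

instance (d : ℕ) (T : ℝ) : BorelSpace (RelaxedControl d T) := ⟨rfl⟩

/-- The canonical space `Ξ = C × C × R^W × ℝ₊`.  All factors are separable metrizable, so the
product `σ`-algebra carried by this type is the Borel `σ`-algebra of the product. -/
abbrev Xi (d : ℕ) (T : ℝ) : Type :=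
  PathSpace d T × PathSpace d T × RelaxedControl d T × ℝ≥0

variable {d : ℕ} {T : ℝ}

/-- First canonical variable: the controlled path `b̃`. -/
def ctrlPath (ξ : Xi d T) : PathSpace d T := ξ.1

/-- Second canonical variable: the driving path `b`. -/
def drivPath (ξ : Xi d T) : PathSpace d T := ξ.2.1

/-- Third canonical variable: the relaxed control `ρ`, as a measure. -/
def control (ξ : Xi d T) : Measure (E d × Time T) := ξ.2.2.1.toMeasure

/-- Fourth canonical variable: the threshold `σ̃`. -/
def threshold (ξ : Xi d T) : ℝ≥0 := ξ.2.2.2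

/-- The canonical filtration
`G_t = σ{b̃_s, b_s, ρ(A × [0,s]), σ̃ : s ≤ t, A Borel}`. -/
abbrev canonicalFiltration (t : Time T) : MeasurableSpace (Xi d T) :=
  (⨆ (s : Time T) (_ : s ≤ t),
    MeasurableSpace.comap (fun ξ : Xi d T => ctrlPath ξ s) inferInstance ⊔
    MeasurableSpace.comap (fun ξ : Xi d T => drivPath ξ s) inferInstance ⊔
    ⨆ (A : Set (E d)) (_ : MeasurableSet A),
      MeasurableSpace.comap (fun ξ : Xi d T => control ξ (A ×ˢ Iic s)) inferInstance) ⊔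
  MeasurableSpace.comap (fun ξ : Xi d T => threshold ξ) inferInstance

/-- `W` is, under `P`, a `d`-dimensional standard Brownian motion on `[0,T]` with respect to the
filtration `G`. -/
structure IsStandardBrownianMotion {Ω : Type*} [MeasurableSpace Ω] (P : Measure Ω)
    (G : Time T → MeasurableSpace Ω) (W : Time T → Ω → E d) : Prop where
  adapted : ∀ t, Measurable[G t] (W t)
  start : ∀ t : Time T, (t : ℝ) = 0 → ∀ᵐ ω ∂P, W t ω = 0
  cts : ∀ᵐ ω ∂P, Continuous fun t => W t ω
  indep : ∀ s t : Time T, s ≤ t →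
    Indep (G s) (MeasurableSpace.comap (fun ω => W t ω - W s ω) inferInstance) P
  law : ∀ s t : Time T, s ≤ t →
    P.map (fun ω => W t ω - W s ω) =
      (stdGaussian (E d)).map (fun x => Real.sqrt ((t : ℝ) - s) • x)

/-- The exponential distribution `θ` with rate `1`, as a measure on `ℝ₊`. -/
def theta : Measure ℝ≥0 := (expMeasure 1).map Real.toNNReal

/-- The fourth marginal `Θ_(4)`. -/
def fourthMarginal (Θ : Measure (Xi d T)) : Measure ℝ≥0 := Θ.map threshold

/-- The class `P_∞`. -/
structure MemPInfty (Θ : ProbabilityMeasure (Xi d T)) : Prop where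
  ac : fourthMarginal (Θ : Measure (Xi d T)) ≪ theta
  brownian : IsStandardBrownianMotion (Θ : Measure (Xi d T)) canonicalFiltration
    (fun t ξ => drivPath ξ t)
  energy : ∀ᵐ ξ ∂(Θ : Measure (Xi d T)), ∫⁻ p, ‖p.1‖ₑ ^ 2 ∂control ξ < ∞
  dynamics : ∀ᵐ ξ ∂(Θ : Measure (Xi d T)), ∀ t : Time T,
    ctrlPath ξ t = drivPath ξ t + ∫ p in univ ×ˢ Iic t, p.1 ∂control ξ

/-- The cost `J(Θ) = E^Θ[½ ∫ ‖y‖² ρ(dy dt)] + R(Θ_(4) ‖ θ)`. -/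
def cost (Θ : ProbabilityMeasure (Xi d T)) : ℝ≥0∞ :=
  ∫⁻ ξ, (1 / 2) * ∫⁻ p, ‖p.1‖ₑ ^ 2 ∂control ξ ∂(Θ : Measure (Xi d T)) +
    InformationTheory.klDiv (fourthMarginal (Θ : Measure (Xi d T))) theta

/-- The accumulated killing rate `∫_0^t ⟨ζ, ϖ(s)⟩ ds`, in `[0,∞]`. -/
def killing (ζ : E d → ℝ≥0) (ϖ : Time T → SubProb (E d)) (t : Time T) : ℝ≥0∞ :=
  ∫⁻ s in Iic t, ∫⁻ x, (ζ x : ℝ≥0∞) ∂(ϖ s).toMeasure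
    ∂((volume : Measure ℝ).comap ((↑) : Time T → ℝ))

/-- `ϖ` solves the equation
`⟨f, ϖ(t)⟩ = E^Θ[f(b̃_t) 1{σ̃ > ∫_0^t ⟨ζ, ϖ(s)⟩ ds}]` for all `f ∈ C_b(ℝ^d)`, `t ∈ [0,T]`. -/
def IsKilledSolution (ζ : E d → ℝ≥0) (Θ : ProbabilityMeasure (Xi d T))
    (ϖ : Time T → SubProb (E d)) : Prop :=
  ∀ (f : E d →ᵇ ℝ) (t : Time T),
    ∫ x, f x ∂(ϖ t).toMeasure =
      ∫ ξ, {ξ : Xi d T | killing ζ ϖ t < (threshold ξ : ℝ≥0∞)}.indicator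
        (fun ξ => f (ctrlPath ξ t)) ξ ∂(Θ : Measure (Xi d T))

/-- The class `P_∞^1` of all `Θ ∈ P_∞` with `J(Θ) < ∞` for which the equation has a (measurable)
solution `ϖ_Θ`. -/
def PInftyOne (ζ : E d → ℝ≥0) : Set (ProbabilityMeasure (Xi d T)) :=
  {Θ | MemPInfty Θ ∧ cost Θ < ∞ ∧
    ∃ ϖ : Time T → SubProb (E d), Measurable ϖ ∧ IsKilledSolution ζ Θ ϖ}

/-- The function `I(π) = inf {J(Θ) : Θ ∈ P_∞^1, ϖ_Θ = π}`, with `inf ∅ = ∞`.  The solution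
`ϖ_Θ` is unique among measurable maps, and a càdlàg `π` is measurable, so `ϖ_Θ = π` says that
`π` solves the equation. -/
def rateFunction (ζ : E d → ℝ≥0) (π : Skorokhod T (SubProb (E d))) : ℝ≥0∞ :=
  ⨅ Θ ∈ {Θ : ProbabilityMeasure (Xi d T) | Θ ∈ PInftyOne ζ ∧ IsKilledSolution ζ Θ π}, cost Θ

end KilledBM

end

noncomputable section

namespace KilledBM

/-! ### Paths of finite Cameron–Martin energy. -/

section

variable {d : ℕ} {T : ℝ}

/-! ### Lebesgue measure on the time interval -/

/-! Let `I(π_n) ≤ M` and choose near-optimal `Θ_n` for which `π_n` solves the killed equation. The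
limit is taken after forgetting the relaxed control, the killed equation involving only `b̃` and
`σ̃`. The control enters through the drift `b̃ - b`. By Jensen, replacing `ρ` by its barycentre in
`y` cannot raise the energy, so the Cameron–Martin energy of the drift is at most the control cost
(`h1Energy_le_of_relaxedControl`). Conversely, a law of `(b̃, b, σ̃)` with finite cost lifts to the
canonical space through the control `δ_{u(t)}(dy) dt`, where `u` is the velocity of the drift, at
equal cost (`cost_liftLaw`) and with `b` still a Brownian motion for the full filtration, because
this control is almost surely adapted to the stopped paths.

On the reduced space the admissible laws of cost at most `c` are compact (`isCompact_boundedLaws`).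
Drifts are tight since energy sublevel sets are compact in path space, `b` always has the Wiener
law, and an entropy bound makes the laws of `σ̃` tight. Admissibility is a closed condition, and the
cost is lower semicontinuous by the variational formula for relative entropy.

It remains to pass to the limit in the killed equation (`exists_killed_limit`). Second moments of
`b̃_t` are bounded uniformly and `ζ` grows more slowly than the square, so the accumulated killing
rates are uniformly Lipschitz and Arzelà–Ascoli gives a limit `k` along a subsequence. The indicator
of `σ̃ > k` is discontinuous, but the entropy bound controls, uniformly, the mass of `σ̃` near any
level, so the indicator can be replaced by a Lipschitz ramp. Hence the killed laws converge in
`d_BL` uniformly in time. Uniform integrability of `ζ(b̃_t)` then identifies `k` with the killing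
rate accumulated by the limit, which therefore solves the equation. The limit is continuous in time,
and uniform convergence implies Skorokhod convergence. -/

instance : MeasureSpace (Time T) where
  volume := (volume : Measure ℝ).comap (↑)

theorem volume_image_time (A : Set (Time T)) :
    (volume : Measure (Time T)) A = (volume : Measure ℝ) ((↑) '' A) :=
  (MeasurableEmbedding.subtype_coe measurableSet_Icc).comap_apply _ _

theorem volume_Iic_time (t : Time T) : (volume : Measure (Time T)) (Iic t) = ENNReal.ofReal t := by
  rw [volume_image_time]
  have : ((↑) '' (Iic t) : Set ℝ) = Icc 0 (t : ℝ) := by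
    ext x
    constructor
    · rintro ⟨y, hy, rfl⟩; exact ⟨y.2.1, hy⟩
    · rintro ⟨h0, h1⟩; exact ⟨⟨x, h0, h1.trans t.2.2⟩, h1, rfl⟩
  rw [this, Real.volume_Icc, sub_zero]

theorem volume_Ioc_time (s t : Time T) :
    (volume : Measure (Time T)) (Ioc s t) = ENNReal.ofReal (t - s) := by
  rw [volume_image_time]
  have : ((↑) '' (Ioc s t) : Set ℝ) = Ioc (s : ℝ) (t : ℝ) := by
    ext x
    constructor
    · rintro ⟨y, hy, rfl⟩; exact ⟨hy.1, hy.2⟩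
    · rintro ⟨h0, h1⟩; exact ⟨⟨x, s.2.1.trans h0.le, h1.trans t.2.2⟩, ⟨h0, h1⟩, rfl⟩
  rw [this, Real.volume_Ioc]

theorem volume_univ_time_le : (volume : Measure (Time T)) univ ≤ ENNReal.ofReal T := by
  rw [volume_image_time, image_univ, Subtype.range_coe, Real.volume_Icc, sub_zero]

instance : IsFiniteMeasure (volume : Measure (Time T)) :=
  ⟨volume_univ_time_le.trans_lt ENNReal.ofReal_lt_top⟩

/-! ### Square integrable velocities and their primitives -/

/-- The space `L²([0,T] ; ℝ^d)`. -/
abbrev Vel (d : ℕ) (T : ℝ) : Type := Lp (E d) 2 (volume : Measure (Time T))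

instance : MeasurableSpace (Vel d T) := borel _

instance : BorelSpace (Vel d T) := ⟨rfl⟩

instance : SecondCountableTopology (Vel d T) :=
  haveI : Fact ((2 : ℝ≥0∞) ≠ ∞) := ⟨by norm_num⟩
  inferInstance

instance : PolishSpace (Vel d T) := inferInstance

theorem vel_integrable (u : Vel d T) : Integrable u (volume : Measure (Time T)) :=
  (Lp.memLp u).integrable (by norm_num)

/-- Cauchy–Schwarz with the integral itself as test vector: for `v = ∫_A u`, pairing `u` with `1_A
v` gives `‖v‖² ≤ √|A| ‖v‖ ‖u‖`, and one factor `‖v‖` cancels. -/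
theorem norm_setIntegral_vel_le (u : Vel d T) {A : Set (Time T)} (hA : MeasurableSet A) :
    ‖∫ s in A, u s‖ ≤ √((volume : Measure (Time T)).real A) * ‖u‖ := by
  set v := ∫ s in A, u s
  have h1 : inner ℝ (indicatorConstLp 2 hA (measure_ne_top volume A) v) u = inner ℝ v v :=
    L2.inner_indicatorConstLp_eq_inner_setIntegral ℝ hA (measure_ne_top volume A) v u
  have h2 := real_inner_le_norm (indicatorConstLp 2 hA (measure_ne_top volume A) v) u
  rw [h1, real_inner_self_eq_norm_sq, norm_indicatorConstLp (by norm_num) (by norm_num)] at h2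
  have e : ((volume : Measure (Time T)).real A) ^ (1 / ENNReal.toReal 2)
      = √((volume : Measure (Time T)).real A) := by
    rw [Real.sqrt_eq_rpow]; norm_num
  rw [e] at h2
  rcases (norm_nonneg v).eq_or_lt with h | h
  · rw [← h]; positivity
  · have : ‖v‖ * ‖v‖ ≤ ‖v‖ * (√((volume : Measure (Time T)).real A) * ‖u‖) := by nlinarith
    exact le_of_mul_le_mul_left this h

theorem setIntegral_Iic_sub_Iic (u : Vel d T) {s t : Time T} (h : s ≤ t) :
    (∫ r in Iic t, u r) - ∫ r in Iic s, u r = ∫ r in Ioc s t, u r := by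
  have hu : Iic t = Iic s ∪ Ioc s t := (Iic_union_Ioc_eq_Iic h).symm
  rw [hu, setIntegral_union (by
    rw [Set.disjoint_left]; intro x hx hx'; exact absurd hx'.1 (not_lt.2 hx)) measurableSet_Ioc
    (vel_integrable u).integrableOn (vel_integrable u).integrableOn]
  abel

theorem norm_setIntegral_Iic_sub_le (u : Vel d T) (s t : Time T) :
    ‖(∫ r in Iic s, u r) - ∫ r in Iic t, u r‖ ≤ ‖u‖ * √|(s : ℝ) - t| := by
  wlog h : s ≤ t generalizing s t
  · rw [norm_sub_rev, abs_sub_comm]; exact this t s (le_of_not_ge h)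
  rw [norm_sub_rev, setIntegral_Iic_sub_Iic u h]
  refine (norm_setIntegral_vel_le u measurableSet_Ioc).trans_eq ?_
  have h' : (s : ℝ) ≤ t := h
  rw [measureReal_def, volume_Ioc_time, ENNReal.toReal_ofReal (by linarith), abs_sub_comm,
    abs_of_nonneg (by linarith), mul_comm]

/-- A function with a modulus of continuity of order `1/2` is continuous. -/
theorem continuous_of_holder {F : Type*} [NormedAddCommGroup F] {f : Time T → F} {R : ℝ}
    (h : ∀ s t, ‖f s - f t‖ ≤ R * √|(s : ℝ) - t|) : Continuous f := by
  refine continuous_iff_continuousAt.2 fun t => ?_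
  rw [ContinuousAt, tendsto_iff_norm_sub_tendsto_zero]
  refine squeeze_zero (fun _ => norm_nonneg _) (fun s => h s t) ?_
  have : Continuous fun s : Time T => R * √|(s : ℝ) - t| := by fun_prop
  simpa using this.tendsto t

/-- The primitive `t ↦ ∫_0^t u(s) ds`. -/
def primitive (u : Vel d T) : PathSpace d T :=
  ⟨fun t => ∫ s in Iic t, u s, continuous_of_holder (norm_setIntegral_Iic_sub_le u)⟩

theorem primitive_apply (u : Vel d T) (t : Time T) : primitive u t = ∫ s in Iic t, u s := rfl

theorem norm_primitive_sub_le (u : Vel d T) (s t : Time T) :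
    ‖primitive u s - primitive u t‖ ≤ ‖u‖ * √|(s : ℝ) - t| := norm_setIntegral_Iic_sub_le u s t

theorem norm_primitive_apply_le (u : Vel d T) (t : Time T) : ‖primitive u t‖ ≤ √T * ‖u‖ := by
  refine (norm_setIntegral_vel_le u measurableSet_Iic).trans ?_
  gcongr
  rw [measureReal_def, volume_Iic_time, ENNReal.toReal_ofReal t.2.1]
  exact t.2.2

theorem primitive_sub (u v : Vel d T) : primitive (u - v) = primitive u - primitive v := by
  ext1 t
  rw [ContinuousMap.sub_apply, primitive_apply, primitive_apply, primitive_apply,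
    ← integral_sub (vel_integrable u).integrableOn (vel_integrable v).integrableOn]
  exact integral_congr_ae (ae_restrict_of_ae (Lp.coeFn_sub u v))

theorem continuous_primitive : Continuous (primitive : Vel d T → PathSpace d T) := by
  have : LipschitzWith (√T).toNNReal (primitive : Vel d T → PathSpace d T) := by
    refine LipschitzWith.of_dist_le_mul fun u v => ?_
    rw [dist_eq_norm, dist_eq_norm, ← primitive_sub, Real.coe_toNNReal _ (Real.sqrt_nonneg _)]
    exact (ContinuousMap.norm_le _ (by positivity)).2 fun t => norm_primitive_apply_le _ t
  exact this.continuous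

/-- Coordinates of a primitive are thus weakly continuous functionals of the velocity. This serves
both the weak compactness argument and the barycentre of a relaxed control. -/
theorem inner_primitive (u : Vel d T) (t : Time T) (e : E d) :
    inner ℝ e (primitive u t)
      = inner ℝ (indicatorConstLp 2 measurableSet_Iic (measure_ne_top volume (Iic t)) e) u :=
  (L2.inner_indicatorConstLp_eq_inner_setIntegral ℝ measurableSet_Iic _ e u).symm

/-- The intervals `Iic t` form a π-system generating the Borel sets, so the integral vanishes over
every measurable set. -/
theorem ae_eq_zero_of_setIntegral_Iic (u : Vel d T) (h : ∀ t, ∫ s in Iic t, u s = 0) : u = 0 := by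
  rw [Lp.eq_zero_iff_ae_eq_zero]
  have hgen : (inferInstance : MeasurableSpace (Time T))
      = MeasurableSpace.generateFrom (range Iic) := by
    rw [← borel_eq_generateFrom_Iic]; exact BorelSpace.measurable_eq
  have huniv : ∫ s, u s = 0 := by
    rcases isEmpty_or_nonempty (Time T) with hT | ⟨⟨t0⟩⟩
    · exact integral_eq_zero_of_ae (Eventually.of_forall fun s => (hT.false s).elim)
    · have hT : (0 : ℝ) ≤ T := t0.2.1.trans t0.2.2
      have := h ⟨T, hT, le_rfl⟩
      rwa [show Iic (⟨T, hT, le_rfl⟩ : Time T) = univ from eq_univ_of_forall fun s => s.2.2,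
        setIntegral_univ] at this
  refine (vel_integrable u).ae_eq_zero_of_forall_setIntegral_eq_zero fun A hA _ => ?_
  induction A, hA using MeasurableSpace.induction_on_inter hgen isPiSystem_Iic with
  | empty => simp
  | basic A hA => obtain ⟨t, rfl⟩ := hA; exact h t
  | compl A hA ih =>
    have := integral_add_compl hA (vel_integrable u)
    rw [ih (measure_lt_top _ _), huniv, zero_add] at this
    exact this
  | iUnion f hd hm ih =>
    rw [integral_iUnion hm hd (vel_integrable u).integrableOn]
    simp [fun i => ih i (measure_lt_top _ _)]

theorem primitive_injective : Function.Injective (primitive : Vel d T → PathSpace d T) := by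
  intro u v huv
  rw [← sub_eq_zero]
  refine ae_eq_zero_of_setIntegral_Iic _ fun t => ?_
  rw [← primitive_apply, primitive_sub, huv, sub_self]; rfl

/-- Lusin–Souslin: a continuous injection between Polish spaces is a Borel embedding. It makes the
velocity a measurable function of a path of finite energy. -/
theorem measurableEmbedding_primitive :
    MeasurableEmbedding (primitive : Vel d T → PathSpace d T) :=
  continuous_primitive.measurableEmbedding primitive_injective

/-- Arzelà–Ascoli for bounded sets of Hölder functions of order `1/2`. -/
theorem isCompact_holder {F : Type*} [NormedAddCommGroup F] [ProperSpace F] (R B : ℝ) :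
    IsCompact {x : C(Time T, F) | (∀ t, ‖x t‖ ≤ B) ∧
      ∀ s t, ‖x s - x t‖ ≤ R * √|(s : ℝ) - t|} := by
  refine ArzelaAscoli.isCompact_of_equicontinuous _ ?_ ?_
  -- The Hölder bound already forces continuity, so as a set of bare functions this is a closed
  -- subset of a product of compact balls.
  · have : ContinuousMap.toFun '' {x : C(Time T, F) | (∀ t, ‖x t‖ ≤ B) ∧
        ∀ s t, ‖x s - x t‖ ≤ R * √|(s : ℝ) - t|}
        = (univ.pi fun _ => Metric.closedBall (0 : F) B) ∩
          {f | ∀ s t : Time T, ‖f s - f t‖ ≤ R * √|(s : ℝ) - t|} := by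
      ext f
      constructor
      · rintro ⟨x, ⟨h1, h2⟩, rfl⟩
        exact ⟨fun t _ => by simpa using h1 t, h2⟩
      · rintro ⟨h1, h2⟩
        exact ⟨⟨f, continuous_of_holder h2⟩, ⟨fun t => by simpa using h1 t (mem_univ t), h2⟩, rfl⟩
    rw [this]
    refine (isCompact_univ_pi fun _ => isCompact_closedBall _ _).inter_right ?_
    simp only [ofPred_forall]
    refine isClosed_iInter fun s => isClosed_iInter fun t => ?_
    exact isClosed_le (by fun_prop) continuous_const
  · intro t
    rw [Metric.equicontinuousAt_iff_right]
    intro ε hε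
    have hc : Continuous fun s : Time T => R * √|(t : ℝ) - s| := by fun_prop
    have := hc.tendsto t
    simp only [sub_self, abs_zero, Real.sqrt_zero, mul_zero] at this
    filter_upwards [this.eventually_lt_const hε] with s hs x
    rw [dist_eq_norm]
    exact (x.2.2 t s).trans_lt hs

/-- Banach–Alaoglu: the dual ball is weak-* compact, hence so is its image under the evaluations at
the vectors `1_{[0,t]} e`. That image is closed in the product space, and the set of primitives is
its preimage under the continuous injection `x ↦ (⟨e, x(t)⟩)`. -/
theorem isClosed_image_primitive (R : ℝ) :
    IsClosed ((primitive : Vel d T → PathSpace d T) '' Metric.closedBall 0 R) := by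
  let Φ : WeakDual ℝ (Vel d T) → Time T × E d → ℝ := fun φ p =>
    φ (indicatorConstLp 2 measurableSet_Iic (measure_ne_top volume (Iic p.1)) p.2)
  have hΦ : Continuous Φ := continuous_pi fun p => WeakDual.eval_continuous _
  have hK := (WeakDual.isCompact_closedBall (0 : StrongDual ℝ (Vel d T)) R).image hΦ
  let Ψ : PathSpace d T → Time T × E d → ℝ := fun x p => inner ℝ p.2 (x p.1)
  have hΨ : Continuous Ψ := continuous_pi fun p => by
    have := ContinuousEvalConst.continuous_eval_const (F := PathSpace d T) p.1
    exact continuous_const.inner this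
  have hΨinj : Function.Injective Ψ := by
    intro x y h
    ext1 t
    refine ext_inner_left ℝ fun e => congrFun h (t, e)
  convert! hK.isClosed.preimage hΨ
  have key : ∀ u : Vel d T, Φ (StrongDual.toWeakDual (InnerProductSpace.toDual ℝ _ u))
      = Ψ (primitive u) := by
    intro u
    funext p
    change inner ℝ u _ = inner ℝ p.2 (primitive u p.1)
    rw [inner_primitive, real_inner_comm]
  ext x
  constructor
  · rintro ⟨u, hu, rfl⟩
    refine ⟨StrongDual.toWeakDual (InnerProductSpace.toDual ℝ _ u), ?_, key u⟩
    simpa using hu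
  · rintro ⟨φ, hφ, hx⟩
    obtain ⟨u, hu⟩ := (InnerProductSpace.toDual ℝ (Vel d T)).surjective (WeakDual.toStrongDual φ)
    refine ⟨u, ?_, hΨinj ?_⟩
    · have : WeakDual.toStrongDual φ ∈ Metric.closedBall (0 : StrongDual ℝ (Vel d T)) R := hφ
      rw [← hu] at this
      simpa using this
    · rw [← key, hu, ← hx]; rfl

theorem isCompact_image_primitive (R : ℝ) :
    IsCompact ((primitive : Vel d T → PathSpace d T) '' Metric.closedBall 0 R) := by
  refine (isCompact_holder R (√T * R)).of_isClosed_subset (isClosed_image_primitive R) ?_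
  rintro _ ⟨u, hu, rfl⟩
  have hu' : ‖u‖ ≤ R := by simpa using hu
  refine ⟨fun t => (norm_primitive_apply_le u t).trans (by gcongr), fun s t =>
    (norm_primitive_sub_le u s t).trans (by gcongr)⟩

/-! ### The Cameron–Martin energy -/

/-- The energy `∫_0^T ‖x'(t)‖² dt` of a path, infinite unless `x` is the primitive of a square
integrable velocity. -/
def h1Energy (x : PathSpace d T) : ℝ≥0∞ := ⨅ (u : Vel d T) (_ : primitive u = x), ‖u‖ₑ ^ 2

theorem h1Energy_primitive (u : Vel d T) : h1Energy (primitive u) = ‖u‖ₑ ^ 2 :=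
  le_antisymm (iInf_le_of_le u (iInf_le _ rfl)) (le_iInf₂ fun v hv => by rw [primitive_injective hv])

theorem exists_primitive_of_h1Energy_lt_top {x : PathSpace d T} (h : h1Energy x < ∞) :
    ∃ u, primitive u = x := by
  simp only [h1Energy, iInf_lt_iff] at h
  obtain ⟨u, hu, -⟩ := h
  exact ⟨u, hu⟩

theorem h1Energy_le_iff (x : PathSpace d T) (c : ℝ≥0) :
    h1Energy x ≤ (c : ℝ≥0∞) ^ 2 ↔ x ∈ primitive '' Metric.closedBall (0 : Vel d T) c := by
  constructor
  · intro h
    obtain ⟨u, rfl⟩ := exists_primitive_of_h1Energy_lt_top (h.trans_lt (by finiteness))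
    refine ⟨u, ?_, rfl⟩
    rw [h1Energy_primitive, ENNReal.pow_le_pow_left_iff two_ne_zero, enorm_le_coe] at h
    simpa using! h
  · rintro ⟨u, hu, rfl⟩
    rw [h1Energy_primitive, ENNReal.pow_le_pow_left_iff two_ne_zero, enorm_le_coe]
    simpa using! hu

theorem isCompact_h1Energy_le (c : ℝ≥0) :
    IsCompact {x : PathSpace d T | h1Energy x ≤ (c : ℝ≥0∞) ^ 2} := by
  convert! isCompact_image_primitive (d := d) (T := T) c
  ext x; exact h1Energy_le_iff x c

theorem lowerSemicontinuous_h1Energy :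
    LowerSemicontinuous (h1Energy : PathSpace d T → ℝ≥0∞) := by
  rw [lowerSemicontinuous_iff_isClosed_preimage]
  intro c
  rcases eq_or_ne c ∞ with rfl | hc
  · simp
  · lift c to ℝ≥0 using hc
    have : (c : ℝ≥0∞) = (NNReal.sqrt c : ℝ≥0∞) ^ 2 := by
      rw [← ENNReal.coe_pow, NNReal.sq_sqrt]
    rw [this]
    exact (isCompact_h1Energy_le _).isClosed

theorem enorm_apply_sq_le_h1Energy (hT : 0 < T) (x : PathSpace d T) (t : Time T) :
    ‖x t‖ₑ ^ 2 ≤ ENNReal.ofReal T * h1Energy x := by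
  by_cases hx : h1Energy x < ∞
  · obtain ⟨u, rfl⟩ := exists_primitive_of_h1Energy_lt_top hx
    rw [h1Energy_primitive]
    have h := norm_primitive_apply_le u t
    have h2 : ‖primitive u t‖ ^ 2 ≤ T * ‖u‖ ^ 2 := by
      calc ‖primitive u t‖ ^ 2 ≤ (√T * ‖u‖) ^ 2 := by gcongr
        _ = T * ‖u‖ ^ 2 := by rw [mul_pow, Real.sq_sqrt hT.le]
    rw [← ofReal_norm, ← ofReal_norm, ← ENNReal.ofReal_pow (norm_nonneg _),
      ← ENNReal.ofReal_pow (norm_nonneg _), ← ENNReal.ofReal_mul hT.le]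
    exact ENNReal.ofReal_le_ofReal h2
  -- For infinite energy the right-hand side is `T * ∞`, which is `∞` only because `T ≠ 0`.
  · rw [not_lt_top_iff.1 hx, ENNReal.mul_top (by simpa using hT)]
    exact le_top

end

/-! ### Passing between relaxed controls and velocities. -/

section

variable {d : ℕ} {T : ℝ}

/-! ### Relaxed controls carried by a velocity -/

theorem vel_measurable (u : Vel d T) : Measurable u := (Lp.stronglyMeasurable u).measurable

theorem vel_graph_measurable (u : Vel d T) : Measurable fun s : Time T => (u s, s) :=
  (vel_measurable u).prodMk measurable_id

theorem lintegral_enorm_sq_vel (u : Vel d T) : ∫⁻ s, ‖u s‖ₑ ^ 2 = ‖u‖ₑ ^ 2 := by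
  rw [Lp.enorm_def, eLpNorm_eq_lintegral_rpow_enorm_toReal (by norm_num) (by norm_num)]
  rw [← ENNReal.rpow_natCast, ← ENNReal.rpow_mul]
  norm_num

/-- The relaxed control `δ_{u(t)}(dy) dt`. -/
def ofVelocity (u : Vel d T) : RelaxedControl d T where
  toFiniteMeasure := ⟨(volume : Measure (Time T)).map fun s => (u s, s), by
    exact Measure.isFiniteMeasure_map _ _⟩
  time_marginal t := by
    change ((volume : Measure (Time T)).map fun s => (u s, s)) _ = _
    rw [Measure.map_apply (vel_graph_measurable u) (MeasurableSet.univ.prod measurableSet_Iic),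
      ← volume_Iic_time]
    congr 1
    ext s; simp
  first_moment := by
    change ∫⁻ p, ‖p.1‖ₑ ∂((volume : Measure (Time T)).map fun s => (u s, s)) < ∞
    rw [lintegral_map (by fun_prop) (vel_graph_measurable u)]
    exact (vel_integrable u).2

theorem ofVelocity_toMeasure (u : Vel d T) :
    (ofVelocity u).toMeasure = (volume : Measure (Time T)).map fun s => (u s, s) := rfl

/-- An `L²`-convergent sequence has an almost everywhere convergent subsequence, so dominated
convergence handles bounded continuous test functions. The first moment is the `L¹` norm of the
velocity, which is Lipschitz for the `L²` norm. -/
theorem continuous_ofVelocity : Continuous (ofVelocity : Vel d T → RelaxedControl d T) := by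
  refine continuous_induced_rng.2 (Continuous.prodMk ?_ ?_)
  · refine continuous_iff_continuousAt.2 fun u => ?_
    refine Filter.tendsto_of_subseq_tendsto fun ns hns => ?_
    obtain ⟨ms, -, hms⟩ := (tendstoInMeasure_of_tendsto_Lp hns).exists_seq_tendsto_ae
    refine ⟨ms, FiniteMeasure.tendsto_iff_forall_integral_tendsto.2 fun f => ?_⟩
    have e : ∀ v : Vel d T, ∫ p, f p ∂(((ofVelocity v).toFiniteMeasure : Measure (E d × Time T)))
        = ∫ s, f (v s, s) := fun v =>
      integral_map (vel_graph_measurable v).aemeasurable f.continuous.aestronglyMeasurable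
    simp only [e]
    refine tendsto_integral_of_dominated_convergence (fun _ => ‖f‖)
      (fun n => (f.continuous.measurable.comp (vel_graph_measurable _)).aestronglyMeasurable)
      (integrable_const _) (fun n => Eventually.of_forall fun s => f.norm_coe_le_norm _) ?_
    filter_upwards [hms] with s hs
    exact (f.continuous.tendsto _).comp (hs.prodMk_nhds tendsto_const_nhds)
  · have e : ∀ v : Vel d T, ∫ p, ‖p.1‖ ∂(ofVelocity v).toMeasure = ∫ s, ‖v s‖ := fun v =>
      integral_map (vel_graph_measurable v).aemeasurable (by fun_prop)
    simp only [e]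
    have hL : LipschitzWith (√((volume : Measure (Time T)).real univ)).toNNReal
        fun v : Vel d T => ∫ s, ‖v s‖ := by
      refine LipschitzWith.of_dist_le_mul fun u v => ?_
      rw [dist_eq_norm, dist_eq_norm, Real.coe_toNNReal _ (Real.sqrt_nonneg _),
        ← integral_sub (vel_integrable u).norm (vel_integrable v).norm]
      refine (norm_integral_le_integral_norm _).trans ?_
      have h1 : ∫ s, ‖‖u s‖ - ‖v s‖‖ ≤ ∫ s, ‖(u - v : Vel d T) s‖ := by
        refine integral_mono_ae ((vel_integrable u).norm.sub (vel_integrable v).norm).norm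
          (vel_integrable _).norm ?_
        filter_upwards [Lp.coeFn_sub u v] with s hs
        rw [hs]
        exact abs_norm_sub_norm_le _ _
      refine h1.trans ?_
      have h2 := eLpNorm_le_eLpNorm_mul_rpow_measure_univ (p := 1) (q := 2) (by norm_num)
        (Lp.aestronglyMeasurable (u - v))
      have h3 : ∫ s, ‖(u - v : Vel d T) s‖ = (eLpNorm (u - v : Vel d T) 1 volume).toReal := by
        rw [eLpNorm_one_eq_lintegral_enorm, integral_norm_eq_lintegral_enorm
          (Lp.aestronglyMeasurable _)]
      rw [h3, Lp.norm_def]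
      refine (ENNReal.toReal_mono ?_ h2).trans_eq ?_
      · exact ENNReal.mul_ne_top (Lp.eLpNorm_ne_top _)
          (ENNReal.rpow_ne_top_of_nonneg (by norm_num) (measure_ne_top _ _))
      · rw [ENNReal.toReal_mul, ← ENNReal.toReal_rpow, mul_comm, Real.sqrt_eq_rpow, measureReal_def]
        norm_num
    exact hL.continuous

theorem energy_ofVelocity (u : Vel d T) :
    ∫⁻ p, ‖p.1‖ₑ ^ 2 ∂(ofVelocity u).toMeasure = ‖u‖ₑ ^ 2 := by
  rw [ofVelocity_toMeasure, lintegral_map (by fun_prop) (vel_graph_measurable u),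
    lintegral_enorm_sq_vel]

theorem setIntegral_ofVelocity (u : Vel d T) (t : Time T) :
    ∫ p in univ ×ˢ Iic t, p.1 ∂(ofVelocity u).toMeasure = primitive u t := by
  rw [ofVelocity_toMeasure, setIntegral_map (MeasurableSet.univ.prod measurableSet_Iic)
    (by fun_prop) (vel_graph_measurable u).aemeasurable, primitive_apply]
  congr 2
  ext s; simp

/-- The control carried by the velocity of a path with finite energy; the zero control for other
paths. -/
def pathControl : PathSpace d T → RelaxedControl d T :=
  Function.extend primitive ofVelocity fun _ => ofVelocity 0

theorem pathControl_primitive (u : Vel d T) : pathControl (primitive u) = ofVelocity u :=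
  primitive_injective.extend_apply _ _ _

theorem measurable_pathControl : Measurable (pathControl : PathSpace d T → RelaxedControl d T) :=
  measurableEmbedding_primitive.measurable_extend continuous_ofVelocity.measurable measurable_const

/-- The path stopped at time `s`. -/
def stopPath (s : Time T) (x : PathSpace d T) : PathSpace d T :=
  x.comp ⟨fun t => min t s, by fun_prop⟩

theorem stopPath_apply (s : Time T) (x : PathSpace d T) (t : Time T) :
    stopPath s x t = x (min t s) := rfl

theorem continuous_stopPath (s : Time T) : Continuous (stopPath s : PathSpace d T → _) :=
  ContinuousMap.continuous_precomp _

theorem stopPath_stopPath {s s' : Time T} (h : s ≤ s') (x : PathSpace d T) :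
    stopPath s (stopPath s' x) = stopPath s x := by
  ext1 t
  simp only [stopPath_apply]
  rw [min_eq_left ((min_le_right t s).trans h)]

/-- Stopping a primitive at `s` multiplies its velocity by `1_{[0,s]}`. So the control on `[0,s]`
depends only on the path up to `s`, which makes the lifted control adapted. Finite energy matters: a
path of infinite energy receives the zero control, while its stopped version may have finite energy.
-/
theorem pathControl_stopPath {x : PathSpace d T} (hx : h1Energy x < ∞) (s : Time T)
    {A : Set (E d)} (hA : MeasurableSet A) :
    (pathControl (stopPath s x)).toMeasure (A ×ˢ Iic s)
      = (pathControl x).toMeasure (A ×ˢ Iic s) := by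
  obtain ⟨u, rfl⟩ := exists_primitive_of_h1Energy_lt_top hx
  have hm : MemLp ((Iic s).indicator u) 2 (volume : Measure (Time T)) :=
    (Lp.memLp u).indicator measurableSet_Iic
  set v : Vel d T := hm.toLp _
  have hv : v =ᵐ[volume] (Iic s).indicator u := hm.coeFn_toLp
  have hs : stopPath s (primitive u) = primitive v := by
    ext1 t
    rw [stopPath_apply, primitive_apply, primitive_apply,
      integral_congr_ae (ae_restrict_of_ae hv), setIntegral_indicator measurableSet_Iic,
      Iic_inter_Iic]
  rw [hs, pathControl_primitive, pathControl_primitive, ofVelocity_toMeasure, ofVelocity_toMeasure,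
    Measure.map_apply (vel_graph_measurable _) (hA.prod measurableSet_Iic),
    Measure.map_apply (vel_graph_measurable _) (hA.prod measurableSet_Iic)]
  refine measure_congr ?_
  filter_upwards [hv] with r hr
  refine propext ?_
  change (v r, r) ∈ A ×ˢ Iic s ↔ (u r, r) ∈ A ×ˢ Iic s
  rw [mem_prod, mem_prod, hr]
  refine and_congr_left fun h => ?_
  rw [indicator_of_mem h]

/-! ### Measurability of relaxed controls -/

/-- On closed sets the mass is a limit of integrals of thickened indicators, each weakly continuous
in the control; a π-λ argument extends this to Borel sets. -/
theorem measurable_toMeasure_apply {B : Set (E d × Time T)} (hB : MeasurableSet B) :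
    Measurable fun r : RelaxedControl d T => r.toMeasure B := by
  have : ∀ r : RelaxedControl d T, IsFiniteMeasure r.toMeasure := fun r => by
    unfold RelaxedControl.toMeasure; infer_instance
  have hcl : ∀ F : Set (E d × Time T), IsClosed F →
      Measurable fun r : RelaxedControl d T => r.toMeasure F := by
    intro F hF
    have hpos : ∀ n : ℕ, (0 : ℝ) < 1 / ((n : ℝ) + 1) := fun n => by positivity
    refine measurable_of_tendsto_metrizable (f := fun (n : ℕ) (r : RelaxedControl d T) =>
      ∫⁻ p, (thickenedIndicator (hpos n) F p : ℝ≥0∞) ∂r.toMeasure) (fun n => ?_) ?_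
    · have h1 : Continuous fun r : RelaxedControl d T => r.toFiniteMeasure :=
        continuous_fst.comp (continuous_induced_dom
          (f := fun r : RelaxedControl d T => (r.toFiniteMeasure, ∫ p, ‖p.1‖ ∂r.toMeasure)))
      have h2 := (FiniteMeasure.continuous_testAgainstNN_eval
        (thickenedIndicator (hpos n) F)).comp h1
      have h3 : (fun r : RelaxedControl d T =>
          ∫⁻ p, (thickenedIndicator (hpos n) F p : ℝ≥0∞) ∂r.toMeasure)
          = fun r => ((r.toFiniteMeasure.testAgainstNN (thickenedIndicator (hpos n) F) : ℝ≥0) :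
            ℝ≥0∞) := by
        funext r
        exact (FiniteMeasure.testAgainstNN_coe_eq).symm
      rw [h3]
      exact h2.measurable.coe_nnreal_ennreal
    · rw [tendsto_pi_nhds]
      intro r
      exact tendsto_lintegral_thickenedIndicator_of_isClosed r.toMeasure hF hpos
        tendsto_one_div_add_atTop_nhds_zero_nat
  have hgen : (inferInstance : MeasurableSpace (E d × Time T))
      = MeasurableSpace.generateFrom {F | IsClosed F} := by
    rw [← borel_eq_generateFrom_isClosed]; exact BorelSpace.measurable_eq
  induction B, hB using MeasurableSpace.induction_on_inter hgen isPiSystem_isClosed with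
  | empty => simp
  | basic F hF => exact hcl F hF
  | compl B hB ih =>
    simp only [measure_compl hB (measure_ne_top _ _)]
    exact (hcl univ isClosed_univ).sub ih
  | iUnion f hd hm ih =>
    simp only [measure_iUnion hd hm]
    exact Measurable.tsum ih

/-- Two measurable families of finite measures on a countably generated space agree almost surely
as soon as they do on every measurable set. -/
theorem ae_eq_of_forall_measurableSet_ae_eq {Ω S : Type*} [MeasurableSpace Ω] [MeasurableSpace S]
    [MeasurableSpace.CountablyGenerated S] {P : Measure Ω} {κ η : Ω → Measure S}
    [∀ ω, IsFiniteMeasure (κ ω)]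
    (h : ∀ B, MeasurableSet B → ∀ᵐ ω ∂P, κ ω B = η ω B) : ∀ᵐ ω ∂P, κ ω = η ω := by
  let B : ℕ → Set S := MeasurableSpace.natGeneratingSequence S
  have hB : ∀ n, MeasurableSet (B n) := MeasurableSpace.measurableSet_natGeneratingSequence
  -- A countable π-system, so one null set serves all its members; `C ∅ = univ` compares the total
  -- masses.
  let C : Finset ℕ → Set S := fun s => ⋂ i ∈ s, B i
  have hC : ∀ s, MeasurableSet (C s) := fun s =>
    Finset.measurableSet_biInter s fun i _ => hB i
  have hall : ∀ᵐ ω ∂P, ∀ s, κ ω (C s) = η ω (C s) := ae_all_iff.2 fun s => h _ (hC s)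
  filter_upwards [hall] with ω hω
  refine ext_of_generate_finite (range C) (le_antisymm ?_ ?_) ?_ ?_ ?_
  · conv_lhs => rw [← MeasurableSpace.generateFrom_natGeneratingSequence S]
    refine MeasurableSpace.generateFrom_mono ?_
    rintro _ ⟨n, rfl⟩
    exact ⟨{n}, by simp [C, B]⟩
  · refine MeasurableSpace.generateFrom_le ?_
    rintro _ ⟨s, rfl⟩
    exact hC s
  · rintro _ ⟨s, rfl⟩ _ ⟨t, rfl⟩ -
    exact ⟨s ∪ t, Finset.inf_union (f := B) (s₁ := s) (s₂ := t) |> fun h => by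
      simpa [C, Finset.inf_eq_iInf] using h⟩
  · rintro _ ⟨s, rfl⟩
    exact hω s
  · simpa [C] using hω ∅

/-! ### Paths driven by relaxed controls -/

theorem map_snd_toMeasure (r : RelaxedControl d T) : r.toMeasure.map Prod.snd = volume := by
  have : IsFiniteMeasure r.toMeasure := by unfold RelaxedControl.toMeasure; infer_instance
  refine Measure.ext_of_Iic _ _ fun t => ?_
  rw [Measure.map_apply measurable_snd measurableSet_Iic, volume_Iic_time, ← r.time_marginal t]
  congr 1
  ext p; simp

/-- Jensen's inequality in Hilbert space form. Composition with the time projection is an isometry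
`J` from `L²(dt)` into `L²(r)`; its adjoint sends the function `y` to the barycentre `u(t)` of `r`
at time `t`. The adjoint has norm at most `1`, and testing against `1_{[0,t]} e` shows that `x` is
the primitive of `u`. -/
theorem h1Energy_le_of_relaxedControl (r : RelaxedControl d T) {x : PathSpace d T}
    (hr : ∫⁻ p, ‖p.1‖ₑ ^ 2 ∂r.toMeasure < ∞)
    (hx : ∀ t, x t = ∫ p in univ ×ˢ Iic t, p.1 ∂r.toMeasure) :
    h1Energy x ≤ ∫⁻ p, ‖p.1‖ₑ ^ 2 ∂r.toMeasure := by
  have : IsFiniteMeasure r.toMeasure := by unfold RelaxedControl.toMeasure; infer_instance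
  have hmp : MeasurePreserving Prod.snd r.toMeasure (volume : Measure (Time T)) :=
    ⟨measurable_snd, map_snd_toMeasure r⟩
  have hnorm : eLpNorm (Prod.fst : E d × Time T → E d) 2 r.toMeasure ^ 2
      = ∫⁻ p, ‖p.1‖ₑ ^ 2 ∂r.toMeasure := by
    rw [eLpNorm_eq_lintegral_rpow_enorm_toReal (by norm_num) (by norm_num),
      ← ENNReal.rpow_natCast, ← ENNReal.rpow_mul]
    norm_num
  have hY : MemLp (Prod.fst : E d × Time T → E d) 2 r.toMeasure := by
    refine ⟨measurable_fst.aestronglyMeasurable, ?_⟩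
    rw [← hnorm] at hr
    by_contra h
    rw [not_lt_top_iff.1 h] at hr
    simp at hr
  let Y : Lp (E d) 2 r.toMeasure := hY.toLp _
  let J := (Lp.compMeasurePreservingₗᵢ (E := E d) (p := 2) ℝ _ hmp)
  let u : Vel d T := ContinuousLinearMap.adjoint J.toContinuousLinearMap Y
  have hu : ‖u‖ ≤ ‖Y‖ := by
    refine (ContinuousLinearMap.le_opNorm _ _).trans ?_
    rw [LinearIsometryEquiv.norm_map]
    exact mul_le_of_le_one_left (norm_nonneg _) J.norm_toContinuousLinearMap_le
  have hux : primitive u = x := by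
    ext1 t
    refine ext_inner_left ℝ fun e => ?_
    rw [inner_primitive, ContinuousLinearMap.adjoint_inner_right]
    have h1 : J.toContinuousLinearMap
        (indicatorConstLp 2 measurableSet_Iic (measure_ne_top volume (Iic t)) e)
        = indicatorConstLp 2 (hmp.measurable measurableSet_Iic)
          (measure_ne_top r.toMeasure (Prod.snd ⁻¹' Iic t)) e :=
      Lp.indicatorConstLp_compMeasurePreserving measurableSet_Iic _ e hmp
    rw [h1, L2.inner_indicatorConstLp_eq_inner_setIntegral ℝ, hx t]
    congr 1
    rw [integral_congr_ae (ae_restrict_of_ae hY.coeFn_toLp)]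
    congr 2
    ext p; simp
  rw [← hux, h1Energy_primitive, ← hnorm]
  have : ‖Y‖ₑ = eLpNorm (Prod.fst : E d × Time T → E d) 2 r.toMeasure := by
    rw [Lp.enorm_def]
    exact eLpNorm_congr_ae hY.coeFn_toLp
  rw [← this]
  gcongr
  exact enorm_le_iff_norm_le.2 hu

end

section

/-! ### Relative entropy: variational formula and lower semicontinuity -/

section Entropy

open InformationTheory

variable {S : Type*} [MeasurableSpace S]

/-- Fenchel–Young: `e^y - 1` is the convex conjugate of `klFun x = x log x + 1 - x`. -/
theorem mul_le_klFun_add_exp {x : ℝ} (hx : 0 ≤ x) (y : ℝ) :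
    x * y ≤ klFun x + (Real.exp y - 1) := by
  rw [klFun_apply]
  rcases hx.eq_or_lt with rfl | hx
  · simp [Real.exp_nonneg]
  · have h := Real.add_one_le_exp (y - Real.log x)
    have e : Real.exp y = x * Real.exp (y - Real.log x) := by
      rw [Real.exp_sub, Real.exp_log hx]; field_simp
    have := mul_le_mul_of_nonneg_left h hx.le
    rw [e]; linarith

theorem integrable_of_abs_le {μ : Measure S} [IsFiniteMeasure μ] {g : S → ℝ} (hg : Measurable g)
    {B : ℝ} (hB : ∀ x, |g x| ≤ B) : Integrable g μ :=
  Integrable.of_bound hg.aestronglyMeasurable B (Eventually.of_forall hB)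

theorem integrable_exp_of_abs_le {μ : Measure S} [IsFiniteMeasure μ] {g : S → ℝ}
    (hg : Measurable g) {B : ℝ} (hB : ∀ x, |g x| ≤ B) : Integrable (fun x => Real.exp (g x) - 1) μ :=
  (integrable_of_abs_le (B := Real.exp B) (Real.measurable_exp.comp hg) fun x => by
    simp only [Function.comp, Real.abs_exp]
    exact Real.exp_le_exp.2 ((le_abs_self _).trans (hB x))).sub (integrable_const _)

/-- The easy half of the variational formula: Fenchel–Young at the density `dν/dθ`, integrated
against `θ`. With `e^g - 1` in place of the logarithm of `∫ e^g`, no normalization of the measures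
is needed. -/
theorem integral_le_klDiv_add {ν θ : Measure S} [IsFiniteMeasure ν] [IsFiniteMeasure θ] {c : ℝ≥0}
    (h : klDiv ν θ ≤ c) {g : S → ℝ} (hg : Measurable g) {B : ℝ} (hB : ∀ x, |g x| ≤ B) :
    ∫ x, g x ∂ν ≤ c + ∫ x, (Real.exp (g x) - 1) ∂θ := by
  have hne : klDiv ν θ ≠ ∞ := (h.trans_lt ENNReal.coe_lt_top).ne
  obtain ⟨hac, hint⟩ := klDiv_ne_top_iff.1 hne
  have hk : Integrable (fun x => klFun (ν.rnDeriv θ x).toReal) θ :=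
    (integrable_klFun_rnDeriv_iff hac).2 hint
  have hc : ∫ x, klFun (ν.rnDeriv θ x).toReal ∂θ ≤ c := by
    rw [← toReal_klDiv_eq_integral_klFun hac]
    exact ENNReal.toReal_le_coe_of_le_coe h
  rw [← integral_toReal_rnDeriv_mul hac]
  have hi : Integrable (fun x => (ν.rnDeriv θ x).toReal * g x) θ :=
    Measure.integrable_toReal_rnDeriv.mul_bdd (c := B) hg.aestronglyMeasurable (Eventually.of_forall hB)
  refine (integral_mono hi (hk.add (integrable_exp_of_abs_le hg hB)) fun x =>
    mul_le_klFun_add_exp ENNReal.toReal_nonneg (g x)).trans ?_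
  rw [integral_add' hk (integrable_exp_of_abs_le hg hB)]
  linarith

/-- Test with `g = a 1_A`. Thus bounded entropy gives absolute continuity uniformly in `ν`: if `θ(A)
≤ e^{-a}`, then `ν(A) ≤ (c + 1)/a`. -/
theorem measureReal_le_of_klDiv_le {ν θ : Measure S} [IsFiniteMeasure ν] [IsFiniteMeasure θ]
    {c : ℝ≥0} (h : klDiv ν θ ≤ c) {A : Set S} (hA : MeasurableSet A) {a : ℝ} (ha : 0 < a) :
    ν.real A ≤ (c + Real.exp a * θ.real A) / a := by
  have h1 := integral_le_klDiv_add h (g := A.indicator fun _ => a)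
    (measurable_const.indicator hA) (B := a) (fun x => by
      by_cases hx : x ∈ A <;> simp [hx, ha.le, abs_of_pos ha])
  have e : (fun x => Real.exp (A.indicator (fun _ => a) x) - 1)
      = A.indicator fun _ => Real.exp a - 1 := by
    funext x
    by_cases hx : x ∈ A <;> simp [hx]
  rw [e, integral_indicator_const _ hA, integral_indicator_const _ hA] at h1
  rw [le_div_iff₀ ha]
  simp only [smul_eq_mul] at h1
  nlinarith [measureReal_nonneg (μ := θ) (s := A)]

/-- The converse half: test with the logarithm of the density `f`, truncated to stay bounded, and
remove the truncation by Fatou. -/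
theorem klDiv_le_of_forall_measurable {ν θ : Measure S} [IsFiniteMeasure ν] [IsFiniteMeasure θ]
    {c : ℝ≥0} (h : ∀ (g : S → ℝ) (B : ℝ), Measurable g → (∀ x, |g x| ≤ B) →
      ∫ x, g x ∂ν ≤ c + ∫ x, (Real.exp (g x) - 1) ∂θ) : klDiv ν θ ≤ c := by
  have hac : ν ≪ θ := by
    refine Measure.AbsolutelyContinuous.mk fun A hA h0 => ?_
    by_contra hne
    have hpos : 0 < ν.real A := by
      rw [measureReal_def]
      exact ENNReal.toReal_pos hne (measure_ne_top _ _)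
    -- If `θ(A) = 0`, testing with `a 1_A` gives `a ν(A) ≤ c`; this `a` makes the left-hand side `c
    -- + 1`.
    set a : ℝ := (c + 1) / ν.real A
    have ha : 0 ≤ a := by positivity
    have h1 := h (A.indicator fun _ => a) a (measurable_const.indicator hA) (fun x => by
      by_cases hx : x ∈ A <;> simp [hx, ha, abs_of_nonneg ha])
    have e : (fun x => Real.exp (A.indicator (fun _ => a) x) - 1)
        = A.indicator fun _ => Real.exp a - 1 := by
      funext x
      by_cases hx : x ∈ A <;> simp [hx]
    rw [e, integral_indicator_const _ hA, integral_indicator_const _ hA, measureReal_def θ, h0] at h1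
    simp only [smul_eq_mul, ENNReal.toReal_zero, zero_mul, add_zero] at h1
    rw [mul_div_cancel₀ _ hpos.ne'] at h1
    linarith
  rw [klDiv_eq_lintegral_klFun_of_ac hac]
  set f : S → ℝ := fun x => (ν.rnDeriv θ x).toReal
  have hf : Measurable f := (Measure.measurable_rnDeriv _ _).ennreal_toReal
  have hf0 : ∀ x, 0 ≤ f x := fun x => ENNReal.toReal_nonneg
  -- The density clamped to `[e^{-n}, e^n]`, so that `log z` is bounded by `n`.
  let z : ℕ → S → ℝ := fun n x => max (Real.exp (-(n : ℝ))) (min (f x) (Real.exp n))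
  have hz : ∀ n, Measurable (z n) := fun n => measurable_const.max (hf.min measurable_const)
  have hzpos : ∀ n x, 0 < z n x := fun n x => lt_max_of_lt_left (Real.exp_pos _)
  have hle : ∀ n : ℕ, (Real.exp (-(n : ℝ))) ≤ Real.exp n := fun n =>
    Real.exp_le_exp.2 (by linarith [(Nat.cast_nonneg n : (0 : ℝ) ≤ n)])
  have hz2 : ∀ n x, z n x ≤ Real.exp n := fun n x => max_le (hle n) (min_le_right _ _)
  have hlog : ∀ n x, |Real.log (z n x)| ≤ n := fun n x => by
    rw [abs_le]
    constructor
    · rw [Real.le_log_iff_exp_le (hzpos n x)]; exact le_max_left _ _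
    · rw [Real.log_le_iff_le_exp (hzpos n x)]; exact hz2 n x
  have hlim : ∀ x, Tendsto (fun n => z n x) atTop (𝓝 (f x)) := by
    intro x
    have h1 : Tendsto (fun n : ℕ => Real.exp (-(n : ℝ))) atTop (𝓝 0) :=
      Real.tendsto_exp_neg_atTop_nhds_zero.comp tendsto_natCast_atTop_atTop
    have h2 : Tendsto (fun n : ℕ => min (f x) (Real.exp n)) atTop (𝓝 (f x)) := by
      refine tendsto_const_nhds.congr' ?_
      filter_upwards [(Real.tendsto_exp_atTop.comp
        tendsto_natCast_atTop_atTop).eventually_ge_atTop (f x)] with n hn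
      exact (min_eq_left hn).symm
    have := h1.max h2
    rwa [max_eq_right (hf0 x)] at this
  -- Clamping moves `f` towards `1`: `f ≤ z` where `z < 1` and `f ≥ z` where `z > 1`. Hence `(f - z)
  -- log z ≥ 0`.
  have hpt : ∀ n x, klFun (z n x) ≤ f x * Real.log (z n x) - (z n x - 1) := by
    intro n x
    rw [klFun_apply]
    have : 0 ≤ (f x - z n x) * Real.log (z n x) := by
      have h3 : (1 : ℝ) ≤ Real.exp n := by simp
      have h4 : Real.exp (-(n : ℝ)) ≤ 1 := by simp
      rcases lt_trichotomy (z n x) 1 with h1 | h1 | h1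
      · refine mul_nonneg_of_nonpos_of_nonpos ?_ (Real.log_nonpos (hzpos n x).le h1.le)
        have h2 : min (f x) (Real.exp n) ≤ z n x := le_max_right _ _
        rcases min_le_iff.1 h2 with h5 | h5 <;> linarith
      · rw [h1]; simp
      · refine mul_nonneg ?_ (Real.log_nonneg h1.le)
        rcases lt_max_iff.1 h1 with h2 | h2
        · linarith
        · have h5 : z n x = min (f x) (Real.exp n) := max_eq_right (h4.trans h2.le)
          rw [h5]; linarith [min_le_left (f x) (Real.exp n)]
    linarith
  have hbdd : ∀ n x, |z n x| ≤ Real.exp n := fun n x => by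
    rw [abs_of_pos (hzpos n x)]; exact hz2 n x
  have hzi : ∀ n, Integrable (fun x => z n x) θ := fun n => integrable_of_abs_le (hz n) (hbdd n)
  have hfz : ∀ n, Integrable (fun x => f x * Real.log (z n x)) θ := fun n =>
    Measure.integrable_toReal_rnDeriv.mul_bdd (c := n)
      (Real.measurable_log.comp (hz n)).aestronglyMeasurable (Eventually.of_forall (hlog n))
  have hzlog : ∀ n, Integrable (fun x => klFun (z n x)) θ := fun n => by
    have h1 : Integrable (fun x => z n x * Real.log (z n x)) θ :=
      (hzi n).mul_bdd (c := n)
        (Real.measurable_log.comp (hz n)).aestronglyMeasurable (Eventually.of_forall (hlog n))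
    exact (h1.add (integrable_const 1)).sub (hzi n)
  have hbound : ∀ n, ∫⁻ x, ENNReal.ofReal (klFun (z n x)) ∂θ ≤ c := by
    intro n
    rw [← ofReal_integral_eq_lintegral_ofReal (hzlog n)
      (Eventually.of_forall fun x => klFun_nonneg (hzpos n x).le)]
    refine ENNReal.ofReal_le_of_le_toReal ?_
    rw [ENNReal.coe_toReal]
    have h1 := h (fun x => Real.log (z n x)) n (Real.measurable_log.comp (hz n)) (hlog n)
    simp only [Real.exp_log (hzpos n _)] at h1
    rw [← integral_toReal_rnDeriv_mul hac] at h1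
    have h2 := integral_mono (hzlog n) ((hfz n).sub ((hzi n).sub (integrable_const 1))) (hpt n)
    rw [integral_sub' (hfz n) ((hzi n).sub (integrable_const 1))] at h2
    simp only [Pi.sub_apply] at h2
    linarith
  have hconv : ∀ x, liminf (fun n => ENNReal.ofReal (klFun (z n x))) atTop
      = ENNReal.ofReal (klFun (f x)) := fun x =>
    (ENNReal.tendsto_ofReal ((continuous_klFun.tendsto _).comp (hlim x))).liminf_eq
  calc ∫⁻ x, ENNReal.ofReal (klFun (f x)) ∂θ
      = ∫⁻ x, liminf (fun n => ENNReal.ofReal (klFun (z n x))) atTop ∂θ := by simp only [hconv]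
    _ ≤ liminf (fun n => ∫⁻ x, ENNReal.ofReal (klFun (z n x)) ∂θ) atTop :=
        lintegral_liminf_le fun n =>
          ENNReal.measurable_ofReal.comp (measurable_klFun.comp (hz n))
    _ ≤ liminf (fun _ : ℕ => (c : ℝ≥0∞)) atTop :=
        liminf_le_liminf (Eventually.of_forall hbound)
    _ = c := liminf_const _

/-- A bounded measurable test function is approximated in `L¹(ν + θ)` by a continuous one. Clipping
the approximation at the bound `B` does not worsen it, and the exponential is Lipschitz with
constant `e^B` on `[-B, B]`. -/
theorem klDiv_le_of_forall_boundedContinuous [PseudoEMetricSpace S] [BorelSpace S] {ν θ : Measure S}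
    [IsFiniteMeasure ν] [IsFiniteMeasure θ] {c : ℝ≥0}
    (h : ∀ g : S →ᵇ ℝ, ∫ x, g x ∂ν ≤ c + ∫ x, (Real.exp (g x) - 1) ∂θ) : klDiv ν θ ≤ c := by
  refine klDiv_le_of_forall_measurable fun g B hg hB => ?_
  rcases isEmpty_or_nonempty S with hS | ⟨⟨x0⟩⟩
  · rw [integral_eq_zero_of_ae (Eventually.of_forall fun s => (hS.false s).elim),
      integral_eq_zero_of_ae (Eventually.of_forall fun s => (hS.false s).elim)]
    simp
  have hB0 : 0 ≤ B := (abs_nonneg _).trans (hB x0)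
  refine le_of_forall_pos_le_add fun ε hε => ?_
  -- The replacement costs at most `δ` under `ν` and `e^B δ` under `θ`.
  set δ : ℝ := ε / (1 + Real.exp B)
  have hδ : 0 < δ := by positivity
  obtain ⟨k, hk, -⟩ := (integrable_of_abs_le (μ := ν + θ) hg hB).exists_boundedContinuous_integral_sub_le hδ
  let m : S → ℝ := fun x => max (-B) (min (k x) B)
  have hmc : Continuous m := by fun_prop
  have hmB : ∀ x, |m x| ≤ B := fun x =>
    abs_le.2 ⟨le_max_left _ _, max_le (by linarith) (min_le_right _ _)⟩
  have hmg : ∀ x, |g x - m x| ≤ |g x - k x| := by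
    intro x
    have h1 := abs_le.1 (hB x)
    have h2 : m x = max (-B) (min (k x) B) := rfl
    have : g x = max (-B) (min (g x) B) := by rw [min_eq_left h1.2, max_eq_right h1.1]
    rw [h2]
    conv_lhs => rw [this]
    refine (abs_max_sub_max_le_max _ _ _ _).trans ?_
    simp only [sub_self, abs_zero, abs_nonneg, sup_of_le_right]
    refine (abs_min_sub_min_le_max _ _ _ _).trans ?_
    simp
  let m' : S →ᵇ ℝ := BoundedContinuousFunction.ofNormedAddCommGroup m hmc B hmB
  have hm' := h m'
  change ∫ x, m x ∂ν ≤ c + ∫ x, (Real.exp (m x) - 1) ∂θ at hm'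
  have hgk : ∀ μ : Measure S, IsFiniteMeasure μ → Integrable (fun x => |g x - k x|) μ := fun μ _ =>
    ((integrable_of_abs_le hg hB).sub (k.integrable μ)).norm
  have hsum : ∫ x, |g x - k x| ∂ν + ∫ x, |g x - k x| ∂θ ≤ δ := by
    rw [← integral_add_measure (hgk ν inferInstance) (hgk θ inferInstance)]
    exact hk
  have e1 : ∫ x, g x ∂ν - ∫ x, m x ∂ν ≤ ∫ x, |g x - k x| ∂ν := by
    rw [← integral_sub (integrable_of_abs_le hg hB) (integrable_of_abs_le hmc.measurable hmB)]
    exact integral_mono ((integrable_of_abs_le hg hB).sub (integrable_of_abs_le hmc.measurable hmB))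
      (hgk ν inferInstance) fun x => (le_abs_self _).trans (hmg x)
  have hexp : ∀ x, (Real.exp (m x) - 1) - (Real.exp (g x) - 1) ≤ Real.exp B * |g x - k x| := by
    intro x
    have h1 := Real.add_one_le_exp (g x - m x)
    have h2 : Real.exp (g x) = Real.exp (m x) * Real.exp (g x - m x) := by
      rw [← Real.exp_add]; ring_nf
    have h3 : Real.exp (m x) ≤ Real.exp B := Real.exp_le_exp.2 ((le_abs_self _).trans (hmB x))
    have h4 : Real.exp (m x) - Real.exp (g x) ≤ Real.exp (m x) * (-(g x - m x)) := by
      rw [h2]; nlinarith [Real.exp_pos (m x)]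
    have h5 : Real.exp (m x) * (-(g x - m x)) ≤ Real.exp (m x) * |g x - k x| :=
      mul_le_mul_of_nonneg_left ((neg_le_abs _).trans (hmg x)) (Real.exp_pos _).le
    have h6 : Real.exp (m x) * |g x - k x| ≤ Real.exp B * |g x - k x| :=
      mul_le_mul_of_nonneg_right h3 (abs_nonneg _)
    linarith
  have e2 : ∫ x, (Real.exp (m x) - 1) ∂θ - ∫ x, (Real.exp (g x) - 1) ∂θ
      ≤ Real.exp B * ∫ x, |g x - k x| ∂θ := by
    rw [← integral_sub (integrable_exp_of_abs_le hmc.measurable hmB)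
      (integrable_exp_of_abs_le hg hB), ← integral_const_mul]
    exact integral_mono ((integrable_exp_of_abs_le hmc.measurable hmB).sub
      (integrable_exp_of_abs_le hg hB)) ((hgk θ inferInstance).const_mul _) hexp
  have n1 : 0 ≤ ∫ x, |g x - k x| ∂ν := integral_nonneg fun _ => abs_nonneg _
  have n2 : 0 ≤ ∫ x, |g x - k x| ∂θ := integral_nonneg fun _ => abs_nonneg _
  have hδε : (1 + Real.exp B) * δ = ε := mul_div_cancel₀ _ (by positivity)
  nlinarith [Real.exp_pos B, mul_nonneg (Real.exp_pos B).le n1,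
    mul_le_mul_of_nonneg_left hsum (Real.exp_pos B).le]

/-- By the two halves of the variational formula, a sublevel set is an intersection of weakly closed
sets, one for each bounded continuous test function. -/
theorem lowerSemicontinuous_klDiv [PseudoEMetricSpace S] [BorelSpace S] (θ : Measure S)
    [IsFiniteMeasure θ] :
    LowerSemicontinuous fun ν : ProbabilityMeasure S => klDiv (ν : Measure S) θ := by
  rw [lowerSemicontinuous_iff_isClosed_preimage]
  intro c
  rcases eq_or_ne c ∞ with rfl | hc
  · simp
  lift c to ℝ≥0 using hc
  have : (fun ν : ProbabilityMeasure S => klDiv (ν : Measure S) θ) ⁻¹' Iic (c : ℝ≥0∞)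
      = ⋂ g : S →ᵇ ℝ, {ν : ProbabilityMeasure S |
        ∫ x, g x ∂(ν : Measure S) ≤ c + ∫ x, (Real.exp (g x) - 1) ∂θ} := by
    ext ν
    simp only [mem_preimage, mem_Iic, mem_iInter, mem_ofPred_eq]
    exact ⟨fun h g => integral_le_klDiv_add h g.continuous.measurable g.norm_coe_le_norm,
      klDiv_le_of_forall_boundedContinuous⟩
  rw [this]
  exact isClosed_iInter fun g => isClosed_le
    (ProbabilityMeasure.continuous_integral_boundedContinuousFunction g) continuous_const

end Entropy

/-! ### The exponential distribution -/

instance : IsProbabilityMeasure theta :=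
  haveI := isProbabilityMeasure_expMeasure one_pos
  Measure.isProbabilityMeasure_map measurable_real_toNNReal.aemeasurable

/-- The exponential density is at most `1` and vanishes on the negative half-line. -/
theorem theta_apply_le {A : Set ℝ≥0} (hA : MeasurableSet A) :
    theta A ≤ volume {x : ℝ | 0 ≤ x ∧ x.toNNReal ∈ A} := by
  rw [theta, Measure.map_apply measurable_real_toNNReal hA, expMeasure, gammaMeasure,
    withDensity_apply _ (measurable_real_toNNReal hA)]
  have h : ∀ x, gammaPDF 1 1 x ≤ (Ici (0 : ℝ)).indicator 1 x := by
    intro x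
    change exponentialPDF 1 x ≤ _
    by_cases hx : 0 ≤ x
    · rw [indicator_of_mem (show x ∈ Ici (0 : ℝ) from hx), exponentialPDF_of_nonneg hx]
      simpa using hx
    · rw [exponentialPDF_of_neg (not_le.1 hx)]
      exact bot_le
  refine (lintegral_mono h).trans ?_
  rw [lintegral_indicator_one measurableSet_Ici, Measure.restrict_apply measurableSet_Ici]
  rfl

theorem theta_near_le (c δ : ℝ) :
    theta {σ : ℝ≥0 | |(σ : ℝ) - c| ≤ δ} ≤ ENNReal.ofReal (2 * δ) := by
  have hA : MeasurableSet {σ : ℝ≥0 | |(σ : ℝ) - c| ≤ δ} :=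
    (isClosed_le (by fun_prop) continuous_const).measurableSet
  refine (theta_apply_le hA).trans ((measure_mono (t := Icc (c - δ) (c + δ)) ?_).trans_eq ?_)
  · rintro x ⟨hx, hxA⟩
    have : |((x.toNNReal : ℝ≥0) : ℝ) - c| ≤ δ := hxA
    rw [Real.coe_toNNReal x hx, abs_le] at this
    exact ⟨by linarith, by linarith⟩
  · rw [Real.volume_Icc]; ring_nf

end

section

/-! ### Weak convergence -/

section WeakConvergence

variable {X : Type*} [MeasurableSpace X]

/-- Layer cake: Lévy–Prokhorov closeness compares `μ{F ≥ t}` with the `ν`-mass of the `δ`-thickening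
of that set, on which `F ≥ t - Lδ`. The bound depends on `F` only through `L`, whence uniformity
over Lipschitz families. -/
theorem integral_le_of_levyProkhorovEDist_lt [PseudoMetricSpace X] [BorelSpace X]
    {μ ν : Measure X}
    [IsProbabilityMeasure μ] [IsProbabilityMeasure ν] {δ : ℝ} (hδ : 0 < δ)
    (h : levyProkhorovEDist μ ν < ENNReal.ofReal δ) {L : ℝ≥0} {F : X → ℝ} (hF : ∀ x, |F x| ≤ 1)
    (hL : LipschitzWith L F) :
    ∫ x, F x ∂μ ≤ ∫ x, F x ∂ν + (L + 2) * δ := by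
  -- Shifted to be nonnegative; the bound `‖f‖ ≤ 2` produces the `2` in the constant `L + 2`.
  obtain ⟨f, hf, hfn⟩ : ∃ f : X →ᵇ ℝ, (∀ x, f x = F x + 1) ∧ ‖f‖ ≤ 2 := by
    have hb : ∀ x, ‖F x + 1‖ ≤ 2 := fun x => by
      have := abs_le.1 (hF x)
      rw [Real.norm_eq_abs, abs_le]; constructor <;> linarith
    exact ⟨BoundedContinuousFunction.ofNormedAddCommGroup (fun x => F x + 1)
      (hL.continuous.add continuous_const) 2 hb, fun x => rfl,
      BoundedContinuousFunction.norm_ofNormedAddCommGroup_le _ (by norm_num) hb⟩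
  have hf0 : ∀ x, 0 ≤ f x := fun x => by rw [hf]; linarith [(abs_le.1 (hF x)).1]
  have h1 := BoundedContinuousFunction.integral_le_of_levyProkhorovEDist_lt μ ν hδ h f
    (ae_of_all _ hf0)
  have hLδ : 0 ≤ (L : ℝ) * δ := by positivity
  have hthick : ∀ t, Metric.thickening δ {a | t ≤ f a} ⊆ {a | t ≤ f a + L * δ} := by
    intro t a ha
    rw [Metric.mem_thickening_iff_exists_edist_lt] at ha
    obtain ⟨b, hb, hab⟩ := ha
    have h2 : edist (F a) (F b) ≤ L * ENNReal.ofReal δ := (hL a b).trans (by gcongr)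
    rw [edist_dist, ← ENNReal.ofReal_coe_nnreal, ← ENNReal.ofReal_mul (NNReal.coe_nonneg L),
      ENNReal.ofReal_le_ofReal_iff hLδ, Real.dist_eq, abs_le] at h2
    have hb' : t ≤ f b := hb
    change t ≤ f a + L * δ
    rw [hf] at hb' ⊢
    linarith
  have hmeas : ∀ g : ℝ → Set X, (∀ s t, s ≤ t → g t ⊆ g s) → ∀ M : ℝ,
      IntegrableOn (fun t => ν.real (g t)) (Ioc 0 M) := by
    intro g hg M
    refine Measure.integrableOn_of_bounded (M := 1) measure_Ioc_lt_top.ne ?_ ?_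
    · exact (Measurable.ennreal_toReal (Antitone.measurable fun s t hst =>
        measure_mono (hg s t hst))).aestronglyMeasurable
    · exact Eventually.of_forall fun t => by
        rw [Real.norm_eq_abs, abs_of_nonneg measureReal_nonneg]; exact measureReal_le_one
  have hint : Integrable (fun x => f x + L * δ) ν := (f.integrable ν).add (integrable_const _)
  have h3 := Integrable.integral_eq_integral_Ioc_meas_le (M := ‖f‖ + L * δ) hint
    (Eventually.of_forall fun x => add_nonneg (hf0 x) hLδ)
    (Eventually.of_forall fun x => by
      have := f.apply_le_norm x
      linarith)
  have h4 : ∫ t in Ioc 0 ‖f‖, ν.real (Metric.thickening δ {a | t ≤ f a})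
      ≤ ∫ t in Ioc 0 (‖f‖ + L * δ), ν.real {a | t ≤ f a + L * δ} := by
    have hm1 := hmeas (fun t => Metric.thickening δ {a | t ≤ f a})
      (fun s t hst => Metric.thickening_subset_of_subset _ fun a ha => hst.trans ha) ‖f‖
    have hm2 := hmeas (fun t => {a | t ≤ f a + L * δ}) (fun s t hst a ha => hst.trans ha)
    refine (setIntegral_mono hm1 (hm2 ‖f‖) fun t => measureReal_mono (hthick t)).trans ?_
    exact setIntegral_mono_set (hm2 _) (Eventually.of_forall fun _ => measureReal_nonneg)
      (Ioc_subset_Ioc_right (by linarith)).eventuallyLE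
  rw [← h3, integral_add (f.integrable ν) (integrable_const _), integral_const, probReal_univ,
    one_smul] at h4
  have hFi : ∀ κ : Measure X, IsProbabilityMeasure κ → ∫ x, f x ∂κ = ∫ x, F x ∂κ + 1 := by
    intro κ _
    have : Integrable F κ := Integrable.of_bound hL.continuous.measurable.aestronglyMeasurable 1
      (Eventually.of_forall hF)
    simp only [hf]
    rw [integral_add this (integrable_const _)]
    simp
  rw [hFi μ inferInstance] at h1
  rw [hFi ν inferInstance] at h4
  have h5 : δ * ‖f‖ ≤ δ * 2 := mul_le_mul_of_nonneg_left hfn hδ.le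
  have h6 : ((L : ℝ) + 2) * δ = L * δ + δ * 2 := by ring
  rw [h6]
  linarith

/-- Weak convergence is uniform over bounded sets of Lipschitz functions. -/
theorem eventually_integral_lipschitz_le [PseudoMetricSpace X] [SecondCountableTopology X]
    [BorelSpace X] {P : ProbabilityMeasure X} {Pn : ℕ → ProbabilityMeasure X}
    (h : Tendsto Pn atTop (𝓝 P)) (L : ℝ≥0) {ε : ℝ} (hε : 0 < ε) :
    ∀ᶠ n in atTop, ∀ F : X → ℝ, (∀ x, |F x| ≤ 1) → LipschitzWith L F →
      |∫ x, F x ∂(Pn n : Measure X) - ∫ x, F x ∂(P : Measure X)| ≤ ε := by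
  set δ : ℝ := ε / (L + 2)
  have hδ : 0 < δ := by positivity
  have h1 := (LevyProkhorov.continuous_ofMeasure_probabilityMeasure (Ω := X)).tendsto P |>.comp h
  have h2 := EMetric.tendsto_nhds.1 h1 (ENNReal.ofReal δ) (ENNReal.ofReal_pos.2 hδ)
  filter_upwards [h2] with n hn F hF hL
  have hn' : levyProkhorovEDist (Pn n : Measure X) (P : Measure X) < ENNReal.ofReal δ := hn
  have a1 := integral_le_of_levyProkhorovEDist_lt hδ hn' hF hL
  rw [levyProkhorovEDist_comm] at hn'
  have a2 := integral_le_of_levyProkhorovEDist_lt hδ hn' hF hL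
  have : (L + 2) * δ = ε := mul_div_cancel₀ _ (by positivity)
  rw [abs_le]
  constructor <;> linarith

/-- The sets `{t < f}` are open, so the portmanteau theorem bounds each layer, and Fatou's lemma
integrates the bounds over `t`. Truncating `f` at `N` makes the layer-cake formula real-valued;
monotone convergence then lets `N → ∞`. -/
theorem lintegral_le_liminf_of_tendsto [TopologicalSpace X] [OpensMeasurableSpace X]
    [HasOuterApproxClosed X] {P : ProbabilityMeasure X} {Pn : ℕ → ProbabilityMeasure X}
    (h : Tendsto Pn atTop (𝓝 P)) {f : X → ℝ≥0∞} (hf : LowerSemicontinuous f) :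
    ∫⁻ x, f x ∂(P : Measure X) ≤ liminf (fun n => ∫⁻ x, f x ∂(Pn n : Measure X)) atTop := by
  have hfm : Measurable f := hf.measurable
  have key : ∀ N : ℕ, ∫⁻ x, min (f x) N ∂(P : Measure X)
      ≤ liminf (fun n => ∫⁻ x, f x ∂(Pn n : Measure X)) atTop := by
    intro N
    have hfin : ∀ x, min (f x) N ≠ ∞ := fun x =>
      ((min_le_right _ _).trans_lt (ENNReal.natCast_lt_top N)).ne
    let g : X → ℝ := fun x => (min (f x) N).toReal
    have hg : Measurable g := (hfm.min measurable_const).ennreal_toReal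
    have hg0 : ∀ x, 0 ≤ g x := fun x => ENNReal.toReal_nonneg
    have hcake : ∀ Q : Measure X, ∫⁻ x, min (f x) N ∂Q = ∫⁻ t in Ioi (0 : ℝ), Q {x | t < g x} := by
      intro Q
      rw [← lintegral_eq_lintegral_meas_lt Q (Eventually.of_forall hg0) hg.aemeasurable]
      simp only [g, ENNReal.ofReal_toReal (hfin _)]
    have hopen : ∀ t : ℝ, 0 < t → IsOpen {x | t < g x} := by
      intro t ht
      have : {x | t < g x} = if ENNReal.ofReal t < N then f ⁻¹' Ioi (ENNReal.ofReal t) else ∅ := by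
        ext x
        simp only [g, mem_ofPred_eq, ← ENNReal.ofReal_lt_iff_lt_toReal ht.le (hfin x), lt_min_iff]
        split_ifs with hN <;> simp [hN]
      rw [this]
      split_ifs
      · exact hf.isOpen_preimage _
      · exact isOpen_empty
    rw [hcake]
    calc ∫⁻ t in Ioi (0 : ℝ), (P : Measure X) {x | t < g x}
        ≤ ∫⁻ t in Ioi (0 : ℝ), liminf (fun n => (Pn n : Measure X) {x | t < g x}) atTop :=
          setLIntegral_mono' measurableSet_Ioi fun t ht =>
            ProbabilityMeasure.le_liminf_measure_open_of_tendsto h (hopen t ht)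
      _ ≤ liminf (fun n => ∫⁻ t in Ioi (0 : ℝ), (Pn n : Measure X) {x | t < g x}) atTop :=
          lintegral_liminf_le fun n => Antitone.measurable fun s t hst =>
            measure_mono fun x hx => lt_of_le_of_lt hst hx
      _ ≤ liminf (fun n => ∫⁻ x, f x ∂(Pn n : Measure X)) atTop := by
          refine liminf_le_liminf (Eventually.of_forall fun n => ?_)
          rw [← hcake]
          exact lintegral_mono fun x => min_le_left _ _
  have hsup : ∀ x, ⨆ N : ℕ, min (f x) N = f x := by
    intro x
    rw [← inf_iSup_eq, ENNReal.iSup_natCast, inf_top_eq]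
  calc ∫⁻ x, f x ∂(P : Measure X) = ∫⁻ x, ⨆ N : ℕ, min (f x) N ∂(P : Measure X) := by
        simp only [hsup]
    _ = ⨆ N : ℕ, ∫⁻ x, min (f x) N ∂(P : Measure X) :=
        lintegral_iSup (fun N => hfm.min measurable_const) fun a b hab x =>
          min_le_min_left _ (by exact_mod_cast hab)
    _ ≤ _ := iSup_le key

theorem lowerSemicontinuous_lintegral [PseudoMetricSpace X] [SecondCountableTopology X]
    [BorelSpace X] {f : X → ℝ≥0∞} (hf : LowerSemicontinuous f) :
    LowerSemicontinuous fun P : ProbabilityMeasure X => ∫⁻ x, f x ∂(P : Measure X) := by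
  rw [lowerSemicontinuous_iff_isClosed_preimage]
  intro c
  refine IsSeqClosed.isClosed fun Pn P hPn h => ?_
  exact (lintegral_le_liminf_of_tendsto h hf).trans
    ((liminf_le_liminf (Eventually.of_forall hPn)).trans_eq (liminf_const c))

end WeakConvergence

end

/-! ### Path space and the uniqueness of Wiener measure. -/

section

variable {d : ℕ} {T : ℝ}

/-! ### The Borel structure of path space -/

theorem continuous_eval_path (t : Time T) : Continuous fun x : PathSpace d T => x t :=
  ContinuousEvalConst.continuous_eval_const t

/-- A continuous path is determined by its values on a countable dense set, and Lusin–Souslin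
applies to this injection. Hence evaluations generate the Borel sets of path space. -/
theorem exists_countable_measurableEmbedding_eval (d : ℕ) (T : ℝ) : ∃ D : Set (Time T), D.Countable ∧
    MeasurableEmbedding fun (x : PathSpace d T) (t : D) => x t := by
  obtain ⟨D, hD, hdense⟩ := TopologicalSpace.exists_countable_dense (Time T)
  have : Countable D := hD
  refine ⟨D, hD, Continuous.measurableEmbedding
    (continuous_pi fun t => continuous_eval_path (t : Time T)) fun x y h => ?_⟩
  refine DFunLike.coe_injective (Continuous.ext_on hdense x.continuous y.continuous fun t ht => ?_)
  exact congrFun h ⟨t, ht⟩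

theorem measurable_path {Ω : Type*} [MeasurableSpace Ω] {X : Ω → PathSpace d T}
    (h : ∀ t, Measurable fun ω => X ω t) : Measurable X := by
  obtain ⟨D, -, hD⟩ := exists_countable_measurableEmbedding_eval d T
  rw [← hD.measurable_comp_iff]
  exact measurable_pi_lambda _ fun t => h t

/-- Characteristic functions determine the finite-dimensional marginals, these determine the law on
the full product as a projective limit, and restriction to countably many times embeds path space.
-/
theorem path_measure_ext {μ ν : Measure (PathSpace d T)} [IsFiniteMeasure μ] [IsFiniteMeasure ν]
    (h : ∀ (J : Finset (Time T)) (a : Time T → E d),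
      ∫ x, Complex.exp ((∑ j ∈ J, inner ℝ (x j) (a j) : ℝ) * Complex.I) ∂μ
        = ∫ x, Complex.exp ((∑ j ∈ J, inner ℝ (x j) (a j) : ℝ) * Complex.I) ∂ν) : μ = ν := by
  obtain ⟨D, hDc, hD⟩ := exists_countable_measurableEmbedding_eval d T
  have hev : Measurable fun (x : PathSpace d T) (t : Time T) => x t :=
    measurable_pi_lambda _ fun t => (continuous_eval_path t).measurable
  have hfd : ∀ J : Finset (Time T), (μ.map fun (x : PathSpace d T) (t : J) => x t)
      = ν.map fun (x : PathSpace d T) (t : J) => x t := by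
    intro J
    have hJ : Measurable fun (x : PathSpace d T) (t : J) => x t :=
      measurable_pi_lambda _ fun t => (continuous_eval_path (t : Time T)).measurable
    have hfin1 : IsFiniteMeasure (μ.map fun (x : PathSpace d T) (t : J) => x t) :=
      Measure.isFiniteMeasure_map _ _
    have hfin2 : IsFiniteMeasure (ν.map fun (x : PathSpace d T) (t : J) => x t) :=
      Measure.isFiniteMeasure_map _ _
    refine Measure.ext_of_charFunDual ?_
    funext L
    have hc : ∀ κ : Measure (PathSpace d T), IsFiniteMeasure κ →
        charFunDual (κ.map fun (x : PathSpace d T) (t : J) => x t) L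
          = ∫ x : PathSpace d T, Complex.exp ((L fun t : J => x t : ℝ) * Complex.I) ∂κ := by
      intro κ _
      rw [charFunDual_apply, integral_map hJ.aemeasurable]
      exact (by fun_prop : Continuous fun v : J → E d =>
        Complex.exp ((L v : ℝ) * Complex.I)).aestronglyMeasurable
    -- Riesz representatives of the components of `L`.
    let a : Time T → E d := fun t => if ht : t ∈ J then
      (InnerProductSpace.toDual ℝ (E d)).symm
        (L.comp (ContinuousLinearMap.single ℝ (fun _ : J => E d) ⟨t, ht⟩)) else 0
    have ha : ∀ x : PathSpace d T, L (fun t : J => x t) = ∑ j ∈ J, inner ℝ (x j) (a j) := by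
      intro x
      rw [← Finset.sum_coe_sort]
      have h1 : (fun t : J => x t) = ∑ t : J, Pi.single t (x t) := by
        funext t
        rw [Finset.sum_apply, Finset.sum_pi_single]
        simp
      rw [h1, map_sum]
      refine Finset.sum_congr rfl fun t _ => ?_
      rw [real_inner_comm]
      simp only [a, t.2, dif_pos, InnerProductSpace.toDual_symm_apply]
      rfl
    rw [hc μ inferInstance, hc ν inferInstance]
    simp only [ha]
    exact h J a
  have hlim : ∀ κ : Measure (PathSpace d T), IsProjectiveLimit
      (κ.map fun (x : PathSpace d T) (t : Time T) => x t)
      (fun J => κ.map fun (x : PathSpace d T) (t : J) => x t) := by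
    intro κ J
    rw [Measure.map_map (Finset.measurable_restrict J) hev]
    rfl
  have hall : (μ.map fun (x : PathSpace d T) (t : Time T) => x t)
      = ν.map fun (x : PathSpace d T) (t : Time T) => x t := by
    have : ∀ J : Finset (Time T), IsFiniteMeasure
        (μ.map fun (x : PathSpace d T) (t : J) => x t) := fun J =>
      Measure.isFiniteMeasure_map _ _
    refine (hlim μ).unique ?_
    have h2 := hlim ν
    simp only [← hfd] at h2
    exact h2
  have hres : ∀ κ : Measure (PathSpace d T), (κ.map fun (x : PathSpace d T) (t : D) => x t)
      = (κ.map fun (x : PathSpace d T) (t : Time T) => x t).map (fun f (t : D) => f t) := by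
    intro κ
    rw [Measure.map_map (measurable_pi_lambda _ fun t => measurable_pi_apply _) hev]
    rfl
  rw [← hD.comap_map μ, ← hD.comap_map ν, hres μ, hres ν, hall]

/-! ### Wiener measure is determined by its increments -/

/-- A law on path space under which the coordinate process is a standard Brownian motion for its
own filtration. -/
structure IsWiener (μ : Measure (PathSpace d T)) : Prop where
  start : ∀ t : Time T, (t : ℝ) = 0 → ∀ᵐ x ∂μ, x t = 0
  indep : ∀ s t : Time T, s ≤ t → IndepFun (stopPath s) (fun x => x t - x s) μ
  law : ∀ s t : Time T, s ≤ t → μ.map (fun x => x t - x s) =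
    (stdGaussian (E d)).map (fun z => Real.sqrt ((t : ℝ) - s) • z)

/-- Write `x(t) = x(s) + (x(t) - x(s))`. The increment is independent of the path stopped at `s`, so
its factor splits off, and the frequency `a t` is added to the one at `s`. When `s ∉ J`, `x(s) = 0`
almost surely and the update has no effect. -/
theorem IsWiener.integral_insert {μ : Measure (PathSpace d T)} [IsProbabilityMeasure μ]
    (hμ : IsWiener μ) {J : Finset (Time T)} {s t : Time T} (hst : s ≤ t) (ht : t ∉ J)
    (hJs : ∀ j ∈ J, j ≤ s) (hs : s ∈ J ∨ (s : ℝ) = 0 ∧ s ∉ J) (a : Time T → E d) :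
    ∫ x, Complex.exp ((∑ j ∈ insert t J, inner ℝ (x j) (a j) : ℝ) * Complex.I) ∂μ
      = (∫ x, Complex.exp ((∑ j ∈ J, inner ℝ (x j) ((Function.update a s (a s + a t)) j) : ℝ)
          * Complex.I) ∂μ) *
        ∫ z, Complex.exp ((inner ℝ z (a t) : ℝ) * Complex.I)
          ∂((stdGaussian (E d)).map (fun z => Real.sqrt ((t : ℝ) - s) • z)) := by
  set a' := Function.update a s (a s + a t)
  have hm : Measurable fun x : PathSpace d T => x t - x s :=
    ((continuous_eval_path t).sub (continuous_eval_path s)).measurable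
  have hc1 : Continuous fun x : PathSpace d T =>
      Complex.exp ((∑ j ∈ J, inner ℝ (x j) (a' j) : ℝ) * Complex.I) := by
    have : ∀ j, Continuous fun x : PathSpace d T => (inner ℝ (x j) (a' j) : ℝ) := fun j =>
      (continuous_eval_path j).inner continuous_const
    fun_prop
  have hc2 : Continuous fun z : E d => Complex.exp ((inner ℝ z (a t) : ℝ) * Complex.I) := by
    fun_prop
  rw [← hμ.law s t hst, integral_map hm.aemeasurable hc2.aestronglyMeasurable]
  have h1 := (hμ.indep s t hst).integral_fun_comp_mul_comp (𝕜 := ℂ)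
    (continuous_stopPath s).measurable.aemeasurable hm.aemeasurable
    hc1.aestronglyMeasurable hc2.aestronglyMeasurable
  have hstopped : ∀ x : PathSpace d T, ∑ j ∈ J, inner ℝ (stopPath s x j) (a' j)
      = ∑ j ∈ J, inner ℝ (x j) (a' j) := fun x =>
    Finset.sum_congr rfl fun j hj => by rw [stopPath_apply, min_eq_left (hJs j hj)]
  simp only [hstopped] at h1
  rw [← h1]
  have hs0 : ∀ᵐ x ∂μ, s ∉ J → x s = 0 := by
    rcases hs with hs | ⟨hs, -⟩
    · exact Eventually.of_forall fun x hx => absurd hs hx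
    · filter_upwards [hμ.start s hs] with x hx _ using hx
  refine integral_congr_ae ?_
  filter_upwards [hs0] with x hx
  rw [← Complex.exp_add, ← add_mul, ← Complex.ofReal_add]
  congr 3
  rw [Finset.sum_insert ht, inner_sub_left]
  by_cases hsJ : s ∈ J
  · rw [← Finset.add_sum_erase J _ hsJ, ← Finset.add_sum_erase J _ hsJ]
    have h2 : ∑ j ∈ J.erase s, inner ℝ (x j) (a' j) = ∑ j ∈ J.erase s, inner ℝ (x j) (a j) :=
      Finset.sum_congr rfl fun j hj => by
        rw [show a' j = a j from Function.update_of_ne (Finset.ne_of_mem_erase hj) _ _]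
    rw [h2, show a' s = a s + a t from Function.update_self _ _ _, inner_add_right]
    ring
  · have h2 : ∑ j ∈ J, inner ℝ (x j) (a' j) = ∑ j ∈ J, inner ℝ (x j) (a j) :=
      Finset.sum_congr rfl fun j hj => by
        rw [show a' j = a j from Function.update_of_ne (ne_of_mem_of_not_mem hj hsJ) _ _]
    rw [h2, hx hsJ, inner_zero_left]
    ring

/-- Induction on the finite set of times, removing the largest one; its predecessor, or time `0`,
plays the role of `s`. -/
theorem IsWiener.unique {μ ν : Measure (PathSpace d T)} [IsProbabilityMeasure μ]
    [IsProbabilityMeasure ν] (hμ : IsWiener μ) (hν : IsWiener ν) : μ = ν := by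
  refine path_measure_ext fun J => ?_
  induction J using Finset.induction_on_max with
  | empty => simp
  | insert t J hJ ih =>
    intro a
    have ht : t ∉ J := fun h => lt_irrefl _ (hJ t h)
    obtain ⟨s, hst, hJs, hs⟩ : ∃ s : Time T, s ≤ t ∧ (∀ j ∈ J, j ≤ s) ∧
        (s ∈ J ∨ (s : ℝ) = 0 ∧ s ∉ J) := by
      rcases J.eq_empty_or_nonempty with rfl | hne
      · exact ⟨⟨0, le_rfl, t.2.1.trans t.2.2⟩, t.2.1, by simp, Or.inr ⟨rfl, by simp⟩⟩
      · exact ⟨J.max' hne, (hJ _ (J.max'_mem hne)).le, fun j hj => J.le_max' j hj,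
          Or.inl (J.max'_mem hne)⟩
    rw [hμ.integral_insert hst ht hJs hs, hν.integral_insert hst ht hJs hs, ih]

end

/-! ### Removing and restoring the relaxed control. -/

section

variable {d : ℕ} {T : ℝ}

/-! ### Laws of the controlled path, the driving path and the threshold -/

/-- The canonical space without the relaxed control. -/
abbrev RedSpace (d : ℕ) (T : ℝ) : Type := PathSpace d T × PathSpace d T × ℝ≥0

/-- Forgetting the relaxed control. -/
def forgetControl (ξ : Xi d T) : RedSpace d T := (ctrlPath ξ, drivPath ξ, threshold ξ)

/-- Stopping both paths at time `s`. -/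
def stopRed (s : Time T) (x : RedSpace d T) : RedSpace d T :=
  (stopPath s x.1, stopPath s x.2.1, x.2.2)

/-- The drift part of the controlled path. -/
def drift (x : RedSpace d T) : PathSpace d T := x.1 - x.2.1

/-- Laws under which the second path is a standard Brownian motion for the filtration generated by
both paths and the threshold. -/
structure Admissible (P : Measure (RedSpace d T)) : Prop where
  start : ∀ t : Time T, (t : ℝ) = 0 → ∀ᵐ x ∂P, x.2.1 t = 0
  indep : ∀ s t : Time T, s ≤ t → IndepFun (stopRed s) (fun x => x.2.1 t - x.2.1 s) P
  law : ∀ s t : Time T, s ≤ t → P.map (fun x => x.2.1 t - x.2.1 s) =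
    (stdGaussian (E d)).map (fun z => Real.sqrt ((t : ℝ) - s) • z)

/-- The cost of a law on the reduced space. -/
def redCost (P : Measure (RedSpace d T)) : ℝ≥0∞ :=
  ∫⁻ x, (1 / 2) * h1Energy (drift x) ∂P +
    InformationTheory.klDiv (P.map fun x => x.2.2) theta

theorem continuous_drift : Continuous (drift : RedSpace d T → PathSpace d T) :=
  continuous_fst.sub (continuous_fst.comp continuous_snd)

theorem continuous_stopRed (s : Time T) : Continuous (stopRed s : RedSpace d T → RedSpace d T) :=
  ((continuous_stopPath s).comp continuous_fst).prodMk
    (((continuous_stopPath s).comp (continuous_fst.comp continuous_snd)).prodMk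
      (continuous_snd.comp continuous_snd))

theorem continuous_increment (s t : Time T) :
    Continuous fun x : RedSpace d T => x.2.1 t - x.2.1 s :=
  ((continuous_eval_path t).comp (continuous_fst.comp continuous_snd)).sub
    ((continuous_eval_path s).comp (continuous_fst.comp continuous_snd))

theorem measurable_h1Energy : Measurable (h1Energy : PathSpace d T → ℝ≥0∞) :=
  lowerSemicontinuous_h1Energy.measurable

theorem measurable_h1Energy_drift : Measurable fun x : RedSpace d T => h1Energy (drift x) :=
  measurable_h1Energy.comp continuous_drift.measurable

theorem measurable_redThreshold : Measurable fun x : RedSpace d T => x.2.2 :=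
  measurable_snd.comp measurable_snd

theorem measurable_ctrlPath : Measurable (ctrlPath : Xi d T → PathSpace d T) := measurable_fst

theorem measurable_drivPath : Measurable (drivPath : Xi d T → PathSpace d T) :=
  measurable_fst.comp measurable_snd

theorem measurable_threshold : Measurable (threshold : Xi d T → ℝ≥0) :=
  measurable_snd.comp (measurable_snd.comp measurable_snd)

theorem measurable_forgetControl : Measurable (forgetControl : Xi d T → RedSpace d T) :=
  measurable_ctrlPath.prodMk (measurable_drivPath.prodMk measurable_threshold)

theorem indepFun_map_iff {Ω Ω' S S' : Type*} [MeasurableSpace Ω] [MeasurableSpace Ω']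
    [MeasurableSpace S] [MeasurableSpace S'] {P : Measure Ω} [IsFiniteMeasure P] {φ : Ω → Ω'}
    (hφ : Measurable φ) {f : Ω' → S} {g : Ω' → S'} (hf : Measurable f) (hg : Measurable g) :
    IndepFun f g (P.map φ) ↔ IndepFun (f ∘ φ) (g ∘ φ) P := by
  have : IsFiniteMeasure (P.map φ) := Measure.isFiniteMeasure_map _ _
  rw [indepFun_iff_map_prod_eq_prod_map_map hf.aemeasurable hg.aemeasurable,
    indepFun_iff_map_prod_eq_prod_map_map (hf.comp hφ).aemeasurable (hg.comp hφ).aemeasurable,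
    Measure.map_map (hf.prodMk hg) hφ, Measure.map_map hf hφ, Measure.map_map hg hφ]
  rfl

theorem Admissible.isWiener {P : Measure (RedSpace d T)} [IsFiniteMeasure P] (h : Admissible P) :
    IsWiener (P.map fun x => x.2.1) := by
  have hm : Measurable fun x : RedSpace d T => x.2.1 := measurable_fst.comp measurable_snd
  have hinc : ∀ s t : Time T, Measurable fun x : PathSpace d T => x t - x s := fun s t =>
    ((continuous_eval_path t).sub (continuous_eval_path s)).measurable
  refine ⟨fun t ht => ?_, fun s t hst => ?_, fun s t hst => ?_⟩
  · rw [ae_map_iff hm.aemeasurable]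
    · exact h.start t ht
    · exact (continuous_eval_path t).measurable (measurableSet_singleton 0)
  · rw [indepFun_map_iff hm (continuous_stopPath s).measurable (hinc s t)]
    exact (h.indep s t hst).comp (φ := fun x => x.2.1) (ψ := id) hm measurable_id
  · rw [Measure.map_map (hinc s t) hm]
    exact h.law s t hst

/-! ### From laws on the canonical space to reduced laws -/

theorem measurable_stopRed_forgetControl (s : Time T) :
    Measurable[canonicalFiltration s] fun ξ : Xi d T => stopRed s (forgetControl ξ) := by
  have hle : ∀ r : Time T, r ≤ s →
      MeasurableSpace.comap (fun ξ : Xi d T => ctrlPath ξ r) inferInstance ⊔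
      MeasurableSpace.comap (fun ξ : Xi d T => drivPath ξ r) inferInstance ⊔
      ⨆ (A : Set (E d)) (_ : MeasurableSet A),
        MeasurableSpace.comap (fun ξ : Xi d T => control ξ (A ×ˢ Iic r)) inferInstance
      ≤ canonicalFiltration s := fun r hr => by
    refine le_trans ?_ le_sup_left
    exact le_iSup₂_of_le r hr le_rfl
  have h1 : Measurable[canonicalFiltration s] fun ξ : Xi d T => stopPath s (ctrlPath ξ) := by
    refine @measurable_path d T (Xi d T) (canonicalFiltration s) _ fun t => ?_
    exact (comap_measurable (fun ξ : Xi d T => ctrlPath ξ (min t s))).mono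
      ((le_sup_left.trans le_sup_left).trans (hle _ (min_le_right t s))) le_rfl
  have h2 : Measurable[canonicalFiltration s] fun ξ : Xi d T => stopPath s (drivPath ξ) := by
    refine @measurable_path d T (Xi d T) (canonicalFiltration s) _ fun t => ?_
    exact (comap_measurable (fun ξ : Xi d T => drivPath ξ (min t s))).mono
      ((le_sup_right.trans le_sup_left).trans (hle _ (min_le_right t s))) le_rfl
  have h3 : Measurable[canonicalFiltration s] fun ξ : Xi d T => threshold ξ :=
    (comap_measurable (fun ξ : Xi d T => threshold ξ)).mono le_sup_right le_rfl
  exact h1.prodMk (h2.prodMk h3)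

theorem MemPInfty.admissible {Θ : ProbabilityMeasure (Xi d T)} (h : MemPInfty Θ) :
    Admissible ((Θ : Measure (Xi d T)).map forgetControl) := by
  refine ⟨fun t ht => ?_, fun s t hst => ?_, fun s t hst => ?_⟩
  · rw [ae_map_iff measurable_forgetControl.aemeasurable]
    · exact h.brownian.start t ht
    · exact ((continuous_eval_path t).comp (continuous_fst.comp continuous_snd)).measurable
        (measurableSet_singleton 0)
  · rw [indepFun_map_iff measurable_forgetControl (continuous_stopRed s).measurable
      (continuous_increment s t).measurable, IndepFun_iff_Indep]
    exact indep_of_indep_of_le_left (h.brownian.indep s t hst)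
      (measurable_stopRed_forgetControl s).comap_le
  · rw [Measure.map_map (continuous_increment s t).measurable measurable_forgetControl]
    exact h.brownian.law s t hst

/-- By the dynamics the drift is `∫ y ρ(dy ds)`, so Jensen applies pathwise; the entropy term does
not change. -/
theorem MemPInfty.redCost_le {Θ : ProbabilityMeasure (Xi d T)} (h : MemPInfty Θ) :
    redCost ((Θ : Measure (Xi d T)).map forgetControl) ≤ cost Θ := by
  unfold redCost cost
  refine add_le_add ?_ ?_
  · rw [lintegral_map (measurable_h1Energy_drift.const_mul _)
      measurable_forgetControl]
    refine lintegral_mono_ae ?_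
    filter_upwards [h.energy, h.dynamics] with ξ h1 h2
    refine mul_le_mul_right (h1Energy_le_of_relaxedControl ξ.2.2.1 h1 fun t => ?_) _
    change ctrlPath ξ t - drivPath ξ t = _
    rw [h2 t, add_sub_cancel_left]
    rfl
  · rw [Measure.map_map measurable_redThreshold measurable_forgetControl]
    exact le_rfl

/-! ### From reduced laws to laws on the canonical space -/

/-- Adjoining the relaxed control carried by the drift. -/
def addControl (x : RedSpace d T) : Xi d T := (x.1, x.2.1, pathControl (drift x), x.2.2)

theorem measurable_addControl : Measurable (addControl : RedSpace d T → Xi d T) :=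
  measurable_fst.prodMk ((measurable_fst.comp measurable_snd).prodMk
    ((measurable_pathControl.comp continuous_drift.measurable).prodMk
      (measurable_snd.comp measurable_snd)))

/-- The lift of a reduced law to the canonical space. -/
def liftLaw (P : ProbabilityMeasure (RedSpace d T)) : ProbabilityMeasure (Xi d T) :=
  P.map measurable_addControl.aemeasurable

theorem liftLaw_toMeasure (P : ProbabilityMeasure (RedSpace d T)) :
    (liftLaw P : Measure (Xi d T)) = (P : Measure (RedSpace d T)).map addControl := rfl

theorem liftLaw_map_forgetControl (P : ProbabilityMeasure (RedSpace d T)) :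
    (liftLaw P : Measure (Xi d T)).map forgetControl = P := by
  rw [liftLaw_toMeasure, Measure.map_map measurable_forgetControl measurable_addControl]
  exact Measure.map_id

instance (ξ : Xi d T) : IsFiniteMeasure (control ξ) := by
  unfold control RelaxedControl.toMeasure; infer_instance

/-- The identity holds at each point `addControl x`. Transport along the push-forward requires a
measurable event, so it is done for one Borel set at a time. -/
theorem ae_control_liftLaw (P : ProbabilityMeasure (RedSpace d T)) :
    ∀ᵐ ξ ∂(liftLaw P : Measure (Xi d T)),
      control ξ = (pathControl (drift (forgetControl ξ))).toMeasure := by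
  refine ae_eq_of_forall_measurableSet_ae_eq fun B hB => ?_
  rw [liftLaw_toMeasure, ae_map_iff measurable_addControl.aemeasurable]
  · exact Eventually.of_forall fun x => rfl
  · refine measurableSet_eq_fun ?_ ?_
    · exact (measurable_toMeasure_apply hB).comp
        (measurable_fst.comp (measurable_snd.comp measurable_snd))
    · exact (measurable_toMeasure_apply hB).comp (measurable_pathControl.comp
        (continuous_drift.measurable.comp measurable_forgetControl))

theorem ae_forgetControl_liftLaw {P : ProbabilityMeasure (RedSpace d T)} {p : RedSpace d T → Prop}
    (hp : MeasurableSet {x | p x}) (h : ∀ᵐ x ∂(P : Measure (RedSpace d T)), p x) :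
    ∀ᵐ ξ ∂(liftLaw P : Measure (Xi d T)), p (forgetControl ξ) := by
  rw [← liftLaw_map_forgetControl P, ae_map_iff measurable_forgetControl.aemeasurable hp] at h
  exact h

/-- Enlarging a `σ`-algebra by null modifications does not affect independence. -/
theorem indep_of_le_eventuallyMeasurableSpace {Ω : Type*} {m m' m₂ mΩ : MeasurableSpace Ω}
    {μ : Measure Ω} (hle : m ≤ eventuallyMeasurableSpace m' (ae μ)) (h : Indep m' m₂ μ) :
    Indep m m₂ μ := by
  rw [Indep_iff]
  intro A B hA hB
  obtain ⟨A', hA', hAA'⟩ := hle A hA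
  rw [measure_congr (hAA'.inter (EventuallyEq.refl _ B)), measure_congr hAA']
  exact (Indep_iff _ _ _).1 h A' B hA' hB

/-- The `σ`-algebra generated by the stopped paths and the threshold. -/
abbrev stoppedSigma (s : Time T) : MeasurableSpace (Xi d T) :=
  MeasurableSpace.comap (fun ξ : Xi d T => stopRed s (forgetControl ξ)) inferInstance

/-- Under the lifted law `ρ(A × [0,r])` is a function of the drift stopped at `r`. This holds only
almost surely, hence the completion on the right-hand side. -/
theorem canonicalFiltration_le_liftLaw {P : ProbabilityMeasure (RedSpace d T)}
    (hE : ∀ᵐ ξ ∂(liftLaw P : Measure (Xi d T)), h1Energy (drift (forgetControl ξ)) < ∞)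
    (s : Time T) :
    canonicalFiltration s
      ≤ eventuallyMeasurableSpace (stoppedSigma s) (ae (liftLaw P : Measure (Xi d T))) := by
  have hstopped : Measurable[stoppedSigma s] fun ξ : Xi d T => stopRed s (forgetControl ξ) :=
    comap_measurable _
  refine sup_le (iSup₂_le fun r hr => sup_le (sup_le ?_ ?_) (iSup₂_le fun A hA => ?_)) ?_
  · rw [← measurable_iff_comap_le]
    have h1 : Measurable[stoppedSigma s] fun ξ : Xi d T => ctrlPath ξ r := by
      have := (((continuous_eval_path r).comp continuous_fst).measurable).comp hstopped
      simpa [Function.comp_def, stopRed, stopPath_apply, min_eq_left hr] using! this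
    exact h1.eventuallyMeasurable
  · rw [← measurable_iff_comap_le]
    have h1 : Measurable[stoppedSigma s] fun ξ : Xi d T => drivPath ξ r := by
      have := (((continuous_eval_path r).comp
        (continuous_fst.comp continuous_snd)).measurable).comp hstopped
      simpa [Function.comp_def, stopRed, stopPath_apply, min_eq_left hr] using! this
    exact h1.eventuallyMeasurable
  · rw [← measurable_iff_comap_le]
    have hg : Measurable fun x : RedSpace d T =>
        (pathControl (stopPath r (drift x))).toMeasure (A ×ˢ Iic r) :=
      (measurable_toMeasure_apply (hA.prod measurableSet_Iic)).comp
        (measurable_pathControl.comp ((continuous_stopPath r).comp continuous_drift).measurable)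
    refine (hg.comp hstopped).eventuallyMeasurable_of_eventuallyEq ?_
    filter_upwards [ae_control_liftLaw P, hE] with ξ h1 h2
    rw [h1, ← pathControl_stopPath h2 r hA, ← stopPath_stopPath hr]
    rfl
  · rw [← measurable_iff_comap_le]
    exact (measurable_redThreshold.comp hstopped).eventuallyMeasurable

theorem indep_canonicalFiltration_liftLaw {P : ProbabilityMeasure (RedSpace d T)}
    (hP : Admissible (P : Measure (RedSpace d T)))
    (hE : ∀ᵐ ξ ∂(liftLaw P : Measure (Xi d T)), h1Energy (drift (forgetControl ξ)) < ∞)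
    {s t : Time T} (hst : s ≤ t) :
    Indep (canonicalFiltration s)
      (MeasurableSpace.comap (fun ξ : Xi d T => drivPath ξ t - drivPath ξ s) inferInstance)
      (liftLaw P : Measure (Xi d T)) := by
  refine indep_of_le_eventuallyMeasurableSpace (canonicalFiltration_le_liftLaw hE s) ?_
  have := hP.indep s t hst
  rw [← liftLaw_map_forgetControl P, indepFun_map_iff measurable_forgetControl
    (continuous_stopRed s).measurable (continuous_increment s t).measurable,
    IndepFun_iff_Indep] at this
  exact this

theorem measurable_drivPath_canonicalFiltration (t : Time T) :
    Measurable[canonicalFiltration t] fun ξ : Xi d T => drivPath ξ t := by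
  rw [measurable_iff_comap_le]
  refine le_trans ?_ le_sup_left
  refine le_iSup₂_of_le t le_rfl ?_
  refine le_trans ?_ le_sup_left
  exact le_sup_right

theorem Admissible.start_liftLaw {P : ProbabilityMeasure (RedSpace d T)}
    (hP : Admissible (P : Measure (RedSpace d T))) (t : Time T) (ht : (t : ℝ) = 0) :
    ∀ᵐ ξ ∂(liftLaw P : Measure (Xi d T)), drivPath ξ t = 0 := by
  have hm : MeasurableSet {x : RedSpace d T | x.2.1 t = 0} :=
    ((continuous_eval_path t).comp (continuous_fst.comp continuous_snd)).measurable
      (measurableSet_singleton 0)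
  have h0 := hP.start t ht
  rw [← liftLaw_map_forgetControl P, ae_map_iff measurable_forgetControl.aemeasurable hm] at h0
  exact h0

theorem Admissible.law_liftLaw {P : ProbabilityMeasure (RedSpace d T)}
    (hP : Admissible (P : Measure (RedSpace d T))) {s t : Time T} (hst : s ≤ t) :
    (liftLaw P : Measure (Xi d T)).map (fun ξ => drivPath ξ t - drivPath ξ s) =
      (stdGaussian (E d)).map (fun z => Real.sqrt ((t : ℝ) - s) • z) := by
  have h0 := hP.law s t hst
  rw [← h0]
  conv_rhs => rw [← liftLaw_map_forgetControl P]
  rw [Measure.map_map (continuous_increment s t).measurable measurable_forgetControl]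
  rfl

theorem Admissible.isStandardBrownianMotion_liftLaw {P : ProbabilityMeasure (RedSpace d T)}
    (hP : Admissible (P : Measure (RedSpace d T)))
    (hE : ∀ᵐ ξ ∂(liftLaw P : Measure (Xi d T)), h1Energy (drift (forgetControl ξ)) < ∞) :
    IsStandardBrownianMotion (liftLaw P : Measure (Xi d T)) canonicalFiltration
      (fun t ξ => drivPath ξ t) :=
  ⟨measurable_drivPath_canonicalFiltration, hP.start_liftLaw,
    Eventually.of_forall fun ξ => (drivPath ξ).continuous,
    fun _ _ hst => indep_canonicalFiltration_liftLaw hP hE hst, fun _ _ hst => hP.law_liftLaw hst⟩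

theorem Admissible.memPInfty_liftLaw {P : ProbabilityMeasure (RedSpace d T)}
    (hP : Admissible (P : Measure (RedSpace d T)))
    (hE : ∀ᵐ x ∂(P : Measure (RedSpace d T)), h1Energy (drift x) < ∞)
    (hac : (P : Measure (RedSpace d T)).map (fun x => x.2.2) ≪ theta) :
    MemPInfty (liftLaw P) := by
  have hE' : ∀ᵐ ξ ∂(liftLaw P : Measure (Xi d T)), h1Energy (drift (forgetControl ξ)) < ∞ :=
    ae_forgetControl_liftLaw
      (measurableSet_lt measurable_h1Energy_drift measurable_const) hE
  refine ⟨?_, hP.isStandardBrownianMotion_liftLaw hE', ?_, ?_⟩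
  · rw [← liftLaw_map_forgetControl P, Measure.map_map measurable_redThreshold
      measurable_forgetControl] at hac
    exact hac
  · filter_upwards [ae_control_liftLaw P, hE'] with ξ h1 h2
    obtain ⟨u, hu⟩ := exists_primitive_of_h1Energy_lt_top h2
    rw [h1, ← hu, pathControl_primitive, energy_ofVelocity]
    finiteness
  · filter_upwards [ae_control_liftLaw P, hE'] with ξ h1 h2 t
    obtain ⟨u, hu⟩ := exists_primitive_of_h1Energy_lt_top h2
    rw [h1, ← hu, pathControl_primitive, setIntegral_ofVelocity, hu]
    change _ = drivPath ξ t + (ctrlPath ξ t - drivPath ξ t)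
    abel

/-- The lifted control is concentrated on the velocity of the drift, so Jensen's inequality becomes
an equality. -/
theorem cost_liftLaw {P : ProbabilityMeasure (RedSpace d T)}
    (hE : ∀ᵐ x ∂(P : Measure (RedSpace d T)), h1Energy (drift x) < ∞) :
    cost (liftLaw P) = redCost (P : Measure (RedSpace d T)) := by
  have hE' : ∀ᵐ ξ ∂(liftLaw P : Measure (Xi d T)), h1Energy (drift (forgetControl ξ)) < ∞ :=
    ae_forgetControl_liftLaw
      (measurableSet_lt measurable_h1Energy_drift measurable_const) hE
  unfold cost redCost
  congr 1
  · conv_rhs => rw [← liftLaw_map_forgetControl P]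
    rw [lintegral_map (measurable_h1Energy_drift.const_mul _)
      measurable_forgetControl]
    refine lintegral_congr_ae ?_
    filter_upwards [ae_control_liftLaw P, hE'] with ξ h1 h2
    obtain ⟨u, hu⟩ := exists_primitive_of_h1Energy_lt_top h2
    rw [h1, ← hu, pathControl_primitive, energy_ofVelocity, h1Energy_primitive]
  · conv_rhs => rw [← liftLaw_map_forgetControl P]
    rw [Measure.map_map measurable_redThreshold measurable_forgetControl]
    rfl

end

section

variable {d : ℕ} {T : ℝ}

/-! ### Compactness of the admissible laws of bounded cost -/

theorem exists_isCompact_measure_compl_le_of_klDiv_le {S : Type*} [MeasurableSpace S]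
    [TopologicalSpace S] [TopologicalSpace.IsCompletelyPseudoMetrizableSpace S]
    [SecondCountableTopology S] [BorelSpace S] [T2Space S] (θ : Measure S) [IsFiniteMeasure θ]
    (c : ℝ≥0) {ε : ℝ≥0∞} (hε : 0 < ε) :
    ∃ K : Set S, IsCompact K ∧ ∀ ν : Measure S, IsFiniteMeasure ν →
      InformationTheory.klDiv ν θ ≤ c → ν Kᶜ ≤ ε := by
  obtain ⟨η, hη, hηε⟩ : ∃ η : ℝ, 0 < η ∧ ENNReal.ofReal η ≤ ε := by
    obtain ⟨η, h0, h1⟩ := ENNReal.lt_iff_exists_nnreal_btwn.1 hε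
    exact ⟨η, by exact_mod_cast h0, by simpa using h1.le⟩
  -- With `θ(Kᶜ) ≤ e^{-a}` the entropy inequality gives `ν(Kᶜ) ≤ (c + 1)/a = η`.
  set a : ℝ := (c + 1) / η with ha
  have ha0 : 0 < a := by positivity
  have ht : IsTightMeasureSet {θ} := isTightMeasureSet_singleton
  obtain ⟨K, hK, hKθ⟩ := isTightMeasureSet_iff_exists_isCompact_measure_compl_le.1 ht
    (ENNReal.ofReal (Real.exp (-a))) (ENNReal.ofReal_pos.2 (Real.exp_pos _))
  refine ⟨K, hK, fun ν hν hkl => ?_⟩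
  have h1 := measureReal_le_of_klDiv_le hkl hK.measurableSet.compl ha0
  have h2 : θ.real Kᶜ ≤ Real.exp (-a) :=
    ENNReal.toReal_le_of_le_ofReal (Real.exp_pos _).le (hKθ θ rfl)
  have h3 : ν.real Kᶜ ≤ η := by
    refine h1.trans ?_
    rw [div_le_iff₀ ha0]
    have h4 : Real.exp a * θ.real Kᶜ ≤ 1 := by
      calc Real.exp a * θ.real Kᶜ ≤ Real.exp a * Real.exp (-a) := by gcongr
        _ = 1 := by rw [← Real.exp_add]; simp
    have h5 : η * a = c + 1 := by rw [ha]; field_simp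
    linarith
  refine le_trans ?_ hηε
  rw [← ENNReal.ofReal_toReal (measure_ne_top ν Kᶜ)]
  exact ENNReal.ofReal_le_ofReal h3

/-- Markov's inequality: the mean energy is at most `2c`, and the sets of bounded energy are
compact. -/
theorem exists_isCompact_h1Energy_drift_compl_le (c : ℝ≥0) {ε : ℝ≥0∞} (hε : 0 < ε) :
    ∃ K : Set (PathSpace d T), IsCompact K ∧ ∀ P : Measure (RedSpace d T),
      redCost P ≤ c → P (drift ⁻¹' Kᶜ) ≤ ε := by
  obtain ⟨η, h0, h1⟩ := ENNReal.lt_iff_exists_nnreal_btwn.1 hε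
  have hη : 0 < η := by exact_mod_cast h0
  obtain ⟨R, hR, hRη⟩ : ∃ R : ℝ≥0, R ≠ 0 ∧ 2 * c / R ^ 2 ≤ η := by
    -- This works because `(1 + y)² ≥ y` for `y = 2c/η`.
    refine ⟨1 + 2 * c / η, by positivity, ?_⟩
    rw [div_le_iff₀ (by positivity)]
    have h2 : 2 * c / η * η = 2 * c := by field_simp
    calc 2 * c ≤ 2 * c / η * η := h2.ge
      _ ≤ (1 + 2 * c / η) ^ 2 * η := by
          gcongr
          have : (0 : ℝ≥0) ≤ 2 * c / η := zero_le
          nlinarith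
      _ = _ := mul_comm _ _
  refine ⟨_, isCompact_h1Energy_le R, fun P hP => ?_⟩
  have hint : ∫⁻ x, h1Energy (drift x) ∂P ≤ 2 * c := by
    have h3 : ∫⁻ x, (1 / 2) * h1Energy (drift x) ∂P ≤ c := le_self_add.trans hP
    rw [lintegral_const_mul _ measurable_h1Energy_drift, one_div] at h3
    calc ∫⁻ x, h1Energy (drift x) ∂P = 2 * (2⁻¹ * ∫⁻ x, h1Energy (drift x) ∂P) := by
          rw [← mul_assoc, ENNReal.mul_inv_cancel (by norm_num) (by norm_num), one_mul]
      _ ≤ 2 * c := by gcongr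
  have hR2 : ((R : ℝ≥0∞) ^ 2) ≠ 0 := by simpa using hR
  calc P (drift ⁻¹' {x | h1Energy x ≤ (R : ℝ≥0∞) ^ 2}ᶜ)
      ≤ P {x | (R : ℝ≥0∞) ^ 2 ≤ h1Energy (drift x)} := measure_mono fun x hx => by
        exact (not_le.1 (show ¬ h1Energy (drift x) ≤ (R : ℝ≥0∞) ^ 2 from hx)).le
    _ ≤ (∫⁻ x, h1Energy (drift x) ∂P) / (R : ℝ≥0∞) ^ 2 :=
        meas_ge_le_lintegral_div measurable_h1Energy_drift.aemeasurable hR2 (by simp)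
    _ ≤ 2 * c / (R : ℝ≥0∞) ^ 2 := by gcongr
    _ = ((2 * c / R ^ 2 : ℝ≥0) : ℝ≥0∞) := by
        rw [ENNReal.coe_div (by positivity)]; push_cast; rfl
    _ ≤ ε := le_trans (by exact_mod_cast hRη) h1.le

/-- The admissible laws of cost at most `c`. -/
def boundedLaws (d : ℕ) (T : ℝ) (c : ℝ≥0) : Set (ProbabilityMeasure (RedSpace d T)) :=
  {P | Admissible (P : Measure (RedSpace d T)) ∧ redCost (P : Measure (RedSpace d T)) ≤ c}

/-- The triple is a continuous image of `(b̃ - b, b, σ̃)`, whose components are tight by the energy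
bound, by the common law of `b`, and by the entropy bound. -/
theorem isTightMeasureSet_boundedLaws (c : ℝ≥0) :
    IsTightMeasureSet {x : Measure (RedSpace d T) | ∃ P ∈ boundedLaws d T c, ↑P = x} := by
  -- Any member `P₀` supplies the Wiener law, by uniqueness, so the existence of Wiener measure is
  -- not needed.
  rcases (boundedLaws d T c).eq_empty_or_nonempty with he | ⟨P₀, hP₀⟩
  · rw [he]
    rw [isTightMeasureSet_iff_exists_isCompact_measure_compl_le]
    exact fun ε _ => ⟨∅, isCompact_empty, by simp⟩
  rw [isTightMeasureSet_iff_exists_isCompact_measure_compl_le]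
  intro ε hε
  have hε3 : 0 < ε / 3 := ENNReal.div_pos hε.ne' (by norm_num)
  have hmb : Measurable fun x : RedSpace d T => x.2.1 := measurable_fst.comp measurable_snd
  have : IsProbabilityMeasure ((P₀ : Measure (RedSpace d T)).map fun x => x.2.1) :=
    Measure.isProbabilityMeasure_map hmb.aemeasurable
  obtain ⟨K₁, hK₁, h₁⟩ := exists_isCompact_h1Energy_drift_compl_le (d := d) (T := T) c hε3
  obtain ⟨K₂, hK₂, h₂⟩ := isTightMeasureSet_iff_exists_isCompact_measure_compl_le.1
    (isTightMeasureSet_singleton (μ := (P₀ : Measure (RedSpace d T)).map fun x => x.2.1)) _ hε3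
  obtain ⟨K₃, hK₃, h₃⟩ := exists_isCompact_measure_compl_le_of_klDiv_le theta c hε3
  have hcont : Continuous fun q : PathSpace d T × PathSpace d T × ℝ≥0 =>
      ((q.1 + q.2.1, q.2.1, q.2.2) : RedSpace d T) := by fun_prop
  refine ⟨_, (hK₁.prod (hK₂.prod hK₃)).image hcont, ?_⟩
  rintro _ ⟨P, hP, rfl⟩
  have : IsProbabilityMeasure ((P : Measure (RedSpace d T)).map fun x => x.2.1) :=
    Measure.isProbabilityMeasure_map hmb.aemeasurable
  have hsub : ((fun q : PathSpace d T × PathSpace d T × ℝ≥0 =>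
      ((q.1 + q.2.1, q.2.1, q.2.2) : RedSpace d T)) '' (K₁ ×ˢ K₂ ×ˢ K₃))ᶜ
      ⊆ (drift ⁻¹' K₁ᶜ ∪ (fun x => x.2.1) ⁻¹' K₂ᶜ) ∪ (fun x => x.2.2) ⁻¹' K₃ᶜ := by
    intro x hx
    by_contra hcon
    simp only [mem_union, mem_preimage, mem_compl_iff, not_or, not_not] at hcon
    exact hx ⟨(drift x, x.2.1, x.2.2), ⟨hcon.1.1, hcon.1.2, hcon.2⟩, by simp [drift]⟩
  have e2 : (P : Measure (RedSpace d T)) ((fun x => x.2.1) ⁻¹' K₂ᶜ) ≤ ε / 3 := by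
    rw [← Measure.map_apply hmb hK₂.measurableSet.compl, hP.1.isWiener.unique hP₀.1.isWiener]
    exact h₂ _ rfl
  have e3 : (P : Measure (RedSpace d T)) ((fun x => x.2.2) ⁻¹' K₃ᶜ) ≤ ε / 3 := by
    rw [← Measure.map_apply measurable_redThreshold hK₃.measurableSet.compl]
    exact h₃ _ (Measure.isFiniteMeasure_map _ _) (le_add_self.trans hP.2)
  calc _ ≤ _ := measure_mono hsub
    _ ≤ _ := (measure_union_le _ _).trans (add_le_add (measure_union_le _ _) le_rfl)
    _ ≤ ε / 3 + ε / 3 + ε / 3 := by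
        gcongr
        exact h₁ _ hP.2
    _ = ε := ENNReal.add_thirds ε

/-- Each condition is an equality between weakly continuous functions of the law: `b_0` has law
`δ_0`, increments have a fixed law, and a joint law is the product of its marginals. -/
theorem isClosed_admissible :
    IsClosed {P : ProbabilityMeasure (RedSpace d T) | Admissible (P : Measure (RedSpace d T))} := by
  have hev : ∀ t : Time T, Continuous fun x : RedSpace d T => x.2.1 t := fun t =>
    (continuous_eval_path t).comp (continuous_fst.comp continuous_snd)
  have h1 : IsClosed {P : ProbabilityMeasure (RedSpace d T) | ∀ t : Time T, (t : ℝ) = 0 →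
      P.map (hev t).measurable.aemeasurable =
        ⟨Measure.dirac (0 : E d), Measure.dirac.isProbabilityMeasure⟩} := by
    simp only [ofPred_forall]
    exact isClosed_iInter fun t => isClosed_iInter fun _ =>
      isClosed_eq (ProbabilityMeasure.continuous_map (hev t)) continuous_const
  have hsc : ∀ s t : Time T,
      IsProbabilityMeasure ((stdGaussian (E d)).map (fun z => Real.sqrt ((t : ℝ) - s) • z)) :=
    fun s t => Measure.isProbabilityMeasure_map (by fun_prop)
  have h2 : IsClosed {P : ProbabilityMeasure (RedSpace d T) | ∀ s t : Time T, s ≤ t →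
      P.map (continuous_increment s t).measurable.aemeasurable = ⟨_, hsc s t⟩} := by
    simp only [ofPred_forall]
    exact isClosed_iInter fun s => isClosed_iInter fun t => isClosed_iInter fun _ =>
      isClosed_eq (ProbabilityMeasure.continuous_map (continuous_increment s t)) continuous_const
  have h3 : IsClosed {P : ProbabilityMeasure (RedSpace d T) | ∀ s t : Time T, s ≤ t →
      P.map ((continuous_stopRed s).prodMk (continuous_increment s t)).measurable.aemeasurable =
      (P.map (continuous_stopRed s).measurable.aemeasurable).prod
        (P.map (continuous_increment s t).measurable.aemeasurable)} := by
    simp only [ofPred_forall]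
    exact isClosed_iInter fun s => isClosed_iInter fun t => isClosed_iInter fun _ =>
      isClosed_eq (ProbabilityMeasure.continuous_map
        ((continuous_stopRed s).prodMk (continuous_increment s t)))
        (ProbabilityMeasure.continuous_prod.comp
          ((ProbabilityMeasure.continuous_map (continuous_stopRed s)).prodMk
            (ProbabilityMeasure.continuous_map (continuous_increment s t))))
  convert (h1.inter h2).inter h3 using 1
  ext P
  constructor
  · intro h
    refine ⟨⟨fun t ht => Subtype.ext ?_, fun s t hst => Subtype.ext (h.law s t hst)⟩,
      fun s t hst => Subtype.ext ?_⟩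
    · change (P : Measure (RedSpace d T)).map _ = Measure.dirac 0
      rw [Measure.map_congr (h.start t ht), Measure.map_const]
      simp
    · exact (indepFun_iff_map_prod_eq_prod_map_map
        (continuous_stopRed s).measurable.aemeasurable
        (continuous_increment s t).measurable.aemeasurable).1 (h.indep s t hst)
  · rintro ⟨⟨a1, a2⟩, a3⟩
    refine ⟨fun t ht => ?_, fun s t hst => ?_, fun s t hst => ?_⟩
    · have h4 : (P : Measure (RedSpace d T)).map (fun x => x.2.1 t) = Measure.dirac 0 :=
        congrArg Subtype.val (a1 t ht)
      have h5 : ∀ᵐ y ∂((P : Measure (RedSpace d T)).map fun x => x.2.1 t), y = 0 := by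
        rw [h4]
        exact (ae_dirac_iff (measurableSet_singleton (0 : E d))).2 rfl
      exact ae_of_ae_map (hev t).measurable.aemeasurable h5
    · exact (indepFun_iff_map_prod_eq_prod_map_map
        (continuous_stopRed s).measurable.aemeasurable
        (continuous_increment s t).measurable.aemeasurable).2 (congrArg Subtype.val (a3 s t hst))
    · exact congrArg Subtype.val (a2 s t hst)

theorem lowerSemicontinuous_redCost :
    LowerSemicontinuous fun P : ProbabilityMeasure (RedSpace d T) =>
      redCost (P : Measure (RedSpace d T)) := by
  have h1 : LowerSemicontinuous fun x : RedSpace d T => (1 / 2) * h1Energy (drift x) := by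
    have h2 : LowerSemicontinuous (h1Energy ∘ drift : RedSpace d T → ℝ≥0∞) :=
      LowerSemicontinuous.comp (f := h1Energy) (g := drift) lowerSemicontinuous_h1Energy continuous_drift
    have h3 : Monotone fun a : ℝ≥0∞ => (1 / 2) * a := fun a b h => by dsimp only; gcongr
    have h4 : Continuous fun a : ℝ≥0∞ => (1 / 2) * a :=
      ENNReal.continuous_const_mul (by norm_num)
    exact h4.comp_lowerSemicontinuous h2 h3
  have h5 : Continuous fun x : RedSpace d T => x.2.2 := continuous_snd.comp continuous_snd
  exact (lowerSemicontinuous_lintegral h1).add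
    (LowerSemicontinuous.comp (lowerSemicontinuous_klDiv theta)
      (ProbabilityMeasure.continuous_map h5))

/-- Prokhorov's theorem for a tight closed set. -/
theorem isCompact_boundedLaws (c : ℝ≥0) : IsCompact (boundedLaws d T c) := by
  have hcl : IsClosed (boundedLaws d T c) :=
    isClosed_admissible.inter (lowerSemicontinuous_redCost.isClosed_preimage _)
  have := isCompact_closure_of_isTightMeasureSet (isTightMeasureSet_boundedLaws (d := d) (T := T) c)
  rwa [hcl.closure_eq] at this

theorem ae_h1Energy_drift_lt_top {P : Measure (RedSpace d T)} (h : redCost P < ∞) :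
    ∀ᵐ x ∂P, h1Energy (drift x) < ∞ := by
  have h1 : ∫⁻ x, (1 / 2) * h1Energy (drift x) ∂P ≠ ∞ := (le_self_add.trans_lt h).ne
  filter_upwards [ae_lt_top (measurable_h1Energy_drift.const_mul _) h1] with x hx
  by_contra hcon
  rw [not_lt, top_le_iff] at hcon
  simp [hcon] at hx

theorem map_threshold_absolutelyContinuous {P : Measure (RedSpace d T)} (h : redCost P < ∞) :
    P.map (fun x => x.2.2) ≪ theta :=
  (InformationTheory.klDiv_ne_top_iff.1 (le_add_self.trans_lt h).ne).1

end

section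

variable {d : ℕ} {T : ℝ}

/-! ### Killed laws -/

theorem continuous_ctrl_apply (t : Time T) : Continuous fun x : RedSpace d T => x.1 t :=
  (continuous_eval_path t).comp continuous_fst

theorem measurable_ctrl_apply (t : Time T) : Measurable fun x : RedSpace d T => x.1 t :=
  (continuous_ctrl_apply t).measurable

/-- The law of the controlled path at time `t` restricted to an event. -/
def killedLaw (P : Measure (RedSpace d T)) [IsProbabilityMeasure P] (A : Set (RedSpace d T))
    (t : Time T) : SubProb (E d) :=
  ⟨(P.restrict A).map fun x => x.1 t, by
    rw [Measure.map_apply (measurable_ctrl_apply t) MeasurableSet.univ, preimage_univ]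
    exact (Measure.restrict_apply_le A univ).trans prob_le_one⟩

theorem integral_killedLaw (P : Measure (RedSpace d T)) [IsProbabilityMeasure P]
    {A : Set (RedSpace d T)} (hA : MeasurableSet A) (t : Time T) {f : E d → ℝ}
    (hf : Continuous f) :
    ∫ y, f y ∂(killedLaw P A t).toMeasure = ∫ x, A.indicator (fun x => f (x.1 t)) x ∂P := by
  rw [integral_indicator hA]
  exact integral_map (measurable_ctrl_apply t).aemeasurable hf.aestronglyMeasurable

theorem lintegral_killedLaw (P : Measure (RedSpace d T)) [IsProbabilityMeasure P]
    {A : Set (RedSpace d T)} (hA : MeasurableSet A) (t : Time T) {f : E d → ℝ≥0∞}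
    (hf : Measurable f) :
    ∫⁻ y, f y ∂(killedLaw P A t).toMeasure = ∫⁻ x, A.indicator (fun x => f (x.1 t)) x ∂P := by
  rw [lintegral_indicator hA]
  exact lintegral_map hf (measurable_ctrl_apply t)

theorem SubProb.ext_of_integral {μ ν : SubProb (E d)}
    (h : ∀ f : E d →ᵇ ℝ, ∫ x, f x ∂μ.toMeasure = ∫ x, f x ∂ν.toMeasure) : μ = ν := by
  have := ext_of_forall_integral_eq_of_IsFiniteMeasure h
  cases μ; cases ν; simpa using this

theorem measurableSet_lt_threshold (c : ℝ≥0∞) :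
    MeasurableSet {x : RedSpace d T | c < (x.2.2 : ℝ≥0∞)} :=
  measurableSet_lt measurable_const measurable_redThreshold.coe_nnreal_ennreal

/-- The equation sees only `b̃` and `σ̃`, hence only the reduced law; bounded continuous functions
separate finite measures. -/
theorem isKilledSolution_iff {ζ : E d → ℝ≥0} {Θ : ProbabilityMeasure (Xi d T)}
    {P : ProbabilityMeasure (RedSpace d T)}
    (hP : (Θ : Measure (Xi d T)).map forgetControl = P) {ϖ : Time T → SubProb (E d)} :
    IsKilledSolution ζ Θ ϖ ↔ ∀ t, ϖ t =
      killedLaw (P : Measure (RedSpace d T)) {x | killing ζ ϖ t < (x.2.2 : ℝ≥0∞)} t := by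
  have key : ∀ (f : E d →ᵇ ℝ) (t : Time T),
      ∫ ξ, {ξ : Xi d T | killing ζ ϖ t < (threshold ξ : ℝ≥0∞)}.indicator
        (fun ξ => f (ctrlPath ξ t)) ξ ∂(Θ : Measure (Xi d T)) =
      ∫ y, f y ∂(killedLaw (P : Measure (RedSpace d T))
        {x | killing ζ ϖ t < (x.2.2 : ℝ≥0∞)} t).toMeasure := by
    intro f t
    have hA := measurableSet_lt_threshold (d := d) (T := T) (killing ζ ϖ t)
    rw [integral_killedLaw _ hA t f.continuous, ← hP, integral_map
      measurable_forgetControl.aemeasurable]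
    · rfl
    · exact (((f.continuous.measurable.comp (measurable_ctrl_apply t)).indicator hA)
        |>.aestronglyMeasurable)
  unfold IsKilledSolution
  simp only [key]
  exact ⟨fun h t => SubProb.ext_of_integral fun f => h f t, fun h f t => by rw [← h t]⟩

/-! ### Thresholds near a given level -/

theorem exists_threshold_near_le (c : ℝ≥0) {η : ℝ} (hη : 0 < η) :
    ∃ δ : ℝ, 0 < δ ∧ ∀ P : Measure (RedSpace d T), IsProbabilityMeasure P → redCost P ≤ c →
      ∀ κ : ℝ, P.real {x | |(x.2.2 : ℝ) - κ| ≤ δ} ≤ η := by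
  set a : ℝ := (c + 1) / η with ha
  have ha0 : 0 < a := by positivity
  -- An interval of length `2δ = e^{-a}` has `θ`-mass at most `e^{-a}`, whatever its centre `κ`.
  refine ⟨Real.exp (-a) / 2, by positivity, fun P hP hcost κ => ?_⟩
  have hA : MeasurableSet {σ : ℝ≥0 | |(σ : ℝ) - κ| ≤ Real.exp (-a) / 2} :=
    measurableSet_le (by fun_prop) measurable_const
  have : IsProbabilityMeasure (P.map fun x => x.2.2) :=
    Measure.isProbabilityMeasure_map measurable_redThreshold.aemeasurable
  have h1 := measureReal_le_of_klDiv_le (le_add_self.trans hcost) hA ha0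
  rw [map_measureReal_apply measurable_redThreshold hA] at h1
  have h2 : theta.real {σ : ℝ≥0 | |(σ : ℝ) - κ| ≤ Real.exp (-a) / 2} ≤ Real.exp (-a) := by
    refine ENNReal.toReal_le_of_le_ofReal (Real.exp_pos _).le ((theta_near_le κ _).trans_eq ?_)
    congr 1; ring
  refine h1.trans ?_
  rw [div_le_iff₀ ha0]
  have h4 : Real.exp a * theta.real {σ : ℝ≥0 | |(σ : ℝ) - κ| ≤ Real.exp (-a) / 2} ≤ 1 := by
    calc _ ≤ Real.exp a * Real.exp (-a) := by gcongr
      _ = 1 := by rw [← Real.exp_add]; simp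
  have h5 : η * a = c + 1 := by rw [ha]; field_simp
  linarith

/-- A Lipschitz approximation of the indicator of the positive half-line. -/
def ramp (δ u : ℝ) : ℝ := max 0 (min 1 (u / δ))

theorem ramp_nonneg (δ u : ℝ) : 0 ≤ ramp δ u := le_max_left _ _

theorem ramp_le_one (δ u : ℝ) : ramp δ u ≤ 1 := max_le zero_le_one (min_le_left _ _)

theorem continuous_ramp (δ : ℝ) : Continuous (ramp δ) := by unfold ramp; fun_prop

theorem ramp_of_le {δ u : ℝ} (hδ : 0 < δ) (h : δ ≤ u) : ramp δ u = 1 := by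
  have : 1 ≤ u / δ := (one_le_div hδ).2 h
  simp [ramp, this]

theorem ramp_of_nonpos {δ u : ℝ} (hδ : 0 < δ) (h : u ≤ 0) : ramp δ u = 0 := by
  have : u / δ ≤ 0 := div_nonpos_of_nonpos_of_nonneg h hδ.le
  simp [ramp, this]

theorem abs_ramp_sub_le {δ : ℝ} (hδ : 0 < δ) (u v : ℝ) :
    |ramp δ u - ramp δ v| ≤ δ⁻¹ * |u - v| := by
  unfold ramp
  calc _ ≤ |min 1 (u / δ) - min 1 (v / δ)| := by
        rw [max_comm 0, max_comm 0]; exact abs_max_sub_max_le_abs _ _ _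
    _ ≤ |u / δ - v / δ| := by
        rw [min_comm 1, min_comm 1]
        have := abs_min_sub_min_le_max (u / δ) 1 (v / δ) 1
        simpa using this
    _ = δ⁻¹ * |u - v| := by
        rw [← sub_div, abs_div, abs_of_pos hδ, div_eq_inv_mul]

theorem measurableSet_lt_threshold_real (κ : ℝ) :
    MeasurableSet {x : RedSpace d T | κ < (x.2.2 : ℝ)} :=
  measurableSet_lt measurable_const measurable_redThreshold.coe_nnreal_real

theorem continuous_ramp_threshold (δ κ : ℝ) :
    Continuous fun x : RedSpace d T => ramp δ ((x.2.2 : ℝ) - κ) :=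
  (continuous_ramp δ).comp ((NNReal.continuous_coe.comp
    (continuous_snd.comp continuous_snd)).sub continuous_const)

/-- Where `|σ̃ - κ| > δ`, the indicator with the perturbed level `κ'` and the ramp agree: both are
`1` above `κ + δ` and `0` below `κ - δ`. -/
theorem abs_integral_indicator_sub_ramp_le (P : Measure (RedSpace d T)) [IsProbabilityMeasure P]
    {κ κ' δ A : ℝ} (hδ : 0 < δ) (hκ : |κ' - κ| ≤ δ) {φ : RedSpace d T → ℝ} (hφ : Measurable φ)
    (hA : ∀ x, |φ x| ≤ A) :
    |∫ x, {x : RedSpace d T | κ' < (x.2.2 : ℝ)}.indicator φ x ∂P -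
        ∫ x, ramp δ ((x.2.2 : ℝ) - κ) * φ x ∂P|
      ≤ A * P.real {x | |(x.2.2 : ℝ) - κ| ≤ δ} := by
  have hA0 : 0 ≤ A := by
    obtain ⟨x⟩ : Nonempty (RedSpace d T) := nonempty_of_isProbabilityMeasure P
    exact (abs_nonneg _).trans (hA x)
  have hB : MeasurableSet {x : RedSpace d T | |(x.2.2 : ℝ) - κ| ≤ δ} :=
    measurableSet_le ((measurable_redThreshold.coe_nnreal_real.sub_const κ).abs) measurable_const
  have hr : Measurable fun x : RedSpace d T => ramp δ ((x.2.2 : ℝ) - κ) :=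
    (continuous_ramp_threshold δ κ).measurable
  have hi1 : Integrable ({x : RedSpace d T | κ' < (x.2.2 : ℝ)}.indicator φ) P := by
    refine Integrable.of_bound
      (hφ.indicator (measurableSet_lt_threshold_real κ')).aestronglyMeasurable A
      (Eventually.of_forall fun x => ?_)
    exact (norm_indicator_le_norm_self φ x).trans (hA x)
  have hi2 : Integrable (fun x : RedSpace d T => ramp δ ((x.2.2 : ℝ) - κ) * φ x) P := by
    refine Integrable.of_bound (hr.mul hφ).aestronglyMeasurable A
      (Eventually.of_forall fun x => ?_)
    rw [Real.norm_eq_abs, abs_mul, abs_of_nonneg (ramp_nonneg _ _)]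
    exact (mul_le_of_le_one_left (abs_nonneg _) (ramp_le_one _ _)).trans (hA x)
  rw [← integral_sub hi1 hi2]
  calc |∫ x, ({x : RedSpace d T | κ' < (x.2.2 : ℝ)}.indicator φ x -
          ramp δ ((x.2.2 : ℝ) - κ) * φ x) ∂P|
      ≤ ∫ x, {x : RedSpace d T | |(x.2.2 : ℝ) - κ| ≤ δ}.indicator (fun _ => A) x ∂P := by
        rw [← Real.norm_eq_abs]
        refine norm_integral_le_of_norm_le ((integrable_const (μ := P) A).indicator hB)
          (Eventually.of_forall fun x => ?_)
        rw [Real.norm_eq_abs]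
        obtain ⟨h1, h2⟩ := abs_le.1 hκ
        have hbd : ∀ i : ℝ, 0 ≤ i → i ≤ 1 → |i * φ x - ramp δ ((x.2.2 : ℝ) - κ) * φ x| ≤ A := by
          intro i hi0 hi1
          rw [← sub_mul, abs_mul]
          refine (mul_le_of_le_one_left (abs_nonneg _) (abs_le.2 ⟨?_, ?_⟩)).trans (hA x)
          · linarith [ramp_le_one δ ((x.2.2 : ℝ) - κ)]
          · linarith [ramp_nonneg δ ((x.2.2 : ℝ) - κ)]
        have hind : {x : RedSpace d T | κ' < (x.2.2 : ℝ)}.indicator φ x =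
            (if κ' < (x.2.2 : ℝ) then 1 else 0) * φ x := by
          simp [indicator_apply]
        by_cases hx : |(x.2.2 : ℝ) - κ| ≤ δ
        · rw [indicator_of_mem (show x ∈ {x : RedSpace d T | |(x.2.2 : ℝ) - κ| ≤ δ} from hx), hind]
          refine hbd _ ?_ ?_ <;> split_ifs <;> norm_num
        · rw [indicator_of_notMem (show x ∉ {x : RedSpace d T | |(x.2.2 : ℝ) - κ| ≤ δ} from hx),
            hind]
          rcases lt_abs.1 (not_le.1 hx) with h | h
          · rw [ramp_of_le hδ h.le, if_pos (by linarith)]; simp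
          · rw [ramp_of_nonpos hδ (by linarith), if_neg (by linarith)]; simp
    _ = A * P.real {x | |(x.2.2 : ℝ) - κ| ≤ δ} := by
        rw [integral_indicator hB, setIntegral_const, smul_eq_mul, mul_comm]

end

section

variable {d : ℕ} {T : ℝ}

/-! ### Convergence of killed laws in the bounded-Lipschitz distance -/

theorem lipschitzWith_mul_ramp {f : E d → ℝ} (hf : f ∈ BLBall (E d)) (t : Time T) {δ κ : ℝ}
    (hδ : 0 < δ) :
    LipschitzWith (1 + δ⁻¹).toNNReal
      fun x : RedSpace d T => ramp δ ((x.2.2 : ℝ) - κ) * f (x.1 t) := by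
  refine LipschitzWith.of_dist_le_mul fun x y => ?_
  rw [Real.coe_toNNReal _ (by positivity), Real.dist_eq]
  have h1 : |f (x.1 t) - f (y.1 t)| ≤ dist x y := by
    have := hf.2.dist_le_mul (x.1 t) (y.1 t)
    rw [NNReal.coe_one, one_mul, Real.dist_eq] at this
    exact this.trans ((ContinuousMap.dist_apply_le_dist t).trans (le_max_left _ _))
  have h2 : |ramp δ ((x.2.2 : ℝ) - κ) - ramp δ ((y.2.2 : ℝ) - κ)| ≤ δ⁻¹ * dist x y := by
    refine (abs_ramp_sub_le hδ _ _).trans ?_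
    gcongr
    rw [sub_sub_sub_cancel_right]
    exact (le_max_right (dist x.2.1 y.2.1) (dist x.2.2 y.2.2)).trans (le_max_right _ _)
  calc |ramp δ ((x.2.2 : ℝ) - κ) * f (x.1 t) - ramp δ ((y.2.2 : ℝ) - κ) * f (y.1 t)|
      = |ramp δ ((x.2.2 : ℝ) - κ) * (f (x.1 t) - f (y.1 t)) +
          (ramp δ ((x.2.2 : ℝ) - κ) - ramp δ ((y.2.2 : ℝ) - κ)) * f (y.1 t)| := by ring_nf
    _ ≤ |ramp δ ((x.2.2 : ℝ) - κ)| * |f (x.1 t) - f (y.1 t)| +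
          |ramp δ ((x.2.2 : ℝ) - κ) - ramp δ ((y.2.2 : ℝ) - κ)| * |f (y.1 t)| := by
        rw [← abs_mul, ← abs_mul]; exact abs_add_le _ _
    _ ≤ 1 * dist x y + (δ⁻¹ * dist x y) * 1 := by
        gcongr
        · rw [abs_of_nonneg (ramp_nonneg _ _)]; exact ramp_le_one _ _
        · exact hf.1 _
    _ = (1 + δ⁻¹) * dist x y := by ring

theorem dBL_le_of_forall {μ ν : SubProb (E d)} {ε : ℝ}
    (h : ∀ f ∈ BLBall (E d), |∫ x, f x ∂μ.toMeasure - ∫ x, f x ∂ν.toMeasure| ≤ ε) :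
    edist μ ν ≤ ENNReal.ofReal ε := by
  refine iSup₂_le fun f hf => ?_
  rw [edist_dist, Real.dist_eq]
  exact ENNReal.ofReal_le_ofReal (h f hf)

/-- Each of the two indicators is exchanged for the same ramp at cost `ε/3`. The ramped test
functions have a Lipschitz constant independent of `t` and `f`, so weak convergence contributes the
last `ε/3` uniformly in time. -/
theorem eventually_edist_killedLaw_le {c : ℝ≥0} {P : ProbabilityMeasure (RedSpace d T)}
    {Pn : ℕ → ProbabilityMeasure (RedSpace d T)} (hPn : ∀ n, Pn n ∈ boundedLaws d T c)
    (hlim : Tendsto Pn atTop (𝓝 P)) {k : C(Time T, ℝ)} {kn : ℕ → C(Time T, ℝ)}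
    (hk : Tendsto kn atTop (𝓝 k)) {ε : ℝ} (hε : 0 < ε) :
    ∀ᶠ n in atTop, ∀ t : Time T,
      edist (killedLaw (Pn n : Measure (RedSpace d T)) {x | kn n t < (x.2.2 : ℝ)} t)
        (killedLaw (P : Measure (RedSpace d T)) {x | k t < (x.2.2 : ℝ)} t)
        ≤ ENNReal.ofReal ε := by
  have hP : P ∈ boundedLaws d T c :=
    (isCompact_boundedLaws c).isClosed.mem_of_tendsto hlim (Eventually.of_forall hPn)
  obtain ⟨δ, hδ, hnear⟩ := exists_threshold_near_le (d := d) (T := T) c (η := ε / 3) (by positivity)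
  filter_upwards [eventually_integral_lipschitz_le hlim (1 + δ⁻¹).toNNReal (ε := ε / 3)
    (by positivity), Metric.tendsto_nhds.1 hk δ hδ] with n hn hkn t
  refine dBL_le_of_forall fun f hf => ?_
  have hfm : Measurable fun x : RedSpace d T => f (x.1 t) :=
    hf.2.continuous.measurable.comp (measurable_ctrl_apply t)
  have hfb : ∀ x : RedSpace d T, |f (x.1 t)| ≤ 1 := fun x => hf.1 _
  rw [integral_killedLaw _ (measurableSet_lt_threshold_real _) t hf.2.continuous,
    integral_killedLaw _ (measurableSet_lt_threshold_real _) t hf.2.continuous]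
  have hκ : |kn n t - k t| ≤ δ := by
    rw [← Real.dist_eq]
    exact (ContinuousMap.dist_apply_le_dist t).trans hkn.le
  have h1 := abs_integral_indicator_sub_ramp_le (Pn n : Measure (RedSpace d T)) hδ hκ hfm hfb
  have h2 := abs_integral_indicator_sub_ramp_le (P : Measure (RedSpace d T)) (κ := k t)
    (κ' := k t) hδ (by simpa using hδ.le) hfm hfb
  have h3 := hn _ (fun x => by
    rw [abs_mul, abs_of_nonneg (ramp_nonneg _ _)]
    exact mul_le_one₀ (ramp_le_one _ _) (abs_nonneg _) (hfb x))
    (lipschitzWith_mul_ramp hf t (κ := k t) hδ)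
  have h4 := hnear (Pn n) inferInstance (hPn n).2 (k t)
  have h5 := hnear P inferInstance hP.2 (k t)
  rw [one_mul] at h1 h2
  rw [abs_le] at *
  constructor <;> linarith [h1.1, h1.2, h2.1, h2.2, h3.1, h3.2]

/-- For `s` near `t` one ramp centred at `k(t)` approximates both indicators. What remains is at
most `E[min(2, ‖b̃_s - b̃_t‖)]`, which tends to `0` by continuity of paths. -/
theorem continuous_killedLaw {c : ℝ≥0} {P : ProbabilityMeasure (RedSpace d T)}
    (hP : P ∈ boundedLaws d T c) (k : C(Time T, ℝ)) :
    Continuous fun t => killedLaw (P : Measure (RedSpace d T)) {x | k t < (x.2.2 : ℝ)} t := by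
  refine continuous_iff_continuousAt.2 fun t => EMetric.tendsto_nhds.2 fun ε hε => ?_
  obtain ⟨η, h0, h1⟩ := ENNReal.lt_iff_exists_nnreal_btwn.1 hε
  have hη : (0 : ℝ) < η := by exact_mod_cast h0
  obtain ⟨δ, hδ, hnear⟩ := exists_threshold_near_le (d := d) (T := T) c (η := η / 3) (by positivity)
  have hm : Measurable fun q : RedSpace d T => q.1 t := measurable_ctrl_apply t
  have hcont : Continuous fun s : Time T =>
      ∫ x : RedSpace d T, min 2 ‖x.1 s - x.1 t‖ ∂(P : Measure (RedSpace d T)) := by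
    refine continuous_of_dominated (bound := fun _ => 2) (fun s => ?_) (fun s => ?_)
      (integrable_const _) ?_
    · exact (continuous_const.min ((continuous_ctrl_apply s).sub
        (continuous_ctrl_apply t)).norm).aestronglyMeasurable
    · refine Eventually.of_forall fun x => ?_
      rw [Real.norm_eq_abs, abs_of_nonneg (le_min zero_le_two (norm_nonneg _))]
      exact min_le_left _ _
    · exact Eventually.of_forall fun x =>
        continuous_const.min ((x.1.continuous.sub continuous_const).norm)
  have hF : ∀ᶠ s in 𝓝 t,
      ∫ x : RedSpace d T, min 2 ‖x.1 s - x.1 t‖ ∂(P : Measure (RedSpace d T)) < η / 3 := by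
    refine (hcont.tendsto t).eventually_lt_const ?_
    simp only [sub_self, norm_zero]
    simpa using hη
  filter_upwards [hF, Metric.tendsto_nhds.1 (k.continuous.tendsto t) δ hδ] with s hs hks
  refine lt_of_le_of_lt (dBL_le_of_forall (ε := η) fun f hf => ?_) (by simpa using h1)
  have hfm : ∀ r : Time T, Measurable fun x : RedSpace d T => f (x.1 r) := fun r =>
    hf.2.continuous.measurable.comp (measurable_ctrl_apply r)
  have hfb : ∀ (r : Time T) (x : RedSpace d T), |f (x.1 r)| ≤ 1 := fun r x => hf.1 _
  rw [integral_killedLaw _ (measurableSet_lt_threshold_real _) s hf.2.continuous,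
    integral_killedLaw _ (measurableSet_lt_threshold_real _) t hf.2.continuous]
  have e1 := abs_integral_indicator_sub_ramp_le (P : Measure (RedSpace d T)) (κ := k t)
    (κ' := k s) hδ hks.le (hfm s) (hfb s)
  have e2 := abs_integral_indicator_sub_ramp_le (P : Measure (RedSpace d T)) (κ := k t)
    (κ' := k t) hδ (by simpa using hδ.le) (hfm t) (hfb t)
  have hint : ∀ r : Time T, Integrable
      (fun x : RedSpace d T => ramp δ ((x.2.2 : ℝ) - k t) * f (x.1 r))
      (P : Measure (RedSpace d T)) := fun r => by
    refine Integrable.of_bound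
      ((continuous_ramp_threshold δ (k t)).measurable.mul (hfm r)).aestronglyMeasurable 1
      (Eventually.of_forall fun x => ?_)
    rw [Real.norm_eq_abs, abs_mul, abs_of_nonneg (ramp_nonneg _ _)]
    exact mul_le_one₀ (ramp_le_one _ _) (abs_nonneg _) (hfb r x)
  have hint2 : Integrable (fun x : RedSpace d T => min 2 ‖x.1 s - x.1 t‖)
      (P : Measure (RedSpace d T)) := by
    refine Integrable.of_bound (continuous_const.min ((continuous_ctrl_apply s).sub
        (continuous_ctrl_apply t)).norm).aestronglyMeasurable 2 (Eventually.of_forall fun x => ?_)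
    rw [Real.norm_eq_abs, abs_of_nonneg (le_min zero_le_two (norm_nonneg _))]
    exact min_le_left _ _
  have e3 : |∫ x : RedSpace d T, ramp δ ((x.2.2 : ℝ) - k t) * f (x.1 s) ∂(P : Measure _) -
      ∫ x : RedSpace d T, ramp δ ((x.2.2 : ℝ) - k t) * f (x.1 t) ∂(P : Measure _)| ≤ η / 3 := by
    rw [← integral_sub (hint s) (hint t), ← Real.norm_eq_abs]
    refine le_trans (norm_integral_le_of_norm_le hint2 (Eventually.of_forall fun x => ?_)) hs.le
    rw [← mul_sub, Real.norm_eq_abs, abs_mul, abs_of_nonneg (ramp_nonneg _ _)]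
    refine (mul_le_of_le_one_left (abs_nonneg _) (ramp_le_one _ _)).trans (le_min ?_ ?_)
    · have h5 := abs_le.1 (hfb s x)
      have h6 := abs_le.1 (hfb t x)
      exact abs_le.2 ⟨by linarith [h5.1, h6.2], by linarith [h5.2, h6.1]⟩
    · have := hf.2.dist_le_mul (x.1 s) (x.1 t)
      rwa [NNReal.coe_one, one_mul, Real.dist_eq, dist_eq_norm] at this
  have h5 := hnear P inferInstance hP.2 (k t)
  rw [one_mul] at e1 e2
  rw [abs_le] at *
  constructor <;> linarith [e1.1, e1.2, e2.1, e2.2, e3.1, e3.2]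

/-! ### Moments of the controlled path -/

/-- Split `b̃ = b + drift`. The Brownian part has second moment at most `T` times that of the
standard Gaussian; for the drift, `‖drift_t‖²` is at most `T` times the energy, whose mean is at
most `2c`. -/
theorem exists_lintegral_sq_le (hT : 0 < T) (c : ℝ≥0) :
    ∃ B : ℝ≥0, ∀ P ∈ boundedLaws d T c, ∀ t : Time T,
      ∫⁻ x, ‖x.1 t‖ₑ ^ 2 ∂(P : Measure (RedSpace d T)) ≤ B := by
  set G : ℝ≥0∞ := ∫⁻ z, ‖z‖ₑ ^ 2 ∂(stdGaussian (E d)) with hG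
  have hGtop : G ≠ ∞ := by
    have h := IsGaussian.memLp_id (stdGaussian (E d)) 2 (by norm_num)
    have h2 := lintegral_rpow_enorm_lt_top_of_eLpNorm_lt_top (by norm_num) (by norm_num) h.2
    refine ne_of_lt (lt_of_eq_of_lt ?_ h2)
    simp [hG]
  have hB : 2 * (ENNReal.ofReal T * G) + 2 * (ENNReal.ofReal T * (2 * c)) ≠ ∞ := by finiteness
  refine ⟨_, fun P hP t => le_of_le_of_eq ?_ (ENNReal.coe_toNNReal hB).symm⟩
  have hb : ∫⁻ x, ‖x.2.1 t‖ₑ ^ 2 ∂(P : Measure (RedSpace d T)) ≤ ENNReal.ofReal T * G := by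
    set o : Time T := ⟨0, le_rfl, hT.le⟩
    have ho : o ≤ t := t.2.1
    calc ∫⁻ x, ‖x.2.1 t‖ₑ ^ 2 ∂(P : Measure (RedSpace d T))
        = ∫⁻ x, ‖x.2.1 t - x.2.1 o‖ₑ ^ 2 ∂(P : Measure (RedSpace d T)) := by
          refine lintegral_congr_ae ?_
          filter_upwards [hP.1.start o rfl] with x hx
          rw [hx, sub_zero]
      _ = ∫⁻ y, ‖y‖ₑ ^ 2 ∂((P : Measure (RedSpace d T)).map fun x => x.2.1 t - x.2.1 o) :=
          (lintegral_map (f := fun y => ‖y‖ₑ ^ 2) (by fun_prop)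
            (continuous_increment o t).measurable).symm
      _ = ∫⁻ z, ‖Real.sqrt ((t : ℝ) - (o : ℝ)) • z‖ₑ ^ 2 ∂(stdGaussian (E d)) := by
          rw [hP.1.law o t ho, lintegral_map (by fun_prop) (by fun_prop)]
      _ ≤ ∫⁻ z, ENNReal.ofReal T * ‖z‖ₑ ^ 2 ∂(stdGaussian (E d)) := by
          refine lintegral_mono fun z => ?_
          rw [enorm_smul, mul_pow, ← ofReal_norm, Real.norm_of_nonneg (Real.sqrt_nonneg _),
            ← ENNReal.ofReal_pow (Real.sqrt_nonneg _), Real.sq_sqrt (by simpa using ho)]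
          gcongr
          have : (o : ℝ) = 0 := rfl
          rw [this, sub_zero]
          exact t.2.2
      _ = ENNReal.ofReal T * G := lintegral_const_mul _ (by fun_prop)
  have hd : ∫⁻ x, ‖drift x t‖ₑ ^ 2 ∂(P : Measure (RedSpace d T)) ≤ ENNReal.ofReal T * (2 * c) := by
    have h3 : ∫⁻ x, (1 / 2) * h1Energy (drift x) ∂(P : Measure (RedSpace d T)) ≤ c :=
      le_self_add.trans hP.2
    rw [lintegral_const_mul _ measurable_h1Energy_drift, one_div] at h3
    calc ∫⁻ x, ‖drift x t‖ₑ ^ 2 ∂(P : Measure (RedSpace d T))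
        ≤ ∫⁻ x, ENNReal.ofReal T * h1Energy (drift x) ∂(P : Measure (RedSpace d T)) :=
          lintegral_mono fun x => enorm_apply_sq_le_h1Energy hT _ t
      _ = ENNReal.ofReal T * ∫⁻ x, h1Energy (drift x) ∂(P : Measure (RedSpace d T)) :=
          lintegral_const_mul _ measurable_h1Energy_drift
      _ = ENNReal.ofReal T * (2 * (2⁻¹ * ∫⁻ x, h1Energy (drift x) ∂(P : Measure (RedSpace d T)))) := by
          rw [← mul_assoc 2, ENNReal.mul_inv_cancel (by norm_num) (by norm_num), one_mul]
      _ ≤ ENNReal.ofReal T * (2 * c) := by gcongr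
  have hmd : Measurable fun x : RedSpace d T => ‖drift x t‖ₑ ^ 2 :=
    (((continuous_eval_path t).comp continuous_drift).measurable.enorm).pow_const 2
  have hmb : Measurable fun x : RedSpace d T => ‖x.2.1 t‖ₑ ^ 2 :=
    (((continuous_eval_path t).comp (continuous_fst.comp continuous_snd)).measurable.enorm).pow_const 2
  calc ∫⁻ x, ‖x.1 t‖ₑ ^ 2 ∂(P : Measure (RedSpace d T))
      ≤ ∫⁻ x, (2 * ‖x.2.1 t‖ₑ ^ 2 + 2 * ‖drift x t‖ₑ ^ 2) ∂(P : Measure (RedSpace d T)) := by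
        refine lintegral_mono fun x => ?_
        have h1 : x.1 t = x.2.1 t + drift x t := by simp [drift]
        have h2 : ‖x.1 t‖₊ ^ 2 ≤ 2 * ‖x.2.1 t‖₊ ^ 2 + 2 * ‖drift x t‖₊ ^ 2 := by
          rw [h1]
          refine (pow_le_pow_left₀ zero_le (nnnorm_add_le _ _) 2).trans ?_
          rw [← NNReal.coe_le_coe]
          push_cast
          nlinarith [sq_nonneg (‖x.2.1 t‖ - ‖drift x t‖)]
        simp only [enorm_eq_nnnorm]
        exact_mod_cast h2
    _ = 2 * ∫⁻ x, ‖x.2.1 t‖ₑ ^ 2 ∂(P : Measure (RedSpace d T)) +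
        2 * ∫⁻ x, ‖drift x t‖ₑ ^ 2 ∂(P : Measure (RedSpace d T)) := by
        rw [lintegral_add_left (hmb.const_mul 2), lintegral_const_mul _ hmb,
          lintegral_const_mul _ hmd]
    _ ≤ _ := by gcongr

end

section

variable {d : ℕ} {T : ℝ}

/-! ### The accumulated killing rate -/

/-- Growth of the killing rate slower than the square of the norm. -/
def SubquadraticGrowth (ζ : E d → ℝ≥0) : Prop :=
  ∀ ε : ℝ≥0, 0 < ε → ∃ A : ℝ≥0, ∀ x, ζ x ≤ A + ε * ‖x‖₊ ^ 2

/-- Since `r^p = r² r^{-(2-p)}` and `p < 2`, one has `C r^p ≤ ε r²` beyond some radius `R`; inside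
it `C r^p ≤ C R^p`. -/
theorem subquadraticGrowth_of_rpow {ζ : E d → ℝ≥0} {p C : ℝ} (hp : 0 ≤ p) (hp2 : p < 2)
    (hC : 0 < C) (h : ∀ x, (ζ x : ℝ) ≤ C * (1 + ‖x‖ ^ p)) : SubquadraticGrowth ζ := by
  intro ε hε
  have hlim : Tendsto (fun r : ℝ => r ^ (-(2 - p))) atTop (𝓝 0) :=
    tendsto_rpow_neg_atTop (by linarith)
  have hεC : (0 : ℝ) < ε / C := div_pos (by exact_mod_cast hε) hC
  obtain ⟨R, hR1, hR⟩ := ((eventually_ge_atTop (1 : ℝ)).and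
    (eventually_forall_ge_atTop.2 (hlim.eventually_lt_const hεC))).exists
  refine ⟨(C * (1 + R ^ p)).toNNReal, fun x => ?_⟩
  have hR0 : 0 ≤ R := by linarith
  rw [← NNReal.coe_le_coe]
  push_cast
  rw [Real.coe_toNNReal _ (by positivity)]
  refine (h x).trans ?_
  have key : C * ‖x‖ ^ p ≤ C * R ^ p + ε * ‖x‖ ^ 2 := by
    rcases le_total ‖x‖ R with hx | hx
    · have : ‖x‖ ^ p ≤ R ^ p := Real.rpow_le_rpow (norm_nonneg _) hx hp
      have h3 : (0 : ℝ) ≤ ε * ‖x‖ ^ 2 := by positivity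
      nlinarith
    · have hx0 : 0 < ‖x‖ := by linarith
      have h4 := hR _ hx
      have h5 : ‖x‖ ^ p = ‖x‖ ^ 2 * ‖x‖ ^ (-(2 - p)) := by
        rw [← Real.rpow_natCast, ← Real.rpow_add hx0]
        congr 1
        push_cast
        ring
      have h6 : C * ‖x‖ ^ (-(2 - p)) ≤ ε := by
        rw [lt_div_iff₀ hC] at h4
        linarith
      have h7 : 0 ≤ C * R ^ p := by positivity
      calc C * ‖x‖ ^ p = (C * ‖x‖ ^ (-(2 - p))) * ‖x‖ ^ 2 := by rw [h5]; ring
        _ ≤ ε * ‖x‖ ^ 2 := by gcongr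
        _ ≤ _ := le_add_of_nonneg_left h7
  linarith

/-- A rate bounded by `R` makes the accumulated rate `R`-Lipschitz. The bound is recorded in Hölder
form, through `|s - t| ≤ √T √|s - t|`, to match `isCompact_holder`. -/
theorem exists_killing_path (hT : 0 < T) {ζ : E d → ℝ≥0} {ϖ : Time T → SubProb (E d)} {R : ℝ≥0}
    (hR : ∀ s, ∫⁻ x, (ζ x : ℝ≥0∞) ∂(ϖ s).toMeasure ≤ R) :
    ∃ k : C(Time T, ℝ), (∀ t, killing ζ ϖ t = ENNReal.ofReal (k t)) ∧ (∀ t, 0 ≤ k t) ∧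
      (∀ t, ‖k t‖ ≤ R * T) ∧ ∀ s t, ‖k s - k t‖ ≤ (R * √T) * √|(s : ℝ) - t| := by
  have hkill : ∀ t, killing ζ ϖ t = ∫⁻ s in Iic t, ∫⁻ x, (ζ x : ℝ≥0∞) ∂(ϖ s).toMeasure :=
    fun t => rfl
  have hle : ∀ t, killing ζ ϖ t ≤ ENNReal.ofReal (R * T) := fun t => by
    rw [hkill]
    calc _ ≤ ∫⁻ s in Iic t, (R : ℝ≥0∞) := lintegral_mono fun s => hR s
      _ = R * ENNReal.ofReal t := by rw [setLIntegral_const, volume_Iic_time]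
      _ ≤ R * ENNReal.ofReal T := by gcongr; exact t.2.2
      _ = ENNReal.ofReal (R * T) := by
          rw [ENNReal.ofReal_mul (NNReal.coe_nonneg R), ENNReal.ofReal_coe_nnreal]
  have hfin : ∀ t, killing ζ ϖ t ≠ ∞ := fun t => ((hle t).trans_lt ENNReal.ofReal_lt_top).ne
  have hinc : ∀ s t : Time T, s ≤ t → (killing ζ ϖ s).toReal ≤ (killing ζ ϖ t).toReal ∧
      (killing ζ ϖ t).toReal ≤ (killing ζ ϖ s).toReal + R * ((t : ℝ) - s) := by
    intro s t hst
    have hsplit : killing ζ ϖ t = killing ζ ϖ s +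
        ∫⁻ s in Ioc s t, ∫⁻ x, (ζ x : ℝ≥0∞) ∂(ϖ s).toMeasure := by
      have hdisj : Disjoint (Iic s) (Ioc s t) :=
        disjoint_left.2 fun x hx hx' => not_lt.2 hx hx'.1
      rw [hkill t, hkill s, ← Iic_union_Ioc_eq_Iic hst, lintegral_union measurableSet_Ioc hdisj]
    have hst' : (0 : ℝ) ≤ (t : ℝ) - s := sub_nonneg.2 hst
    have h1 : ∫⁻ s in Ioc s t, ∫⁻ x, (ζ x : ℝ≥0∞) ∂(ϖ s).toMeasure
        ≤ ENNReal.ofReal (R * ((t : ℝ) - s)) := by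
      calc _ ≤ ∫⁻ s in Ioc s t, (R : ℝ≥0∞) := lintegral_mono fun s => hR s
        _ = R * ENNReal.ofReal ((t : ℝ) - s) := by rw [setLIntegral_const, volume_Ioc_time]
        _ = ENNReal.ofReal (R * ((t : ℝ) - s)) := by
            rw [ENNReal.ofReal_mul (NNReal.coe_nonneg R), ENNReal.ofReal_coe_nnreal]
    constructor
    · exact ENNReal.toReal_mono (hfin t) (hsplit ▸ le_self_add)
    · rw [hsplit, ENNReal.toReal_add (hfin s) (h1.trans_lt ENNReal.ofReal_lt_top).ne]
      gcongr
      exact ENNReal.toReal_le_of_le_ofReal (by positivity) h1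
  have hlip : ∀ s t : Time T, |(killing ζ ϖ s).toReal - (killing ζ ϖ t).toReal|
      ≤ R * |(s : ℝ) - t| := by
    have hw : ∀ s t : Time T, s ≤ t → |(killing ζ ϖ s).toReal - (killing ζ ϖ t).toReal|
        ≤ R * |(s : ℝ) - t| := fun s t hst => by
      obtain ⟨h1, h2⟩ := hinc s t hst
      have hst' : (s : ℝ) ≤ t := hst
      rw [abs_of_nonpos (by linarith), abs_of_nonpos (by linarith)]
      linarith
    intro s t
    rcases le_total s t with h | h
    · exact hw s t h
    · rw [abs_sub_comm, abs_sub_comm (s : ℝ)]; exact hw t s h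
  have hcont : Continuous fun t => (killing ζ ϖ t).toReal :=
    (LipschitzWith.of_dist_le_mul (K := R) hlip).continuous
  refine ⟨⟨_, hcont⟩, fun t => (ENNReal.ofReal_toReal (hfin t)).symm,
    fun t => ENNReal.toReal_nonneg, fun t => ?_, fun s t => ?_⟩
  · change ‖(killing ζ ϖ t).toReal‖ ≤ _
    rw [Real.norm_of_nonneg ENNReal.toReal_nonneg]
    exact ENNReal.toReal_le_of_le_ofReal (by positivity) (hle t)
  · refine (hlip s t).trans ?_
    rw [mul_assoc]
    gcongr
    have h1 : |(s : ℝ) - t| ≤ T := by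
      rw [abs_le]; constructor <;> linarith [s.2.1, s.2.2, t.2.1, t.2.2]
    calc |(s : ℝ) - t| = √|(s : ℝ) - t| * √|(s : ℝ) - t| :=
          (Real.mul_self_sqrt (abs_nonneg _)).symm
      _ ≤ √T * √|(s : ℝ) - t| := by gcongr

theorem exists_lintegral_rate_le (hT : 0 < T) {ζ : E d → ℝ≥0} (hζ : Continuous ζ)
    (hg : SubquadraticGrowth ζ) (c : ℝ≥0) :
    ∃ R : ℝ≥0, ∀ P ∈ boundedLaws d T c, ∀ A : Set (RedSpace d T), MeasurableSet A →
      ∀ t : Time T, ∫⁻ x, (ζ x : ℝ≥0∞)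
        ∂(killedLaw (P : Measure (RedSpace d T)) A t).toMeasure ≤ R := by
  obtain ⟨B, hB⟩ := exists_lintegral_sq_le (d := d) hT c
  obtain ⟨a, ha⟩ := hg 1 one_pos
  refine ⟨a + B, fun P hP A hA t => ?_⟩
  rw [lintegral_killedLaw _ hA t hζ.measurable.coe_nnreal_ennreal]
  calc ∫⁻ x, A.indicator (fun x => (ζ (x.1 t) : ℝ≥0∞)) x ∂(P : Measure (RedSpace d T))
      ≤ ∫⁻ x, ((a : ℝ≥0∞) + ‖x.1 t‖ₑ ^ 2) ∂(P : Measure (RedSpace d T)) := by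
        refine lintegral_mono fun x => (indicator_le_self _ _ x).trans ?_
        have := ha (x.1 t)
        rw [one_mul] at this
        rw [enorm_eq_nnnorm]
        change (ζ (x.1 t) : ℝ≥0∞) ≤ _
        exact_mod_cast this
    _ = a + ∫⁻ x, ‖x.1 t‖ₑ ^ 2 ∂(P : Measure (RedSpace d T)) := by
        rw [lintegral_add_left measurable_const]; simp
    _ ≤ ((a + B : ℝ≥0) : ℝ≥0∞) := by
        push_cast; gcongr; exact hB P hP t

theorem measurable_lintegral_killedLaw {ζ : E d → ℝ≥0} (hζ : Continuous ζ)
    (P : ProbabilityMeasure (RedSpace d T)) (k : C(Time T, ℝ)) :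
    Measurable fun s : Time T => ∫⁻ x, (ζ x : ℝ≥0∞)
      ∂(killedLaw (P : Measure (RedSpace d T)) {x | k s < (x.2.2 : ℝ)} s).toMeasure := by
  have h1 : ∀ s : Time T, ∫⁻ x, (ζ x : ℝ≥0∞)
      ∂(killedLaw (P : Measure (RedSpace d T)) {x | k s < (x.2.2 : ℝ)} s).toMeasure =
      ∫⁻ x, {q : Time T × RedSpace d T | k q.1 < (q.2.2.2 : ℝ)}.indicator
        (fun q => (ζ (q.2.1 q.1) : ℝ≥0∞)) (s, x) ∂(P : Measure (RedSpace d T)) := fun s => by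
    rw [lintegral_killedLaw _ (measurableSet_lt_threshold_real _) s
      hζ.measurable.coe_nnreal_ennreal]
    rfl
  simp only [h1]
  refine Measurable.lintegral_prod_right' (Measurable.indicator ?_ ?_)
  · have : Continuous fun q : Time T × RedSpace d T => ζ (q.2.1 q.1) := by fun_prop
    exact this.measurable.coe_nnreal_ennreal
  · refine measurableSet_lt ?_ ?_
    · exact k.continuous.measurable.comp measurable_fst
    · exact measurable_redThreshold.coe_nnreal_real.comp measurable_snd

theorem integrable_ctrl_sq {P : ProbabilityMeasure (RedSpace d T)} {t : Time T} {B : ℝ≥0}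
    (hB : ∫⁻ x, ‖x.1 t‖ₑ ^ 2 ∂(P : Measure (RedSpace d T)) ≤ B) :
    Integrable (fun x => ‖x.1 t‖ ^ 2) (P : Measure (RedSpace d T)) ∧
      ∫ x, ‖x.1 t‖ ^ 2 ∂(P : Measure (RedSpace d T)) ≤ B := by
  have hm : Measurable fun x : RedSpace d T => ‖x.1 t‖ ^ 2 :=
    (measurable_ctrl_apply t).norm.pow_const 2
  have h1 : ∀ x : RedSpace d T, ENNReal.ofReal (‖x.1 t‖ ^ 2) = ‖x.1 t‖ₑ ^ 2 := fun x => by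
    rw [ENNReal.ofReal_pow (norm_nonneg _), ofReal_norm]
  constructor
  · refine ⟨hm.aestronglyMeasurable, ?_⟩
    rw [hasFiniteIntegral_iff_ofReal (Eventually.of_forall fun x => by positivity)]
    simp only [h1]
    exact hB.trans_lt ENNReal.coe_lt_top
  · rw [integral_eq_lintegral_of_nonneg_ae (Eventually.of_forall fun x => by positivity)
      hm.aestronglyMeasurable]
    simp only [h1]
    exact ENNReal.toReal_le_coe_of_le_coe hB

theorem lintegral_killedLaw_eq_ofReal {ζ : E d → ℝ≥0} (hζ : Continuous ζ) {a ε : ℝ≥0}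
    (hg : ∀ x, ζ x ≤ a + ε * ‖x‖₊ ^ 2) {P : ProbabilityMeasure (RedSpace d T)} {t : Time T}
    {B : ℝ≥0} (hB : ∫⁻ x, ‖x.1 t‖ₑ ^ 2 ∂(P : Measure (RedSpace d T)) ≤ B)
    {A : Set (RedSpace d T)} (hA : MeasurableSet A) :
    Integrable (fun x => (ζ (x.1 t) : ℝ)) (P : Measure (RedSpace d T)) ∧
    ∫⁻ x, (ζ x : ℝ≥0∞) ∂(killedLaw (P : Measure (RedSpace d T)) A t).toMeasure =
      ENNReal.ofReal (∫ x, A.indicator (fun x => (ζ (x.1 t) : ℝ)) x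
        ∂(P : Measure (RedSpace d T))) := by
  have hm : Measurable fun x : RedSpace d T => (ζ (x.1 t) : ℝ) :=
    (hζ.measurable.comp (measurable_ctrl_apply t)).coe_nnreal_real
  have hi : Integrable (fun x => (ζ (x.1 t) : ℝ)) (P : Measure (RedSpace d T)) := by
    refine Integrable.mono' ((integrable_const (a : ℝ)).add
      ((integrable_ctrl_sq hB).1.const_mul (ε : ℝ))) hm.aestronglyMeasurable
      (Eventually.of_forall fun x => ?_)
    rw [Real.norm_of_nonneg (NNReal.coe_nonneg _)]
    exact_mod_cast hg (x.1 t)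
  refine ⟨hi, ?_⟩
  rw [lintegral_killedLaw _ hA t hζ.measurable.coe_nnreal_ennreal,
    ofReal_integral_eq_lintegral_ofReal (hi.indicator hA)
      (Eventually.of_forall fun x => indicator_nonneg (fun _ _ => NNReal.coe_nonneg _) x)]
  refine lintegral_congr fun x => ?_
  by_cases hx : x ∈ A <;> simp [hx]

/-- Quantitative uniform integrability: the excess of `ζ` over the level `a` is at most `ε ‖x‖²`. -/
theorem abs_integral_indicator_sub_truncation_le {ζ : E d → ℝ≥0} (hζ : Continuous ζ) {a ε : ℝ≥0}
    (hg : ∀ x, ζ x ≤ a + ε * ‖x‖₊ ^ 2) {P : ProbabilityMeasure (RedSpace d T)} {t : Time T}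
    {B : ℝ≥0} (hB : ∫⁻ x, ‖x.1 t‖ₑ ^ 2 ∂(P : Measure (RedSpace d T)) ≤ B)
    {A : Set (RedSpace d T)} (hA : MeasurableSet A) :
    |∫ x, A.indicator (fun x => (ζ (x.1 t) : ℝ)) x ∂(P : Measure (RedSpace d T)) -
      ∫ x, A.indicator (fun x => min (ζ (x.1 t) : ℝ) a) x ∂(P : Measure (RedSpace d T))|
      ≤ ε * B := by
  have hm : Measurable fun x : RedSpace d T => (ζ (x.1 t) : ℝ) :=
    (hζ.measurable.comp (measurable_ctrl_apply t)).coe_nnreal_real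
  have hi := (lintegral_killedLaw_eq_ofReal hζ hg hB hA).1
  have hi2 : Integrable (fun x => min (ζ (x.1 t) : ℝ) a) (P : Measure (RedSpace d T)) :=
    hi.inf (integrable_const _)
  obtain ⟨hs1, hs2⟩ := integrable_ctrl_sq hB
  rw [← integral_sub (hi.indicator hA) (hi2.indicator hA), ← Real.norm_eq_abs]
  calc _ ≤ ∫ x, (ε : ℝ) * ‖x.1 t‖ ^ 2 ∂(P : Measure (RedSpace d T)) := by
        refine norm_integral_le_of_norm_le (hs1.const_mul _) (Eventually.of_forall fun x => ?_)
        have h1 : (ζ (x.1 t) : ℝ) ≤ a + ε * ‖x.1 t‖ ^ 2 := by exact_mod_cast hg (x.1 t)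
        have h2 : (0 : ℝ) ≤ ε * ‖x.1 t‖ ^ 2 := by positivity
        by_cases hx : x ∈ A
        · simp only [indicator_of_mem hx]
          rcases le_total (ζ (x.1 t) : ℝ) a with h | h
          · rw [min_eq_left h, sub_self, norm_zero]; exact h2
          · rw [min_eq_right h, Real.norm_of_nonneg (by linarith)]; linarith
        · simpa only [indicator_of_notMem hx, sub_self, norm_zero] using h2
    _ = ε * ∫ x, ‖x.1 t‖ ^ 2 ∂(P : Measure (RedSpace d T)) := integral_const_mul _ _
    _ ≤ ε * B := by gcongr

/-- Weak convergence does not suffice for unbounded `ζ` and a discontinuous indicator. Two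
truncations, two exchanges of indicator for ramp and one weak limit each cost at most `e/6`. -/
theorem tendsto_lintegral_killedLaw (hT : 0 < T) {ζ : E d → ℝ≥0} (hζ : Continuous ζ)
    (hg : SubquadraticGrowth ζ) {c : ℝ≥0} {P : ProbabilityMeasure (RedSpace d T)}
    {Pn : ℕ → ProbabilityMeasure (RedSpace d T)} (hPn : ∀ n, Pn n ∈ boundedLaws d T c)
    (hlim : Tendsto Pn atTop (𝓝 P)) {k : C(Time T, ℝ)} {kn : ℕ → C(Time T, ℝ)}
    (hk : Tendsto kn atTop (𝓝 k)) (t : Time T) :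
    Tendsto (fun n => ∫⁻ x, (ζ x : ℝ≥0∞)
        ∂(killedLaw (Pn n : Measure (RedSpace d T)) {x | kn n t < (x.2.2 : ℝ)} t).toMeasure) atTop
      (𝓝 (∫⁻ x, (ζ x : ℝ≥0∞)
        ∂(killedLaw (P : Measure (RedSpace d T)) {x | k t < (x.2.2 : ℝ)} t).toMeasure)) := by
  have hP : P ∈ boundedLaws d T c :=
    (isCompact_boundedLaws c).isClosed.mem_of_tendsto hlim (Eventually.of_forall hPn)
  obtain ⟨B, hB⟩ := exists_lintegral_sq_le (d := d) hT c
  obtain ⟨a₁, ha₁⟩ := hg 1 one_pos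
  have hA : ∀ κ : ℝ, MeasurableSet {x : RedSpace d T | κ < (x.2.2 : ℝ)} :=
    measurableSet_lt_threshold_real
  rw [(lintegral_killedLaw_eq_ofReal hζ ha₁ (hB P hP t) (hA (k t))).2]
  simp only [fun n => (lintegral_killedLaw_eq_ofReal hζ ha₁ (hB (Pn n) (hPn n) t) (hA (kn n t))).2]
  refine ENNReal.tendsto_ofReal (Metric.tendsto_nhds.2 fun e he => ?_)
  obtain ⟨ε, hε, hεB⟩ : ∃ ε : ℝ≥0, 0 < ε ∧ (ε : ℝ) * B ≤ e / 6 := by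
    refine ⟨(e / (6 * (B + 1))).toNNReal, Real.toNNReal_pos.2 (by positivity), ?_⟩
    rw [Real.coe_toNNReal _ (by positivity), div_mul_eq_mul_div, div_le_div_iff₀ (by positivity)
      (by norm_num)]
    nlinarith [NNReal.coe_nonneg B]
  obtain ⟨a, ha⟩ := hg ε hε
  have hηa : (a : ℝ) * (e / (6 * (a + 1))) ≤ e / 6 := by
    rw [mul_div_assoc', div_le_div_iff₀ (by positivity) (by norm_num)]
    nlinarith [NNReal.coe_nonneg a]
  obtain ⟨δ, hδ, hnear⟩ := exists_threshold_near_le (d := d) (T := T) c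
    (η := e / (6 * (a + 1))) (by positivity)
  set φ : RedSpace d T → ℝ := fun x => min (ζ (x.1 t) : ℝ) a with hφ
  have hφc : Continuous φ :=
    (NNReal.continuous_coe.comp (hζ.comp (continuous_ctrl_apply t))).min continuous_const
  have hφ0 : ∀ x, 0 ≤ φ x := fun x => le_min (NNReal.coe_nonneg _) (NNReal.coe_nonneg _)
  have hφb : ∀ x, |φ x| ≤ a := fun x => by
    rw [abs_of_nonneg (hφ0 x)]; exact min_le_right _ _
  let F : RedSpace d T →ᵇ ℝ := BoundedContinuousFunction.ofNormedAddCommGroup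
    (fun x => ramp δ ((x.2.2 : ℝ) - k t) * φ x) ((continuous_ramp_threshold δ (k t)).mul hφc) a
    (fun x => by
      rw [Real.norm_eq_abs, abs_mul, abs_of_nonneg (ramp_nonneg _ _)]
      exact (mul_le_of_le_one_left (abs_nonneg _) (ramp_le_one _ _)).trans (hφb x))
  have hF := ProbabilityMeasure.tendsto_iff_forall_integral_tendsto.1 hlim F
  filter_upwards [Metric.tendsto_nhds.1 hF (e / 6) (by positivity),
    Metric.tendsto_nhds.1 hk δ hδ] with n hn hkn
  have hκ : |kn n t - k t| ≤ δ := by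
    rw [← Real.dist_eq]
    exact (ContinuousMap.dist_apply_le_dist t).trans hkn.le
  have e1 := abs_integral_indicator_sub_truncation_le hζ ha (hB (Pn n) (hPn n) t) (hA (kn n t))
  have e2 := abs_integral_indicator_sub_truncation_le hζ ha (hB P hP t) (hA (k t))
  have e3 := abs_integral_indicator_sub_ramp_le (Pn n : Measure (RedSpace d T)) hδ hκ
    hφc.measurable hφb
  have e4 := abs_integral_indicator_sub_ramp_le (P : Measure (RedSpace d T)) (κ := k t)
    (κ' := k t) hδ (by simpa using hδ.le) hφc.measurable hφb
  have e5 : (a : ℝ) * (Pn n : Measure (RedSpace d T)).real {x | |(x.2.2 : ℝ) - k t| ≤ δ} ≤ e / 6 :=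
    (mul_le_mul_of_nonneg_left (hnear (Pn n) inferInstance (hPn n).2 (k t)) a.2).trans hηa
  have e6 : (a : ℝ) * (P : Measure (RedSpace d T)).real {x | |(x.2.2 : ℝ) - k t| ≤ δ} ≤ e / 6 :=
    (mul_le_mul_of_nonneg_left (hnear P inferInstance hP.2 (k t)) a.2).trans hηa
  change |∫ x, ramp δ ((x.2.2 : ℝ) - k t) * φ x ∂(Pn n : Measure (RedSpace d T)) -
    ∫ x, ramp δ ((x.2.2 : ℝ) - k t) * φ x ∂(P : Measure (RedSpace d T))| < e / 6 at hn
  rw [Real.dist_eq]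
  rw [abs_lt] at hn ⊢
  rw [abs_le] at e1 e2 e3 e4
  constructor <;> linarith [e1.1, e1.2, e2.1, e2.2, e3.1, e3.2, e4.1, e4.2, hn.1, hn.2]

end

section

variable {d : ℕ} {T : ℝ}

/-! ### Compactness of the sublevel sets -/

/-- Stability of the killed equation. Compactness is needed only for the scalar functions `k_n`;
once these converge, the killed laws follow. -/
theorem exists_killed_limit (hT : 0 < T) {ζ : E d → ℝ≥0} (hζ : Continuous ζ)
    (hg : SubquadraticGrowth ζ) {c : ℝ≥0} {P : ProbabilityMeasure (RedSpace d T)}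
    {Pn : ℕ → ProbabilityMeasure (RedSpace d T)} (hPn : ∀ n, Pn n ∈ boundedLaws d T c)
    (hlim : Tendsto Pn atTop (𝓝 P)) {ϖn : ℕ → Time T → SubProb (E d)}
    (hϖ : ∀ n t, ϖn n t = killedLaw (Pn n : Measure (RedSpace d T))
      {x | killing ζ (ϖn n) t < (x.2.2 : ℝ≥0∞)} t) :
    ∃ ψ : ℕ → ℕ, StrictMono ψ ∧ ∃ ϖ : Time T → SubProb (E d), Continuous ϖ ∧
      (∀ t, ϖ t = killedLaw (P : Measure (RedSpace d T))
        {x | killing ζ ϖ t < (x.2.2 : ℝ≥0∞)} t) ∧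
      ∀ ε : ℝ, 0 < ε → ∀ᶠ n in atTop, ∀ t, edist (ϖn (ψ n) t) (ϖ t) ≤ ENNReal.ofReal ε := by
  have hP : P ∈ boundedLaws d T c :=
    (isCompact_boundedLaws c).isClosed.mem_of_tendsto hlim (Eventually.of_forall hPn)
  obtain ⟨R, hR⟩ := exists_lintegral_rate_le hT hζ hg c
  have hset : ∀ {κ : ℝ} {a : ℝ≥0∞}, 0 ≤ κ → a = ENNReal.ofReal κ →
      {x : RedSpace d T | a < (x.2.2 : ℝ≥0∞)} = {x | κ < (x.2.2 : ℝ)} := by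
    intro κ a hκ ha
    ext x
    change a < (x.2.2 : ℝ≥0∞) ↔ κ < (x.2.2 : ℝ)
    rw [ha, ENNReal.ofReal_lt_coe_iff hκ]
  have hrate : ∀ n s, ∫⁻ x, (ζ x : ℝ≥0∞) ∂(ϖn n s).toMeasure ≤ R := fun n s => by
    rw [hϖ n s]
    exact hR _ (hPn n) _ (measurableSet_lt_threshold _) s
  choose kn hk1 hk2 hk3 hk4 using fun n => exists_killing_path hT (hrate n)
  obtain ⟨k, -, ψ, hψ, hkψ⟩ := (isCompact_holder (T := T) (F := ℝ) (R * √T) (R * T)).isSeqCompact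
    (x := kn) (fun n => ⟨hk3 n, hk4 n⟩)
  have hk0 : ∀ t, 0 ≤ k t := fun t =>
    ge_of_tendsto' (((continuous_eval_const t).tendsto k).comp hkψ) fun n => hk2 (ψ n) t
  have hϖ' : ∀ n t, ϖn n t = killedLaw (Pn n : Measure (RedSpace d T))
      {x | kn n t < (x.2.2 : ℝ)} t := fun n t => by
    rw [← hset (hk2 n t) (hk1 n t)]; exact hϖ n t
  have hlimψ := hlim.comp hψ.tendsto_atTop
  set ϖ : Time T → SubProb (E d) := fun t =>
    killedLaw (P : Measure (RedSpace d T)) {x | k t < (x.2.2 : ℝ)} t with hϖdef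
  -- Closes the fixed point: the accumulated rates converge to `killing ζ ϖ t` by dominated
  -- convergence and to `k t` by the choice of subsequence.
  have hkill : ∀ t, killing ζ ϖ t = ENNReal.ofReal (k t) := by
    intro t
    have h1 : Tendsto (fun n => killing ζ (ϖn (ψ n)) t) atTop (𝓝 (killing ζ ϖ t)) := by
      refine tendsto_lintegral_of_dominated_convergence (fun _ => (R : ℝ≥0∞)) (fun n => ?_)
        (fun n => Eventually.of_forall fun s => hrate (ψ n) s) ?_
        (Eventually.of_forall fun s => ?_)
      · simp only [hϖ']
        exact measurable_lintegral_killedLaw hζ _ _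
      · have : ∫⁻ _ in Iic t, (R : ℝ≥0∞) = R * ENNReal.ofReal t := by
          rw [setLIntegral_const, volume_Iic_time]
        exact ne_of_eq_of_ne this (by finiteness)
      · simp only [hϖ']
        exact tendsto_lintegral_killedLaw hT hζ hg (fun n => hPn (ψ n)) hlimψ hkψ s
    have h2 : Tendsto (fun n => killing ζ (ϖn (ψ n)) t) atTop (𝓝 (ENNReal.ofReal (k t))) := by
      simp only [hk1]
      exact ENNReal.tendsto_ofReal (((continuous_eval_const t).tendsto k).comp hkψ)
    exact tendsto_nhds_unique h1 h2
  refine ⟨ψ, hψ, ϖ, continuous_killedLaw hP k, fun t => ?_, fun ε hε => ?_⟩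
  · rw [hset (hk0 t) (hkill t)]
  · filter_upwards [eventually_edist_killedLaw_le (fun n => hPn (ψ n)) hlimψ hkψ hε] with n hn t
    rw [hϖ' (ψ n) t]
    exact hn t

theorem isCompact_rateFunction_le (hT : 0 < T) {ζ : E d → ℝ≥0} (hζ : Continuous ζ)
    (hg : SubquadraticGrowth ζ) (M : ℝ≥0) :
    IsCompact {π : Skorokhod T (SubProb (E d)) | rateFunction ζ π ≤ (M : ℝ≥0∞)} := by
  refine isCompact_iff_isSeqCompact.2 fun u hu => ?_
  -- The infimum is not known to be attained, so near-minimizers with vanishing slack `1/(n+1)` are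
  -- used.
  have hex : ∀ n : ℕ, ∃ Θ : ProbabilityMeasure (Xi d T),
      (Θ ∈ PInftyOne ζ ∧ IsKilledSolution ζ Θ (u n)) ∧
      cost Θ < (M : ℝ≥0∞) + ((1 / ((n : ℝ≥0) + 1) : ℝ≥0) : ℝ≥0∞) := fun n => by
    have h1 : rateFunction ζ (u n) < (M : ℝ≥0∞) + ((1 / ((n : ℝ≥0) + 1) : ℝ≥0) : ℝ≥0∞) :=
      (hu n).trans_lt (ENNReal.lt_add_right ENNReal.coe_ne_top
        (by simpa only [ne_eq, ENNReal.coe_eq_zero] using (by positivity : (0 : ℝ≥0) < _).ne'))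
    obtain ⟨Θ, hΘ⟩ := iInf_lt_iff.1 h1
    obtain ⟨hmem, hcost⟩ := iInf_lt_iff.1 hΘ
    exact ⟨Θ, hmem, hcost⟩
  choose Θ hΘ hcost using hex
  set Pn : ℕ → ProbabilityMeasure (RedSpace d T) := fun n =>
    (Θ n).map measurable_forgetControl.aemeasurable with hPndef
  have hPncost : ∀ n, redCost (Pn n : Measure (RedSpace d T)) ≤
      ((M + 1 / ((n : ℝ≥0) + 1) : ℝ≥0) : ℝ≥0∞) := fun n => by
    rw [ENNReal.coe_add]
    exact ((hΘ n).1.1.redCost_le).trans (hcost n).le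
  have hPn : ∀ (c : ℝ≥0) (n : ℕ), 1 / ((n : ℝ≥0) + 1) ≤ c → Pn n ∈ boundedLaws d T (M + c) :=
    fun c n hn => ⟨(hΘ n).1.1.admissible,
      (hPncost n).trans (ENNReal.coe_le_coe.2 (by gcongr))⟩
  have hPn1 : ∀ n, Pn n ∈ boundedLaws d T (M + 1) := fun n =>
    hPn 1 n (by rw [div_le_one (by positivity)]; exact le_add_self)
  obtain ⟨P, hP, φ, hφ, hlim⟩ := (isCompact_boundedLaws (M + 1)).isSeqCompact hPn1
  obtain ⟨ψ, hψ, ϖ, hϖc, hϖ, hconv⟩ := exists_killed_limit hT hζ hg (fun n => hPn1 (φ n)) hlim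
    (ϖn := fun n => u (φ n)) (fun n => (isKilledSolution_iff (P := Pn (φ n)) rfl).1 (hΘ (φ n)).2)
  -- For each `ε` the sequence eventually lies in the closed set `boundedLaws d T (M + ε)`, so the
  -- slack disappears in the limit.
  have hPM : redCost (P : Measure (RedSpace d T)) ≤ M := by
    refine ENNReal.le_of_forall_pos_le_add fun ε hε _ => ?_
    rw [← ENNReal.coe_add]
    have hev : ∀ᶠ n in atTop, (Pn ∘ φ) n ∈ boundedLaws d T (M + ε) := by
      have h0 : Tendsto (fun n : ℕ => 1 / ((n : ℝ≥0) + 1)) atTop (𝓝 0) :=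
        tendsto_one_div_add_atTop_nhds_zero_nat
      filter_upwards [hφ.tendsto_atTop.eventually (h0.eventually_le_const hε)] with n hn
      exact hPn ε _ hn
    exact ((isCompact_boundedLaws (M + ε)).isClosed.mem_of_tendsto hlim hev).2
  have hPtop : redCost (P : Measure (RedSpace d T)) < ∞ := hPM.trans_lt ENNReal.coe_lt_top
  have hE := ae_h1Energy_drift_lt_top hPtop
  let π : Skorokhod T (SubProb (E d)) :=
    ⟨ϖ, fun t => hϖc.continuousWithinAt, fun t => ⟨ϖ t, hϖc.continuousWithinAt⟩⟩
  have hsol : IsKilledSolution ζ (liftLaw P) π :=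
    (isKilledSolution_iff (liftLaw_map_forgetControl P)).2 hϖ
  have hcostP : cost (liftLaw P) = redCost (P : Measure (RedSpace d T)) := cost_liftLaw hE
  refine ⟨π, ?_, φ ∘ ψ, hφ.comp hψ, ?_⟩
  · have hmem : liftLaw P ∈ PInftyOne ζ :=
      ⟨hP.1.memPInfty_liftLaw hE (map_threshold_absolutelyContinuous hPtop),
        hcostP.trans_lt hPtop, ϖ, hϖc.measurable, hsol⟩
    have hrate : rateFunction ζ π ≤ cost (liftLaw P) := by
      have h0 : liftLaw P ∈ {Θ : ProbabilityMeasure (Xi d T) |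
          Θ ∈ PInftyOne ζ ∧ IsKilledSolution ζ Θ π} := ⟨hmem, hsol⟩
      exact biInf_le cost h0
    exact hrate.trans (hcostP.trans_le hPM)
  · refine EMetric.tendsto_nhds.2 fun ε hε => ?_
    obtain ⟨η, h0, h1⟩ := ENNReal.lt_iff_exists_nnreal_btwn.1 hε
    filter_upwards [hconv η (by exact_mod_cast h0)] with n hn
    -- Convergence is uniform in time, so the identity time change suffices.
    refine lt_of_le_of_lt (iInf_le_of_le (OrderIso.refl _) (max_le ?_ (iSup_le hn))) ?_
    · simp
    · simpa using h1

theorem lowerSemicontinuous_of_isCompact_le {X : Type*} [TopologicalSpace X] [T2Space X]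
    {f : X → ℝ≥0∞} (h : ∀ M : ℝ≥0, IsCompact {x | f x ≤ M}) : LowerSemicontinuous f := by
  refine lowerSemicontinuous_iff_isClosed_preimage.2 fun c => ?_
  induction c with
  | top => simp
  | coe c => exact (h c).isClosed

end

end KilledBM

end

/-! ### The proposition. -/

theorem proposition8p1 (d : ℕ) (T : ℝ) (hT : 0 < T) (ζ : KilledBM.E d → ℝ≥0)
    (hζ : Continuous ζ)
    (hgrowth : ∃ p C : ℝ, 0 ≤ p ∧ p < 2 ∧ 0 < C ∧ ∀ x, (ζ x : ℝ) ≤ C * (1 + ‖x‖ ^ p)) :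
    (∀ M : ℝ≥0, IsCompact
      {π : KilledBM.Skorokhod T (KilledBM.SubProb (KilledBM.E d)) |
        KilledBM.rateFunction ζ π ≤ (M : ℝ≥0∞)}) ∧
    LowerSemicontinuous
      (fun π : KilledBM.Skorokhod T (KilledBM.SubProb (KilledBM.E d)) =>
        KilledBM.rateFunction ζ π) := by
  obtain ⟨p, C, hp, hp2, hC, h⟩ := hgrowth
  have hcompact := KilledBM.isCompact_rateFunction_le hT hζ
    (KilledBM.subquadraticGrowth_of_rpow hp hp2 hC h)
  exact ⟨hcompact, KilledBM.lowerSemicontinuous_of_isCompact_le hcompact⟩
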